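/- Let $K$ be a field of characteristic $0$. **The algebras.** Let $x$ be an even and $X$ an odd variable, of grades $g(x)=1$, $g(X)=-1$. The Buttin superalgebra $B(1)$ consists of the generating functions $f(x)+g(x)X$ with $f,g\in K[[x]]$, with bracket $$\{F,G\}=\frac{\partial F}{\partial x}\frac{\partial G}{\partial X}+(-1)^{p(F)}\frac{\partial F}{\partial X}\frac{\partial G}{\partial x};$$ even generating functions are the odd elements of the algebra and vice versa. $SB(1)=\{F\in B(1):\partial^2F/\partial x\,\partial X=0\}$ has the (topological) basis $X$, $x^i$ ($i\ge 0$), and $[X,x^i]=-i\,x^{i-1}$, $[x^i,x^j]=0$. $SLe(1)=SB(1)/\mathrm{Span}\{1\}$. **Cohomology.** For $A=SB(1)$ or $SLe(1)$ let $C^k_g(A)$ be the space of continuous super skew-symmetric $k$-linear forms on $A$ that vanish on homogeneous arguments whose grades do not add up to $g$. With the Lie superalgebra differential for the trivial module $K$, let $Z^k_g$, $B^k_g$ be the cocycles and coboundaries and $H^k_g(A)=Z^k_g/B^k_g$. $C(X)$, $C(x^i)$ are the $1$-cochains dual to the basis elements, and $C(b_1,\dots,b_k)=C(b_1)\wedge\dots\wedge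 C(b_k)$. "Deleting the terms with argument $1$" turns a cochain of $SB(1)$ into a cochain of $SLe(1)$. **Table.** Let $N(k,g)$ be the number of entries of the following table in degree $k$ and grade $g$ ($1\le k\le 10$, $g\le 10$); the grades are listed with multiplicity, a star marks one of the entries of that degree and grade: - $k=1$: $-1^*$ - $k=2$: none - $k=3$: $1,\ 3^*,\ 5^*,\ 7^*,\ 9^*$ - $k=4$: $2,\ 4,\ 5^*,\ 6,\ 7^*,\ 8^*,8,\ 9^*,\ 10^*,10$ - $k=5$: $3,\ 5,\ 6,\ 7^*,7,\ 8,\ 9^*,9,9,\ 10^*,10$ - $k=6$: $4,\ 6,\ 7,\ 8,8,\ 9^*,9,\ 10,10,10$ - $k=7$: $5,\ 7,\ 8,\ 9,9,\ 10,10$ - $k=8$: $6,\ 8,\ 9,\ 10,10$ - $k=9$: $7,\ 9,\ 10$ - $k=10$: $8,\ 10$ **Statement.** There are $N(k,g)$ cocycles of $SB(1)$ of each degree $k$ and grade $g$ (the generating cocycles $a^k_g,b^k_g,c^k_g$; if one of them is starred, it is $a^k_g$) with the following properties. 1. $a^1_{-1}=C(X)$, and for $0\le m\le 4$ $$a^3_{2m+1}=\sum_{i=0}^{m}(-1)^i\binom{2m+2}{i}C(X,x^i,x^{2m+2-i})+\frac{(-1)^{m+1}}{2}\binom{2m+2}{m+1}C(X,x^{m+1},x^{m+1}).$$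 2. For $1\le k\le 10$ and $g\le 10$, the classes of all products $c\wedge C(1)^{\wedge(k-k')}$, where $c$ is a generating cocycle of degree $k'\le k$ and grade $g$, form a basis of $H^k_g(SB(1))$. 3. Deleting the terms with argument $1$ from the starred cocycles gives generating cocycles of $SLe(1)$: for $1\le k\le 10$ and $g\le 10$, the classes of all products $c\wedge C(x)^{\wedge(k-k')}$, where $c$ arises from a starred cocycle of degree $k'\le k$ and grade $g-(k-k')$, form a basis of $H^k_g(SLe(1))$. 4. Deleting the terms with argument $1$ from $a^3_1$ gives the cocycle $-C(X)\wedge C(x)\wedge C(x)$ of $SLe(1)$; it is not a coboundary, but it is a consequence of $C(X)$. 5. For $0\le m\le 4$ a cocycle $C$ of degree $3$ and grade $2m+1$, of $SB(1)$ or of $SLe(1)$, is a coboundary if and only if the expression for $a^3_{2m+1}$ in 1 vanishes when $C(X,x^i,x^j)$ is read as the value of $C$ at the arguments $X,x^i,x^j$ (which is $0$ for $SLe(1)$ if one of them is $1$). -/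

import Mathlib

open PowerSeries

noncomputable section

/-! ### Lie superalgebras with a grading by the integers -/

/-- A `ℤ`-graded Lie superalgebra over a field `K` (of characteristic other than `2, 3`).
The decomposition `A = A₀ ⊕ A₁` into even and odd part is given by its two projections `par 0`,
`par 1`, and the grading by the projections `comp n` on the homogeneous components, an element
being a possibly infinite (formal) sum of its homogeneous components. An element `a` is
homogeneous of parity `p` if `par p a = a`, and homogeneous of grade `n` if `comp n a = a`. -/
structure GradedLieSuperalgebra (K A : Type*) [Field K] [AddCommGroup A] [Module K A] where
  bracket : A →ₗ[K] A →ₗ[K] A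
  par : ZMod 2 → A →ₗ[K] A
  comp : ℤ → A →ₗ[K] A
  par_add : ∀ a, par 0 a + par 1 a = a
  par_par : ∀ p q a, par p (par q a) = if p = q then par q a else 0
  comp_comp : ∀ m n a, comp m (comp n a) = if m = n then comp n a else 0
  comp_par : ∀ n p a, comp n (par p a) = par p (comp n a)
  ext_comp : ∀ a, (∀ n, comp n a = 0) → a = 0
  par_bracket : ∀ p q a b,
    par (p + q) (bracket (par p a) (par q b)) = bracket (par p a) (par q b)
  comp_bracket : ∀ m n a b,
    comp (m + n) (bracket (comp m a) (comp n b)) = bracket (comp m a) (comp n b)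
  skew : ∀ p q a b,
    bracket (par p a) (par q b) = -((-1 : K) ^ (p * q).val • bracket (par q b) (par p a))
  jacobi : ∀ p q a b c,
    bracket (par p a) (bracket (par q b) c) =
      bracket (bracket (par p a) (par q b)) c +
        (-1 : K) ^ (p * q).val • bracket (par q b) (bracket (par p a) c)

namespace GradedLieSuperalgebra

variable {K A : Type*} [Field K] [AddCommGroup A] [Module K A] (L : GradedLieSuperalgebra K A)

/-! ### Cochains with values in the trivial module, and their cohomology

A `k`-cochain is a function `(Fin k → A) → K` that lies in `L.cochains k g` for its grade `g`. -/

/-- Super skew-symmetry: a transposition of adjacent odd arguments changes nothing, all other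
transpositions of adjacent homogeneous arguments change the sign. -/
def IsSuperSkew {k : ℕ} (C : (Fin k → A) → K) : Prop :=
  ∀ i j : Fin k, (i : ℕ) + 1 = j → ∀ (p q : ZMod 2) (a : Fin k → A),
    L.par p (a i) = a i → L.par q (a j) = a j →
      C (a ∘ Equiv.swap i j) = -((-1) ^ (p * q).val * C a)

/-- Cochains of grade `g` vanish on homogeneous arguments whose grades do not add up to `g`. -/
def IsOfGrade {k : ℕ} (g : ℤ) (C : (Fin k → A) → K) : Prop :=
  ∀ (a : Fin k → A) (n : Fin k → ℤ), (∀ i, L.comp (n i) (a i) = a i) → ∑ i, n i ≠ g → C a = 0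

/-- Continuity of a multilinear form for the topology of formal series: there is an `N` such that
the form does not see the terms of grade larger than `N` of its arguments. -/
def IsContinuous {k : ℕ} (C : (Fin k → A) → K) : Prop :=
  ∃ N : ℤ, ∀ (a : Fin k → A) (i : Fin k), (∀ n ≤ N, L.comp n (a i) = 0) → C a = 0

/-- The space of `k`-cochains of grade `g` with values in the trivial module `K`. -/
def cochains (k : ℕ) (g : ℤ) : Submodule K ((Fin k → A) → K) where
  carrier := {C | (∃ f : MultilinearMap K (fun _ : Fin k => A) K, C = ⇑f) ∧
    L.IsSuperSkew C ∧ L.IsOfGrade g C ∧ L.IsContinuous C}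
  zero_mem' := by
    refine ⟨⟨0, rfl⟩, ?_, ?_, ⟨0, ?_⟩⟩
    · intro i j _ p q a _ _; simp
    · intro a n _ _; rfl
    · intro a i _; rfl
  add_mem' := by
    rintro C D ⟨⟨f, hf⟩, hs, hg, N, hN⟩ ⟨⟨f', hf'⟩, hs', hg', N', hN'⟩
    refine ⟨⟨f + f', by subst hf; subst hf'; rfl⟩, ?_, ?_, ⟨max N N', ?_⟩⟩
    · intro i j hij p q a hp hq
      simp only [Pi.add_apply, hs i j hij p q a hp hq, hs' i j hij p q a hp hq]
      ring
    · intro a n h h'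
      simp only [Pi.add_apply, hg a n h h', hg' a n h h', add_zero]
    · intro a i h
      simp only [Pi.add_apply, hN a i fun n hn => h n (le_trans hn (le_max_left _ _)),
        hN' a i fun n hn => h n (le_trans hn (le_max_right _ _)), add_zero]
  smul_mem' := by
    rintro r C ⟨⟨f, hf⟩, hs, hg, N, hN⟩
    refine ⟨⟨r • f, by subst hf; rfl⟩, ?_, ?_, ⟨N, ?_⟩⟩
    · intro i j hij p q a hp hq
      simp only [Pi.smul_apply, hs i j hij p q a hp hq, smul_eq_mul]
      ring
    · intro a n h h'
      simp only [Pi.smul_apply, hg a n h h', smul_zero]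
    · intro a i h
      simp only [Pi.smul_apply, hN a i h, smul_zero]

/-- `twist ε a = (-1) ^ (ε p(a)) a` for `a` homogeneous of parity `p(a)`. -/
def twist (ε : ZMod 2) (a : A) : A := L.par 0 a + (-1 : K) ^ ε.val • L.par 1 a

/-- The differential for the trivial module: on homogeneous arguments
`dC(a₀, …, a_k) = ∑_{i < j} ± C(a₀, …, a_{i-1}, [a_i, a_j], a_{i+1}, …, â_j, …, a_k)`
with the sign `(-1) ^ (j + p(a_j) (p(a_{i+1}) + ⋯ + p(a_{j-1})))`. If all even arguments precede
the odd ones this sign is `(-1)^j`, `(-1)^{q+1}` or `(-1)^{i+1}`, according as `a_i, a_j` are both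
even, `a_i` is even and `a_j` is odd, or both are odd, where `a_q` is the last even argument. -/
def d (k : ℕ) : ((Fin k → A) → K) →ₗ[K] ((Fin (k + 1) → A) → K) where
  toFun C a := ∑ i : Fin (k + 1), ∑ j : Fin (k + 1), if i < j then
    (-1) ^ (j : ℕ) * ∑ ε : ZMod 2, C (fun m =>
      if j.succAbove m = i then L.bracket (a i) (L.par ε (a j))
      else if i < j.succAbove m ∧ j.succAbove m < j then L.twist ε (a (j.succAbove m))
      else a (j.succAbove m))
    else 0
  map_add' C D := by
    funext a
    simp only [Pi.add_apply, ← Finset.sum_add_distrib]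
    refine Finset.sum_congr rfl fun i _ => Finset.sum_congr rfl fun j _ => ?_
    split_ifs
    · rw [Finset.sum_add_distrib, mul_add]
    · simp
  map_smul' r C := by
    funext a
    simp only [Pi.smul_apply, smul_eq_mul, RingHom.id_apply]
    rw [Finset.mul_sum]
    refine Finset.sum_congr rfl fun i _ => ?_
    rw [Finset.mul_sum]
    refine Finset.sum_congr rfl fun j _ => ?_
    split_ifs
    · rw [← Finset.mul_sum]
      ring
    · simp

/-- The space `Z^k_g` of cocycles. -/
def cocycles (k : ℕ) (g : ℤ) : Submodule K ((Fin k → A) → K) :=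
  L.cochains k g ⊓ LinearMap.ker (L.d k)

/-- The space `B^k_g` of coboundaries. -/
def coboundaries : (k : ℕ) → (g : ℤ) → Submodule K ((Fin k → A) → K)
  | 0, _ => ⊥
  | k + 1, g => Submodule.map (L.d k) (L.cochains k g)

/-- The cohomology `H^k_g = Z^k_g / B^k_g` with trivial coefficients. -/
abbrev cohomology (k : ℕ) (g : ℤ) : Type _ :=
  L.cocycles k g ⧸ (L.coboundaries k g).submoduleOf (L.cocycles k g)

/-- The functions `v i` are cocycles and their classes form a basis of `H^k_g`. -/
def IsCohomologyBasis (k : ℕ) (g : ℤ) {ι : Type*} (v : ι → (Fin k → A) → K) : Prop :=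
  ∃ (h : ∀ i, v i ∈ L.cocycles k g) (b : Module.Basis ι K (L.cohomology k g)),
    ∀ i, b i = ((L.coboundaries k g).submoduleOf (L.cocycles k g)).mkQ ⟨v i, h i⟩

/-- The exterior product `C ∧ φ` of a `k`-cochain with a `1`-cochain: on homogeneous arguments
`(C ∧ φ)(a₀, …, a_k) = ∑_j ± C(a₀, …, â_j, …, a_k) φ(a_j)` with the sign
`(-1) ^ (k - j + p(a_j) (p(a_{j+1}) + ⋯ + p(a_k)))` that moves `a_j` to the last place. -/
def wedge {k : ℕ} (C : (Fin k → A) → K) (φ : A →ₗ[K] K) : (Fin (k + 1) → A) → K :=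
  fun a => ∑ j : Fin (k + 1), (-1) ^ (k - (j : ℕ)) * ∑ ε : ZMod 2,
    C (fun m => if j < j.succAbove m then L.twist ε (a (j.succAbove m)) else a (j.succAbove m)) *
      φ (L.par ε (a j))

/-- Given cochains `a k' g j` of degree `k'`, the consequence
`a k' g j ∧ φ ∧ ⋯ ∧ φ` of degree `k`, with `k - k'` factors `φ` (for `k' ≤ k`). -/
def consequence (φ : A →ₗ[K] K) (a : (k : ℕ) → ℤ → ℕ → (Fin k → A) → K) :
    (k : ℕ) → (k' : ℕ) → ℤ → ℕ → (Fin k → A) → K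
  | 0, _, g, j => a 0 g j
  | k + 1, k', g, j =>
    if k' = k + 1 then a (k + 1) g j else L.wedge (consequence φ a k k' g j) φ

/-- The cochains `a k' g' j`, where `j` runs through `0, …, num k' g' - 1`, generate the
cohomology in degree `k` and grade `g`: they and their products with powers of the `1`-cochain
`φ` of grade `z`, as far as they have degree `k` and grade `g`, are cocycles, and
their classes form a basis of `H^k_g`. -/
def Generates (φ : A →ₗ[K] K) (z : ℤ) (num : ℕ → ℤ → ℕ)
    (a : (k : ℕ) → ℤ → ℕ → (Fin k → A) → K) (k : ℕ) (g : ℤ) : Prop :=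
  L.IsCohomologyBasis k g
    (fun t : {t : ℕ × ℤ × ℕ // t.1 ≤ k ∧ t.2.1 + z * ((k : ℤ) - t.1) = g ∧ t.2.2 < num t.1 t.2.1} =>
      L.consequence φ a k t.1.1 t.1.2.1 t.1.2.2)

/-! ### Subalgebras and quotients -/

/-- The subalgebra structure on a graded subspace that is closed under the bracket. -/
def sub (S : Submodule K A) (hb : ∀ a ∈ S, ∀ b ∈ S, L.bracket a b ∈ S)
    (hp : ∀ p, ∀ a ∈ S, L.par p a ∈ S) (hc : ∀ n, ∀ a ∈ S, L.comp n a ∈ S) :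
    GradedLieSuperalgebra K S where
  bracket := LinearMap.mk₂ K (fun a b => ⟨L.bracket a b, hb a a.2 b b.2⟩)
    (fun a b c => Subtype.ext (by simp)) (fun r a b => Subtype.ext (by simp))
    (fun a b c => Subtype.ext (by simp)) (fun r a b => Subtype.ext (by simp))
  par p := (L.par p).restrict (hp p)
  comp n := (L.comp n).restrict (hc n)
  par_add a := Subtype.ext (L.par_add a)
  par_par p q a := Subtype.ext (by
    have := L.par_par p q a
    split_ifs at this ⊢ <;> exact this)
  comp_comp p q a := Subtype.ext (by
    have := L.comp_comp p q a
    split_ifs at this ⊢ <;> exact this)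
  comp_par n p a := Subtype.ext (L.comp_par n p a)
  ext_comp a h := Subtype.ext (L.ext_comp a fun n => congrArg Subtype.val (h n))
  par_bracket p q a b := Subtype.ext (L.par_bracket p q a b)
  comp_bracket m n a b := Subtype.ext (L.comp_bracket m n a b)
  skew p q a b := Subtype.ext (L.skew p q a b)
  jacobi p q a b c := Subtype.ext (L.jacobi p q a b c)

/-- The quotient by a (closed) graded ideal. -/
def quot (I : Submodule K A) (hb : ∀ a ∈ I, ∀ b, L.bracket a b ∈ I)
    (hb' : ∀ a ∈ I, ∀ b, L.bracket b a ∈ I)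
    (hp : ∀ p, ∀ a ∈ I, L.par p a ∈ I) (hc : ∀ n, ∀ a ∈ I, L.comp n a ∈ I)
    (hcl : ∀ a, (∀ n, L.comp n a ∈ I) → a ∈ I) :
    GradedLieSuperalgebra K (A ⧸ I) where
  bracket := LinearMap.liftQ₂ I I (L.bracket.compr₂ I.mkQ)
    (fun a ha => LinearMap.ext fun b => (Submodule.Quotient.mk_eq_zero I).2 (hb a ha b))
    (fun a ha => LinearMap.ext fun b => (Submodule.Quotient.mk_eq_zero I).2 (hb' a ha b))
  par p := I.mapQ I (L.par p) (hp p)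
  comp n := I.mapQ I (L.comp n) (hc n)
  par_add a := by
    induction a using Submodule.Quotient.induction_on with | _ a
    exact congrArg I.mkQ (L.par_add a)
  par_par p q a := by
    induction a using Submodule.Quotient.induction_on with | _ a
    have := congrArg I.mkQ (L.par_par p q a)
    split_ifs at this ⊢ <;> exact this
  comp_comp p q a := by
    induction a using Submodule.Quotient.induction_on with | _ a
    have := congrArg I.mkQ (L.comp_comp p q a)
    split_ifs at this ⊢ <;> exact this
  comp_par n p a := by
    induction a using Submodule.Quotient.induction_on with | _ a
    exact congrArg I.mkQ (L.comp_par n p a)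
  ext_comp a h := by
    induction a using Submodule.Quotient.induction_on with | _ a
    exact (Submodule.Quotient.mk_eq_zero I).2
      (hcl a fun n => (Submodule.Quotient.mk_eq_zero I).1 (h n))
  par_bracket p q a b := by
    induction a using Submodule.Quotient.induction_on with | _ a
    induction b using Submodule.Quotient.induction_on with | _ b
    exact congrArg I.mkQ (L.par_bracket p q a b)
  comp_bracket p q a b := by
    induction a using Submodule.Quotient.induction_on with | _ a
    induction b using Submodule.Quotient.induction_on with | _ b
    exact congrArg I.mkQ (L.comp_bracket p q a b)
  skew p q a b := by
    induction a using Submodule.Quotient.induction_on with | _ a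
    induction b using Submodule.Quotient.induction_on with | _ b
    exact congrArg I.mkQ (L.skew p q a b)
  jacobi p q a b c := by
    induction a using Submodule.Quotient.induction_on with | _ a
    induction b using Submodule.Quotient.induction_on with | _ b
    induction c using Submodule.Quotient.induction_on with | _ c
    exact congrArg I.mkQ (L.jacobi p q a b c)

end GradedLieSuperalgebra

/-! ### The Buttin superalgebra in one even and one odd variable -/

namespace Buttin

variable (K : Type*) [Field K]

/-- Generating functions in an even variable `x` and an odd variable `X`:
the pair `(f, g)` stands for `f(x) + g(x) X`. -/
abbrev GenFun : Type _ := K⟦X⟧ × K⟦X⟧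

variable {K}

/-- The term of degree `n` of a power series in `x` (zero for negative `n`). -/
def term (n : ℤ) : K⟦X⟧ →ₗ[K] K⟦X⟧ :=
  if 0 ≤ n then (monomial n.toNat) ∘ₗ (coeff n.toNat) else 0

theorem coeff_term (n : ℤ) (f : K⟦X⟧) (i : ℕ) :
    coeff i (term n f) = if (i : ℤ) = n then coeff i f else 0 := by
  unfold term
  split_ifs with h h' h'
  · subst h'; simp
  · rw [LinearMap.comp_apply, coeff_monomial, if_neg (by omega)]
  · omega
  · simp

theorem term_eq_self {n : ℤ} {f : K⟦X⟧} (h : ∀ i : ℕ, (i : ℤ) ≠ n → coeff i f = 0) :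
    term n f = f := by
  ext i
  rw [coeff_term]
  split_ifs with h'
  · rfl
  · exact (h i h').symm

theorem term_term (m n : ℤ) (f : K⟦X⟧) :
    term m (term n f) = if m = n then term n f else 0 := by
  ext i
  split_ifs with h
  · subst h
    simp only [coeff_term]
    split_ifs <;> rfl
  · simp only [coeff_term, map_zero]
    split_ifs with h1 h2
    · omega
    · rfl
    · rfl

theorem coeff_mul_term {m n : ℤ} (f g : K⟦X⟧) {i : ℕ} (h : (i : ℤ) ≠ m + n) :
    coeff i (term m f * term n g) = 0 := by
  rw [coeff_mul]
  refine Finset.sum_eq_zero fun p hp => ?_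
  replace hp := Finset.HasAntidiagonal.mem_antidiagonal.1 hp
  rw [coeff_term, coeff_term]
  split_ifs with h1 h2
  · omega
  all_goals simp

theorem derivative_term (n : ℤ) (f : K⟦X⟧) :
    derivative K (term n f) = term (n - 1) (derivative K f) := by
  ext i
  rw [coeff_derivative, coeff_term, coeff_term, coeff_derivative]
  have : ((i + 1 : ℕ) : ℤ) = n ↔ (i : ℤ) = n - 1 := by omega
  simp only [this]
  split_ifs <;> simp

/-- The Buttin bracket
`{F, G} = ∂F/∂x ∂G/∂X + (-1)^p(F) ∂F/∂X ∂G/∂x`, where `p(F)` is the parity of the generating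
function `F`: for `F = f₀ + f₁ X` and `G = g₀ + g₁ X` it is
`(f₀' g₁ - f₁ g₀') + (f₁' g₁ - f₁ g₁') X`. -/
def bracket : GenFun K →ₗ[K] GenFun K →ₗ[K] GenFun K :=
  LinearMap.mk₂ K
    (fun F G => (derivative K F.1 * G.2 - F.2 * derivative K G.1,
      derivative K F.2 * G.2 - F.2 * derivative K G.2))
    (fun a b c => by ext1 <;> simp <;> ring)
    (fun r a b => by ext1 <;> simp [smul_sub])
    (fun a b c => by ext1 <;> simp <;> ring)
    (fun r a b => by ext1 <;> simp [smul_sub])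

theorem bracket_apply (F G : GenFun K) :
    bracket F G = (derivative K F.1 * G.2 - F.2 * derivative K G.1,
      derivative K F.2 * G.2 - F.2 * derivative K G.2) := rfl

/-- Even generating functions `f(x)` are the odd elements of the algebra, odd generating functions
`g(x) X` are the even ones. -/
def par (p : ZMod 2) : GenFun K →ₗ[K] GenFun K :=
  if p = 0 then LinearMap.inr K K⟦X⟧ K⟦X⟧ ∘ₗ LinearMap.snd K K⟦X⟧ K⟦X⟧
  else LinearMap.inl K K⟦X⟧ K⟦X⟧ ∘ₗ LinearMap.fst K K⟦X⟧ K⟦X⟧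

theorem zmod_two (p : ZMod 2) : p = 0 ∨ p = 1 := by
  revert p; decide

theorem par_zero_apply (F : GenFun K) : par 0 F = (0, F.2) := by simp [par]

theorem par_one_apply (F : GenFun K) : par 1 F = (F.1, 0) := by simp [par]

/-- The grading with `g(x) = 1` and `g(X) = -1`. -/
def comp (n : ℤ) : GenFun K →ₗ[K] GenFun K := (term n).prodMap (term (n + 1))

theorem comp_apply (n : ℤ) (F : GenFun K) : comp n F = (term n F.1, term (n + 1) F.2) := rfl

end Buttin

open Buttin in
/-- The Buttin superalgebra `B(1)`. -/
def buttin (K : Type*) [Field K] : GradedLieSuperalgebra K (GenFun K) where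
  bracket := bracket
  par := par
  comp := comp
  par_add a := by simp [par_zero_apply, par_one_apply]
  par_par p q a := by
    rcases zmod_two p with rfl | rfl <;> rcases zmod_two q with rfl | rfl <;> simp [par_zero_apply, par_one_apply]
  comp_comp m n a := by
    by_cases h : m = n
    · subst h; simp [comp_apply, term_term]
    · simp [comp_apply, term_term, h]
  comp_par n p a := by
    rcases zmod_two p with rfl | rfl <;> simp [par_zero_apply, par_one_apply, comp_apply]
  ext_comp a h := by
    have h1 : ∀ n, term n a.1 = 0 := fun n => congrArg Prod.fst (h n)
    have h2 : ∀ n, term n a.2 = 0 := fun n => by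
      have := congrArg Prod.snd (h (n - 1))
      simpa [comp_apply] using this
    ext i
    · simpa [coeff_term] using congrArg (coeff i) (h1 i)
    · simpa [coeff_term] using congrArg (coeff i) (h2 i)
  par_bracket p q a b := by
    have h : (1 + 1 : ZMod 2) = 0 := by decide
    rcases zmod_two p with rfl | rfl <;> rcases zmod_two q with rfl | rfl <;>
      simp [par_zero_apply, par_one_apply, bracket_apply, h]
  comp_bracket m n a b := by
    simp only [comp_apply, bracket_apply, derivative_term]
    refine Prod.ext (term_eq_self fun i hi => ?_) (term_eq_self fun i hi => ?_) <;>
      rw [map_sub, coeff_mul_term _ _ (by omega), coeff_mul_term _ _ (by omega), sub_zero]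
  skew p q a b := by
    rcases zmod_two p with rfl | rfl <;> rcases zmod_two q with rfl | rfl <;>
      simp [par_zero_apply, par_one_apply, bracket_apply] <;> ring_nf
  jacobi p q a b c := by
    have h : (1 : ZMod 2).val = 1 := rfl
    rcases zmod_two p with rfl | rfl <;> rcases zmod_two q with rfl | rfl <;>
      refine Prod.ext ?_ ?_ <;>
      simp [par_zero_apply, par_one_apply, bracket_apply, h] <;> ring

namespace Buttin

variable (K : Type*) [Field K]

/-- The operator `Δ = ∂²/∂x∂X`, mapping `f + g X` to `g'`. -/
def Delta : GenFun K →ₗ[K] K⟦X⟧ := (derivative K).toLinearMap ∘ₗ LinearMap.snd K K⟦X⟧ K⟦X⟧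

/-- The space of generating functions `F` with `Δ F = 0`. -/
abbrev SBSpace : Submodule K (GenFun K) := LinearMap.ker (Delta K)

theorem mem_SBSpace {F : GenFun K} : F ∈ SBSpace K ↔ derivative K F.2 = 0 := Iff.rfl

end Buttin

open Buttin in
/-- The special Buttin superalgebra `SB(1)`. -/
def SB (K : Type*) [Field K] : GradedLieSuperalgebra K (SBSpace K) :=
  (buttin K).sub (SBSpace K)
    (fun a ha b hb => by
      rw [mem_SBSpace] at *
      change derivative K (derivative K a.2 * b.2 - a.2 * derivative K b.2) = 0
      rw [ha, hb]; simp)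
    (fun p a ha => by
      rw [mem_SBSpace] at *
      change derivative K (par p a).2 = 0
      rcases zmod_two p with rfl | rfl <;> simp [par_zero_apply, par_one_apply, ha])
    (fun n a ha => by
      rw [mem_SBSpace] at *
      change derivative K (term (n + 1) a.2) = 0
      rw [derivative_term, ha, map_zero])

namespace Buttin

variable (K : Type*) [Field K]

/-- The element `X` of `SB(1)`. -/
def elX : SBSpace K := ⟨(0, 1), (mem_SBSpace K).2 (by simp)⟩

/-- The element `x^i` of `SB(1)`. -/
def elx (i : ℕ) : SBSpace K := ⟨(X ^ i, 0), (mem_SBSpace K).2 (by simp)⟩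

/-- The centre `Span {1}` of `SB(1)`. -/
abbrev center : Submodule K (SBSpace K) := K ∙ elx K 0

variable {K}

theorem mem_center {F : SBSpace K} : F ∈ center K ↔ (∀ i, i ≠ 0 → coeff i F.1.1 = 0) ∧ F.1.2 = 0 := by
  rw [Submodule.mem_span_singleton]
  constructor
  · rintro ⟨r, rfl⟩
    refine ⟨fun i hi => ?_, ?_⟩ <;> simp [elx, coeff_one]
    intro h; exact absurd h hi
  · rintro ⟨h1, h2⟩
    refine ⟨coeff 0 F.1.1, Subtype.ext (Prod.ext ?_ ?_)⟩
    · ext i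
      by_cases hi : i = 0
      · subst hi; simp [elx]
      · rw [h1 i hi]; simp [elx, coeff_one, hi]
    · simp [elx, h2]

end Buttin

open Buttin in
/-- The special Leites superalgebra `SLe(1) = SB(1) / Span {1}`. -/
def SLe (K : Type*) [Field K] : GradedLieSuperalgebra K (SBSpace K ⧸ center K) :=
  (SB K).quot (center K)
    (fun a ha b => by
      obtain ⟨r, rfl⟩ := Submodule.mem_span_singleton.1 ha
      have : (SB K).bracket (elx K 0) b = 0 := Subtype.ext (by
        change bracket (elx K 0).1 b.1 = 0
        simp [elx, bracket_apply])
      rw [map_smul, LinearMap.smul_apply, this, smul_zero]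
      exact Submodule.zero_mem _)
    (fun a ha b => by
      obtain ⟨r, rfl⟩ := Submodule.mem_span_singleton.1 ha
      have : (SB K).bracket b (elx K 0) = 0 := Subtype.ext (by
        change bracket b.1 (elx K 0).1 = 0
        simp [elx, bracket_apply])
      rw [map_smul, this, smul_zero]
      exact Submodule.zero_mem _)
    (fun p a ha => by
      rw [mem_center] at *
      change (∀ i, i ≠ 0 → coeff i (par p a.1).1 = 0) ∧ (par p a.1).2 = 0
      rcases zmod_two p with rfl | rfl
      · simpa [par_zero_apply] using ha.2
      · simpa [par_one_apply] using ha.1)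
    (fun n a ha => by
      rw [mem_center] at *
      change (∀ i, i ≠ 0 → coeff i (term n a.1.1) = 0) ∧ term (n + 1) a.1.2 = 0
      refine ⟨fun i hi => ?_, by rw [ha.2, map_zero]⟩
      rw [coeff_term, ha.1 i hi, ite_self])
    (fun a h => by
      have h' : ∀ n : ℤ, (∀ i, i ≠ 0 → coeff i (term n a.1.1) = 0) ∧ term (n + 1) a.1.2 = 0 :=
        fun n => mem_center.1 (h n)
      refine mem_center.2 ⟨fun i hi => ?_, ?_⟩
      · simpa [coeff_term] using (h' i).1 i hi
      · ext i
        have := congrArg (coeff i) (h' ((i : ℤ) - 1)).2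
        simpa [coeff_term] using this)

/-! ### The cochains -/

namespace Buttin

variable (K : Type*) [Field K]

/-- The `1`-cochain `C(X)` of `SB(1)`, dual to the basis element `X`. -/
def dualX : SBSpace K →ₗ[K] K := coeff 0 ∘ₗ LinearMap.snd K K⟦X⟧ K⟦X⟧ ∘ₗ (SBSpace K).subtype

/-- The `1`-cochain `C(x^i)` of `SB(1)`, dual to the basis element `x^i`. -/
def dualx (i : ℕ) : SBSpace K →ₗ[K] K :=
  coeff i ∘ₗ LinearMap.fst K K⟦X⟧ K⟦X⟧ ∘ₗ (SBSpace K).subtype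

/-- The representative without constant term of an element of `SLe(1)`. -/
def lift : SBSpace K ⧸ center K →ₗ[K] SBSpace K :=
  (center K).liftQ (LinearMap.id - (dualx K 0).smulRight (elx K 0)) (by
    rw [Submodule.span_singleton_le_iff_mem, LinearMap.mem_ker]
    simp [dualx, elx])

variable {K}

/-- A linear form regarded as a cochain of degree `1`. -/
def ofLin {A : Type*} [AddCommGroup A] [Module K A] (φ : A →ₗ[K] K) : (Fin 1 → A) → K :=
  fun a => φ (a 0)

/-- The cochain of `SLe(1)` that arises from a cochain of `SB(1)` by deleting all terms with
argument `1`. -/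
def deleteOne {k : ℕ} (C : (Fin k → SBSpace K) → K) : (Fin k → SBSpace K ⧸ center K) → K :=
  fun a => C (fun i => lift K (a i))

variable (K)

/-- The cochain `C(X, x^i, x^j) = C(X) ∧ C(x^i) ∧ C(x^j)` of `SB(1)`. -/
def cXxx (i j : ℕ) : (Fin 3 → SBSpace K) → K :=
  (SB K).wedge ((SB K).wedge (ofLin (dualX K)) (dualx K i)) (dualx K j)

/-- For any `c i j`, standing for `C(X, x^i, x^j)`, the expression `a^3_{2m+1}`: with `n = 2m + 2`,
`∑_{i ≤ m} (-1)^i binom(n, i) c i (n - i) + (-1)^{m+1} (binom(n, m+1) / 2) c (m+1) (m+1)`. -/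
def aThree {M : Type*} [AddCommGroup M] [Module K M] (m : ℕ) (c : ℕ → ℕ → M) : M :=
  ∑ i ∈ Finset.range (m + 1), ((-1 : K) ^ i * (Nat.choose (2 * m + 2) i : K)) • c i (2 * m + 2 - i) +
    ((-1 : K) ^ (m + 1) * ((Nat.choose (2 * m + 2) (m + 1) : K) / 2)) • c (m + 1) (m + 1)

/-- The number of entries of the table in row `k` and column `g`. -/
def numSB : ℕ → ℤ → ℕ
  | 1, g => if g = -1 then 1 else 0
  | 3, g => if g = 1 ∨ g = 3 ∨ g = 5 ∨ g = 7 ∨ g = 9 then 1 else 0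
  | 4, g => if g = 2 ∨ g = 4 ∨ g = 5 ∨ g = 6 ∨ g = 7 ∨ g = 9 then 1
      else if g = 8 ∨ g = 10 then 2 else 0
  | 5, g => if g = 3 ∨ g = 5 ∨ g = 6 ∨ g = 8 then 1 else if g = 7 ∨ g = 10 then 2
      else if g = 9 then 3 else 0
  | 6, g => if g = 4 ∨ g = 6 ∨ g = 7 then 1 else if g = 8 ∨ g = 9 then 2
      else if g = 10 then 3 else 0
  | 7, g => if g = 5 ∨ g = 7 ∨ g = 8 then 1 else if g = 9 ∨ g = 10 then 2 else 0
  | 8, g => if g = 6 ∨ g = 8 ∨ g = 9 then 1 else if g = 10 then 2 else 0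
  | 9, g => if g = 7 ∨ g = 9 ∨ g = 10 then 1 else 0
  | 10, g => if g = 8 ∨ g = 10 then 1 else 0
  | _, _ => 0

/-- The number of generating cocycles of `SLe(1)` in row `k` and column `g` of the table. -/
def numSLe : ℕ → ℤ → ℕ
  | 1, g => if g = -1 then 1 else 0
  | 3, g => if g = 3 ∨ g = 5 ∨ g = 7 ∨ g = 9 then 1 else 0
  | 4, g => if g = 5 ∨ g = 7 ∨ g = 8 ∨ g = 9 ∨ g = 10 then 1 else 0
  | 5, g => if g = 7 ∨ g = 9 ∨ g = 10 then 1 else 0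
  | 6, g => if g = 9 then 1 else 0
  | _, _ => 0

end Buttin

end

/-! Write `ξ = C(X)` and `y_i = C(x^i)`. Since `X` is even and the `x^i` are odd, the cochains of
both algebras are polynomials `p + ξ q` with `ξ² = 0` and commuting variables `y_i`, `b ≤ i`, where
`b = 0` for SB(1) and `b = 1` for SLe(1). The only nonzero brackets are `[x^i, X] = i x^{i-1}` and
its mirror image, so `d (p + ξ q) = ξ D p` with the derivation `D : y_i ↦ (i + 1) y_{i+1}`, called
`raise` (`exists_forms`, `d_oddForm`, `d_xiForm`). As `D` is injective in positive degree, the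
cocycles of degree `m + 1` and grade `g` are the `ξ q` with `q` of degree `m` and weight `g + 1`,
and the cohomology is the cokernel of `D` on such polynomials (`cocycles_eq`, `coboundaries_eq`).

For a suitable order of the monomials the leading term of `D μ` arises by raising the largest index
in `μ`. The leading terms are thus the monomials whose largest index exceeds `b` and occurs once.
The others, called normal, represent a basis of the cokernel: `monomial_mem_span_sup_raised`
eliminates the rest, and `eq_zero_of_isNormal_raise` gives independence and the injectivity of `D`.

A normal monomial is a power of `y_b` times a product of `y_i`, `b < i`, which is `1` or has its
largest index repeated. The first factor accounts for the consequences, since `y_b` is `C(1)` or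
`C(x)`; the second runs through finite lists that are counted by evaluation. Lists without entry `1`
serve both algebras and are the starred generators; deleting the terms with argument `1` means
setting `y_0 = 0`.

In degree three the basis monomial `y_{q+1}²` has to be exchanged for the prescribed polynomial
`pairPoly`. The same coefficients define a linear form `pairForm` in the second derivatives. It
vanishes on the image of `D` by telescoping, and at `pairPoly` it is a sum of positive terms;
preceded by derivatives by `y_b` it also handles the consequences (`isRaiseBasis_pairPoly`). Since
`y_{q+1}²` is the only normal monomial of degree `2` and weight `2q + 2`, `pairForm` detects
coboundaries (`mem_raised_iff`). -/

noncomputable section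

namespace MvPolynomial

variable {K : Type*} [Field K]

/-! ### Derivations with constant coefficients and their polarizations -/

/-- The derivative in the direction of a vector `v`. -/
def vecDeriv (v : ℕ → K) : Derivation K (MvPolynomial ℕ K) (MvPolynomial ℕ K) :=
  mkDerivation K fun i => C (v i)

/-- The derivation `y_i ↦ (i + 1) y_{i+1}` for `b ≤ i`, and `y_i ↦ 0` for `i < b`. -/
def raise (K : Type*) [Field K] (b : ℕ) :
    Derivation K (MvPolynomial ℕ K) (MvPolynomial ℕ K) :=
  mkDerivation K fun i => if b ≤ i then ((i : K) + 1) • X (i + 1) else 0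

/-- The transpose of `raise` on vectors. -/
def shiftVec (b : ℕ) (v : ℕ → K) : ℕ → K := fun i => if b ≤ i then ((i : K) + 1) * v (i + 1) else 0

theorem vecDeriv_X (v : ℕ → K) (i : ℕ) : vecDeriv v (X i) = C (v i) := mkDerivation_X _ _ _

theorem raise_X (b i : ℕ) :
    raise K b (X i) = if b ≤ i then ((i : K) + 1) • X (i + 1) else 0 := mkDerivation_X _ _ _

theorem vecDeriv_comm (v w : ℕ → K) (p : MvPolynomial ℕ K) :
    vecDeriv v (vecDeriv w p) = vecDeriv w (vecDeriv v p) := by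
  have : ⁅vecDeriv v, vecDeriv w⁆ = 0 := by
    refine derivation_ext fun i => ?_
    simp [Derivation.commutator_apply, vecDeriv_X]
  have h := congrArg (fun D => D p) this
  simpa [Derivation.commutator_apply, sub_eq_zero] using h

/-- A commutator of derivations is a derivation, so it suffices to compare on variables. -/
theorem vecDeriv_raise (b : ℕ) (v : ℕ → K) (p : MvPolynomial ℕ K) :
    vecDeriv v (raise K b p) = raise K b (vecDeriv v p) + vecDeriv (shiftVec b v) p := by
  have : ⁅vecDeriv v, raise K b⁆ = vecDeriv (shiftVec b v) := by
    refine derivation_ext fun i => ?_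
    rw [Derivation.commutator_apply, vecDeriv_X, vecDeriv_X, raise_X, shiftVec]
    split_ifs <;> simp [vecDeriv_X, smul_eq_C_mul]
  rw [← this, Derivation.commutator_apply]
  ring

theorem vecDeriv_add (v w : ℕ → K) : vecDeriv (v + w) = vecDeriv v + vecDeriv w :=
  derivation_ext fun i => by simp [vecDeriv_X]

theorem vecDeriv_smul (r : K) (v : ℕ → K) : vecDeriv (r • v) = r • vecDeriv v :=
  derivation_ext fun i => by simp [vecDeriv_X, smul_eq_C_mul]

theorem vecDeriv_zero : vecDeriv (0 : ℕ → K) = 0 :=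
  derivation_ext fun i => by simp [vecDeriv_X]

theorem vecDeriv_single (i : ℕ) : vecDeriv (Pi.single i (1 : K)) = pderiv i :=
  derivation_ext fun j => by
    rw [vecDeriv_X, pderiv_X]
    by_cases h : j = i
    · subst h; simp
    · simp [h]

/-- Lets the composition in `multiDeriv` run over an unordered finite set. -/
instance : LeftCommutative fun (w : ℕ → K) (T : Module.End K (MvPolynomial ℕ K)) =>
    (vecDeriv w).toLinearMap ∘ₗ T :=
  ⟨fun v w T => LinearMap.ext fun p => vecDeriv_comm v w (T p)⟩

variable {ι κ : Type*}

/-- The composition of the derivatives in the directions `v i`, for `i` in `s`. -/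
def multiDeriv (s : Finset ι) (v : ι → ℕ → K) : Module.End K (MvPolynomial ℕ K) :=
  Multiset.foldr (fun w T => (vecDeriv w).toLinearMap ∘ₗ T) LinearMap.id (s.val.map v)

theorem multiDeriv_empty (v : ι → ℕ → K) (p : MvPolynomial ℕ K) : multiDeriv ∅ v p = p := rfl

theorem multiDeriv_congr {s : Finset ι} {v w : ι → ℕ → K} (h : ∀ i ∈ s, v i = w i) :
    multiDeriv s v = multiDeriv s w := by
  rw [multiDeriv, multiDeriv, Multiset.map_congr rfl h]

theorem multiDeriv_map (e : κ ↪ ι) (s : Finset κ) (v : ι → ℕ → K) :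
    multiDeriv (s.map e) v = multiDeriv s (v ∘ e) := by
  rw [multiDeriv, multiDeriv, Finset.map_val, Multiset.map_map]

/-- The value of the polarization of `p` at the vectors `v i`, for `i` in `s`. -/
def polar (s : Finset ι) (v : ι → ℕ → K) : MvPolynomial ℕ K →ₗ[K] K :=
  lcoeff K 0 ∘ₗ multiDeriv s v

theorem polar_apply (s : Finset ι) (v : ι → ℕ → K) (p : MvPolynomial ℕ K) :
    polar s v p = coeff 0 (multiDeriv s v p) := rfl

variable [DecidableEq ι]

theorem multiDeriv_insert {s : Finset ι} {i : ι} (hi : i ∉ s) (v : ι → ℕ → K)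
    (p : MvPolynomial ℕ K) :
    multiDeriv (insert i s) v p = vecDeriv (v i) (multiDeriv s v p) := by
  rw [multiDeriv, Finset.insert_val_of_notMem hi, Multiset.map_cons, Multiset.foldr_cons]
  rfl

theorem multiDeriv_erase {s : Finset ι} {i : ι} (hi : i ∈ s) (v : ι → ℕ → K)
    (p : MvPolynomial ℕ K) :
    multiDeriv s v p = vecDeriv (v i) (multiDeriv (s.erase i) v p) := by
  rw [← multiDeriv_insert (Finset.notMem_erase i s), Finset.insert_erase hi]

theorem multiDeriv_smul (s : Finset ι) (c : ι → K) (v : ι → ℕ → K) (p : MvPolynomial ℕ K) :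
    multiDeriv s (fun i => c i • v i) p = (∏ i ∈ s, c i) • multiDeriv s v p := by
  induction s using Finset.induction_on with
  | empty => simp [multiDeriv_empty]
  | insert i s hi ih =>
    rw [multiDeriv_insert hi, multiDeriv_insert hi, ih, Finset.prod_insert hi, vecDeriv_smul,
      Derivation.map_smul, Derivation.smul_apply, smul_smul, mul_comm]

theorem multiDeriv_vecDeriv (s : Finset ι) (v : ι → ℕ → K) (w : ℕ → K) (p : MvPolynomial ℕ K) :
    multiDeriv s v (vecDeriv w p) = vecDeriv w (multiDeriv s v p) := by
  induction s using Finset.induction_on with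
  | empty => rfl
  | insert i s hi ih => rw [multiDeriv_insert hi, multiDeriv_insert hi, ih, vecDeriv_comm]

theorem multiDeriv_eq_zero {s : Finset ι} {i : ι} (hi : i ∈ s) {v : ι → ℕ → K}
    {p : MvPolynomial ℕ K} (h : vecDeriv (v i) p = 0) : multiDeriv s v p = 0 := by
  rw [multiDeriv_erase hi, ← multiDeriv_vecDeriv, h, map_zero]

theorem multiDeriv_X_mul (s : Finset ι) (v : ι → ℕ → K) (i : ℕ) (p : MvPolynomial ℕ K) :
    multiDeriv s v (X i * p) =
      X i * multiDeriv s v p + ∑ j ∈ s, v j i • multiDeriv (s.erase j) v p := by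
  induction s using Finset.induction_on with
  | empty => simp [multiDeriv_empty]
  | insert j s hj ih =>
    rw [multiDeriv_insert hj, multiDeriv_insert hj, ih, Finset.sum_insert hj,
      Finset.erase_insert hj, map_add, Derivation.leibniz, vecDeriv_X, map_sum]
    have : ∀ l ∈ s, v l i • multiDeriv ((insert j s).erase l) v p =
        vecDeriv (v j) (v l i • multiDeriv (s.erase l) v p) := fun l hl => by
      have hlj : j ≠ l := fun h => hj (h ▸ hl)
      rw [Finset.erase_insert_of_ne hlj,
        multiDeriv_insert (fun h => hj (Finset.mem_of_mem_erase h)), Derivation.map_smul]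
    rw [Finset.sum_congr rfl this, smul_eq_C_mul]
    simp only [smul_eq_mul]
    ring

theorem multiDeriv_raise (s : Finset ι) (v : ι → ℕ → K) (b : ℕ) (p : MvPolynomial ℕ K) :
    multiDeriv s v (raise K b p) = raise K b (multiDeriv s v p) +
      ∑ j ∈ s, vecDeriv (shiftVec b (v j)) (multiDeriv (s.erase j) v p) := by
  induction s using Finset.induction_on with
  | empty => simp [multiDeriv_empty]
  | insert j s hj ih =>
    rw [multiDeriv_insert hj, multiDeriv_insert hj, ih, Finset.sum_insert hj,
      Finset.erase_insert hj, map_add, vecDeriv_raise, map_sum, add_assoc]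
    have : ∀ l ∈ s, vecDeriv (shiftVec b (v l)) (multiDeriv ((insert j s).erase l) v p) =
        vecDeriv (v j) (vecDeriv (shiftVec b (v l)) (multiDeriv (s.erase l) v p)) := fun l hl => by
      have hlj : j ≠ l := fun h => hj (h ▸ hl)
      rw [Finset.erase_insert_of_ne hlj,
        multiDeriv_insert (fun h => hj (Finset.mem_of_mem_erase h)), vecDeriv_comm]
    rw [Finset.sum_congr rfl this]

theorem coeff_zero_raise (b : ℕ) (p : MvPolynomial ℕ K) : coeff 0 (raise K b p) = 0 := by
  induction p using MvPolynomial.induction_on with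
  | C r => simp [raise]
  | add p q hp hq => simp [hp, hq]
  | mul_X p i hp =>
    rw [Derivation.leibniz, raise_X, coeff_add]
    simp only [smul_eq_mul, ← constantCoeff_eq, map_mul, constantCoeff_X] at hp ⊢
    split_ifs <;> simp

theorem polar_X_mul (s : Finset ι) (v : ι → ℕ → K) (i : ℕ) (p : MvPolynomial ℕ K) :
    polar s v (X i * p) = ∑ j ∈ s, v j i * polar (s.erase j) v p := by
  rw [polar_apply, multiDeriv_X_mul, coeff_add, coeff_sum, coeff_X_mul', if_neg (by simp),
    zero_add]
  simp [polar_apply]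

/-- Moving `raise` past the derivatives leaves one commutator for each vector, and `raise` itself
produces no constant term. In this shape, one argument replaced by its shift, the brackets enter the
differential. -/
theorem polar_raise (s : Finset ι) (v : ι → ℕ → K) (b : ℕ) (p : MvPolynomial ℕ K) :
    polar s v (raise K b p) =
      ∑ j ∈ s, coeff 0 (vecDeriv (shiftVec b (v j)) (multiDeriv (s.erase j) v p)) := by
  rw [polar_apply, multiDeriv_raise, coeff_add, coeff_sum, coeff_zero_raise, zero_add]

theorem polar_erase {s : Finset ι} {i : ι} (hi : i ∈ s) (v : ι → ℕ → K) (p : MvPolynomial ℕ K) :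
    polar s v p = coeff 0 (vecDeriv (v i) (multiDeriv (s.erase i) v p)) := by
  rw [polar_apply, multiDeriv_erase hi]

theorem polar_update_of_notMem {s : Finset ι} {i : ι} (hi : i ∉ s) (v : ι → ℕ → K) (x : ℕ → K) :
    polar s (Function.update v i x) = polar s v := by
  rw [polar, polar, multiDeriv_congr fun j hj =>
    Function.update_of_ne (ne_of_mem_of_not_mem hj hi) x v]

theorem polar_update_of_mem {s : Finset ι} {i : ι} (hi : i ∈ s) (v : ι → ℕ → K) (x : ℕ → K)
    (p : MvPolynomial ℕ K) :
    polar s (Function.update v i x) p = coeff 0 (vecDeriv x (multiDeriv (s.erase i) v p)) := by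
  rw [polar_erase hi, Function.update_self, multiDeriv_congr (w := v) fun j hj =>
    Function.update_of_ne (Finset.ne_of_mem_erase hj) x v]

theorem polar_eq_zero {s : Finset ι} {i : ι} (hi : i ∈ s) {v : ι → ℕ → K}
    {p : MvPolynomial ℕ K} (h : vecDeriv (v i) p = 0) : polar s v p = 0 := by
  rw [polar_apply, multiDeriv_eq_zero hi h, coeff_zero]

theorem polar_eq_zero' {s : Finset ι} {i : ι} (hi : i ∈ s) {v : ι → ℕ → K}
    {p : MvPolynomial ℕ K} (h : v i = 0) : polar s v p = 0 :=
  polar_eq_zero hi (by rw [h, vecDeriv_zero, Derivation.zero_apply])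

theorem polar_smul (s : Finset ι) (c : ι → K) (v : ι → ℕ → K) (p : MvPolynomial ℕ K) :
    polar s (fun i => c i • v i) p = (∏ i ∈ s, c i) * polar s v p := by
  rw [polar_apply, multiDeriv_smul, coeff_smul, smul_eq_mul, polar_apply]

end MvPolynomial

namespace MvPolynomial

variable {K : Type*} [Field K]

/-! ### Cokernel of the raising derivation: a basis of monomials -/

/-- The weight of a monomial, `y_i` having weight `i`. -/
def wt : (ℕ →₀ ℕ) →+ ℕ := Finsupp.weight fun i : ℕ => i

theorem wt_single (i k : ℕ) : wt (Finsupp.single i k) = k * i := by simp [wt, Finsupp.weight_single]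

/-- The exponents of the monomials of degree `m` and weight `n` in the variables `y_i`, `b ≤ i`. -/
def IsIndex (b m : ℕ) (n : ℤ) (μ : ℕ →₀ ℕ) : Prop :=
  (∀ i < b, μ i = 0) ∧ μ.degree = m ∧ (wt μ : ℤ) = n

/-- The polynomials of degree `m` and weight `n` in the variables `y_i`, `b ≤ i`. -/
def polys (K : Type*) [Field K] (b m : ℕ) (n : ℤ) : Submodule K (MvPolynomial ℕ K) where
  carrier := {p | ∀ μ, coeff μ p ≠ 0 → IsIndex b m n μ}
  zero_mem' μ h := by simp at h
  add_mem' {p q} hp hq μ h := by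
    by_cases h' : coeff μ p = 0
    · exact hq μ (by simpa [h'] using h)
    · exact hp μ h'
  smul_mem' r p hp μ h := hp μ fun h' => h (by simp [h'])

theorem monomial_mem_polys {b m : ℕ} {n : ℤ} {μ : ℕ →₀ ℕ} (h : IsIndex b m n μ) (r : K) :
    monomial μ r ∈ polys K b m n := fun ν hν => by
  classical
  rw [coeff_monomial] at hν
  split_ifs at hν with h'
  · exact h' ▸ h
  · exact absurd rfl hν

theorem polys_le {b m : ℕ} {n : ℤ} {S : Submodule K (MvPolynomial ℕ K)}
    (h : ∀ μ, IsIndex b m n μ → monomial μ 1 ∈ S) : polys K b m n ≤ S := fun p hp => by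
  rw [p.as_sum]
  refine Submodule.sum_mem _ fun μ hμ => ?_
  have := S.smul_mem (coeff μ p) (h μ (hp μ (mem_support_iff.1 hμ)))
  rwa [smul_monomial, smul_eq_mul, mul_one] at this

theorem exchange_single {μ : ℕ →₀ ℕ} {i : ℕ} (h : μ i ≠ 0) (j : ℕ) :
    μ - Finsupp.single i 1 + Finsupp.single j 1 + Finsupp.single i 1 =
      μ + Finsupp.single j 1 := by
  rw [add_right_comm, Finsupp.sub_add_single_one_cancel h]

theorem raise_monomial (b : ℕ) (ν : ℕ →₀ ℕ) (r : K) :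
    raise K b (monomial ν r) = ∑ i ∈ ν.support, if b ≤ i then
      monomial (ν - Finsupp.single i 1 + Finsupp.single (i + 1) 1) (r * (ν i * ((i : K) + 1)))
      else 0 := by
  rw [raise, mkDerivation_monomial, Finsupp.sum, Finset.smul_sum]
  refine Finset.sum_congr rfl fun i _ => ?_
  split_ifs with h
  · rw [smul_eq_mul, X, smul_monomial, monomial_mul, smul_monomial]
    congr 1
    simp
  · simp

theorem exists_of_coeff_raise_ne_zero {b : ℕ} {p : MvPolynomial ℕ K} {l : ℕ →₀ ℕ}
    (h : coeff l (raise K b p) ≠ 0) :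
    ∃ ν i, coeff ν p ≠ 0 ∧ b ≤ i ∧ ν i ≠ 0 ∧
      l + Finsupp.single i 1 = ν + Finsupp.single (i + 1) 1 := by
  classical
  rw [p.as_sum, map_sum, coeff_sum] at h
  obtain ⟨ν, hν, h⟩ := Finset.exists_ne_zero_of_sum_ne_zero h
  rw [raise_monomial, coeff_sum] at h
  obtain ⟨i, hi, h⟩ := Finset.exists_ne_zero_of_sum_ne_zero h
  split_ifs at h with hb
  · rw [coeff_monomial] at h
    split_ifs at h with hl
    · have hi' := Finsupp.mem_support_iff.1 hi
      refine ⟨ν, i, mem_support_iff.1 hν, hb, hi', ?_⟩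
      rw [← hl, exchange_single hi']
    · exact absurd rfl h
  · simp at h

/-- Here `l` is `ν` with one index `i` raised; the additive form of the equation avoids truncated
subtraction. -/
theorem isIndex_of_raise {b m : ℕ} {n : ℤ} {l ν : ℕ →₀ ℕ} {i : ℕ} (hb : b ≤ i)
    (h : l + Finsupp.single i 1 = ν + Finsupp.single (i + 1) 1) (hν : IsIndex b m n ν) :
    IsIndex b m (n + 1) l := by
  obtain ⟨h1, h2, h3⟩ := hν
  refine ⟨fun j hj => ?_, ?_, ?_⟩
  · have := DFunLike.congr_fun h j
    simp only [Finsupp.add_apply, h1 j hj, Finsupp.single_apply] at this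
    rw [if_neg (by omega), if_neg (by omega)] at this
    exact this
  · have := congrArg Finsupp.degree h
    simp only [map_add, Finsupp.degree_single] at this
    omega
  · have := congrArg wt h
    simp only [map_add, wt_single] at this
    omega

theorem raise_mem_polys {b m : ℕ} {n : ℤ} {p : MvPolynomial ℕ K} (hp : p ∈ polys K b m n) :
    raise K b p ∈ polys K b m (n + 1) := fun l hl => by
  obtain ⟨ν, i, hν, hb, -, h⟩ := exists_of_coeff_raise_ne_zero hl
  exact isIndex_of_raise hb h (hp ν hν)

/-- The image of the raising derivation in degree `m` and weight `n`. -/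
def raised (K : Type*) [Field K] (b m : ℕ) (n : ℤ) : Submodule K (MvPolynomial ℕ K) :=
  (polys K b m (n - 1)).map (raise K b).toLinearMap

theorem raised_le (b m : ℕ) (n : ℤ) : raised K b m n ≤ polys K b m n := by
  rintro _ ⟨p, hp, rfl⟩
  simpa using raise_mem_polys hp

/-- A monomial in the `y_i`, `b ≤ i`, is normal if the largest index of a variable in it is `b` or
occurs with multiplicity at least `2`. -/
def IsNormal (b : ℕ) (μ : ℕ →₀ ℕ) : Prop := ∀ M, b < M → μ M = 1 → ∃ j, M < j ∧ μ j ≠ 0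

/-- An auxiliary order on monomials: the leading term of the image under `raise` of a monomial is
obtained by raising the largest index of a variable. -/
def rank : (ℕ →₀ ℕ) →+ ℕ := Finsupp.weight fun i : ℕ => 2 ^ i

theorem rank_single (i k : ℕ) : rank (Finsupp.single i k) = k * 2 ^ i := by
  simp [rank, Finsupp.weight_single]

/-- Elimination by induction on `rank`: a monomial that is not normal is, up to a nonzero factor,
the leading term of the image of a monomial, and all other terms of that image have smaller rank. -/
theorem monomial_mem_span_sup_raised [CharZero K] {b m : ℕ} {n : ℤ} (μ : ℕ →₀ ℕ)
    (hμ : IsIndex b m n μ) :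
    monomial μ (1 : K) ∈ Submodule.span K
      ((fun l => monomial l (1 : K)) '' {l | IsIndex b m n l ∧ IsNormal b l}) ⊔ raised K b m n := by
  induction h : rank μ using Nat.strong_induction_on generalizing μ with
  | _ r ih =>
  subst h
  by_cases hn : IsNormal b μ
  · exact Submodule.mem_sup_left (Submodule.subset_span ⟨μ, ⟨hμ, hn⟩, rfl⟩)
  simp only [IsNormal, not_forall, not_exists, not_and, not_not] at hn
  obtain ⟨M, hM, hM1, hj⟩ := hn
  obtain ⟨M, rfl⟩ : ∃ M', M = M' + 1 := ⟨M - 1, by omega⟩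
  -- The single largest index `M + 1` is lowered, so that `M` is the largest index of `ν` and
  -- raising it gives `μ` back.
  set ν := μ - Finsupp.single (M + 1) 1 + Finsupp.single M 1 with hν
  have hνμ : ν + Finsupp.single (M + 1) 1 = μ + Finsupp.single M 1 := by
    rw [hν, exchange_single (by omega)]
  have hνM : ν M ≠ 0 := by simp [hν]
  have hνi : ∀ i, M < i → ν i = 0 := fun i hi => by
    have := DFunLike.congr_fun hνμ i
    simp only [Finsupp.add_apply, Finsupp.single_apply] at this
    rw [if_neg (by omega : ¬ M = i)] at this
    by_cases h : M + 1 = i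
    · subst h; simp at this; omega
    · rw [if_neg h, hj i (by omega)] at this; simpa using this
  have hνI : IsIndex b m (n - 1) ν := by
    obtain ⟨h1, h2, h3⟩ := hμ
    refine ⟨fun j hj => ?_, ?_, ?_⟩
    · have := DFunLike.congr_fun hνμ j
      simp only [Finsupp.add_apply, h1 j hj, Finsupp.single_apply] at this
      rw [if_neg (by omega), if_neg (by omega)] at this
      exact this
    · have := congrArg Finsupp.degree hνμ
      simp only [map_add, Finsupp.degree_single] at this
      omega
    · have := congrArg wt hνμ
      simp only [map_add, wt_single] at this
      omega
  have hD : raise K b (monomial ν 1) ∈ raised K b m n :=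
    ⟨_, monomial_mem_polys hνI 1, rfl⟩
  rw [raise_monomial, ← Finset.add_sum_erase _ _ (Finsupp.mem_support_iff.2 hνM),
    if_pos (by omega)] at hD
  set S := Submodule.span K
      ((fun l => monomial l (1 : K)) '' {l | IsIndex b m n l ∧ IsNormal b l}) ⊔ raised K b m n
  have hrest : ∀ i ∈ ν.support.erase M, (if b ≤ i then
      monomial (ν - Finsupp.single i 1 + Finsupp.single (i + 1) 1) (1 * (ν i * ((i : K) + 1)))
      else 0) ∈ S := fun i hi => by
    obtain ⟨hiM, hi⟩ := Finset.mem_erase.1 hi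
    have hi0 := Finsupp.mem_support_iff.1 hi
    have hlt : i < M := lt_of_le_of_ne (not_lt.1 fun h => hi0 (hνi i h)) hiM
    split_ifs with hb
    · set l := ν - Finsupp.single i 1 + Finsupp.single (i + 1) 1 with hl
      have hlν : l + Finsupp.single i 1 = ν + Finsupp.single (i + 1) 1 := by
        rw [hl, exchange_single hi0]
      have hlI := isIndex_of_raise hb hlν hνI
      rw [sub_add_cancel] at hlI
      -- Raising `i` adds `2^i` to the rank of `ν`, which is less than the `2^M` gained in passing
      -- to `μ`.
      have hr : rank l < rank μ := by
        have e1 := congrArg rank hlν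
        have e2 := congrArg rank hνμ
        simp only [map_add, rank_single, pow_succ] at e1 e2
        have := Nat.pow_lt_pow_right (a := 2) (by norm_num) hlt
        omega
      have := S.smul_mem (1 * (ν i * ((i : K) + 1))) (ih _ hr l hlI rfl)
      rwa [smul_monomial, smul_eq_mul, mul_one] at this
    · exact S.zero_mem
  have hlead := S.sub_mem (Submodule.mem_sup_right hD) (S.sum_mem hrest)
  rw [add_sub_cancel_right] at hlead
  have hνe : ν - Finsupp.single M 1 + Finsupp.single (M + 1) 1 = μ := by
    have : ν - Finsupp.single M 1 + Finsupp.single (M + 1) 1 + Finsupp.single M 1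
        = μ + Finsupp.single M 1 := by
      rw [exchange_single hνM, hνμ]
    exact add_right_cancel this
  rw [hνe] at hlead
  have hc : (1 * ((ν M : K) * ((M : K) + 1))) ≠ 0 := by
    have : ((M : K) + 1) ≠ 0 := by exact_mod_cast Nat.succ_ne_zero M
    simp [hνM, this]
  have := S.smul_mem (1 * ((ν M : K) * ((M : K) + 1)))⁻¹ hlead
  rwa [smul_monomial, smul_eq_mul, inv_mul_cancel₀ hc] at this

/-- Among the nonconstant monomials of `q` take `μ` of largest rank and raise its largest index. The
result has a nonzero coefficient in `raise K b q`, but its largest index exceeds `b` and occurs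
once, so it is not normal. The case of a vanishing image is the injectivity of `raise` in positive
degree. -/
theorem eq_zero_of_isNormal_raise [CharZero K] {b : ℕ} {q : MvPolynomial ℕ K}
    (hq : ∀ μ, coeff μ q ≠ 0 → ∀ i < b, μ i = 0)
    (hn : ∀ l, coeff l (raise K b q) ≠ 0 → IsNormal b l) (μ : ℕ →₀ ℕ) (hμ : coeff μ q ≠ 0) :
    μ = 0 := by
  classical
  by_contra hμ0
  obtain ⟨μ, hμ, hmax⟩ := Finset.exists_max_image (q.support.erase 0) rank
    ⟨μ, Finset.mem_erase.2 ⟨hμ0, mem_support_iff.2 hμ⟩⟩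
  obtain ⟨hμ0, hμ⟩ := Finset.mem_erase.1 hμ
  have hμq := mem_support_iff.1 hμ
  have hne : μ.support.Nonempty := Finsupp.support_nonempty_iff.2 hμ0
  set M := μ.support.max' hne
  have hM : μ M ≠ 0 := Finsupp.mem_support_iff.1 (Finset.max'_mem _ hne)
  have hMax : ∀ i, M < i → μ i = 0 := fun i hi => by
    by_contra h
    exact absurd (Finset.le_max' _ i (Finsupp.mem_support_iff.2 h)) (not_le.2 hi)
  have hbM : b ≤ M := not_lt.1 fun h => hM (hq μ hμq M h)
  set l := μ - Finsupp.single M 1 + Finsupp.single (M + 1) 1 with hl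
  have hlμ : l + Finsupp.single M 1 = μ + Finsupp.single (M + 1) 1 := by
    rw [hl, exchange_single hM]
  -- No other term contributes to the coefficient of `l`: maximality of the rank forces `M ≤ i`, and
  -- `M < i` would put into `l` an index above `M + 1`.
  have key : ∀ ν ∈ q.support, ∀ i ∈ ν.support,
      ν - Finsupp.single i 1 + Finsupp.single (i + 1) 1 = l → ν = μ ∧ i = M := by
    intro ν hν i hi h
    have hi0 := Finsupp.mem_support_iff.1 hi
    have hν0 : ν ≠ 0 := by rintro rfl; simp at hi0
    have hr := hmax ν (Finset.mem_erase.2 ⟨hν0, hν⟩)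
    have hlν : l + Finsupp.single i 1 = ν + Finsupp.single (i + 1) 1 := by
      rw [← h, exchange_single hi0]
    have e1 := congrArg rank hlν
    have e2 := congrArg rank hlμ
    simp only [map_add, rank_single, pow_succ] at e1 e2
    have hMi : M ≤ i := by
      by_contra hlt
      have := Nat.pow_lt_pow_right (a := 2) (by norm_num) (not_le.1 hlt)
      omega
    have hiM : i = M := by
      by_contra hne
      have e3 := DFunLike.congr_fun hlν (i + 1)
      have e4 := DFunLike.congr_fun hlμ (i + 1)
      simp only [Finsupp.add_apply, Finsupp.single_apply] at e3 e4
      rw [hMax (i + 1) (by omega), if_neg (by omega), if_neg (by omega)] at e4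
      rw [if_neg (by omega), if_pos trivial] at e3
      omega
    subst hiM
    exact ⟨add_right_cancel (hlν.symm.trans hlμ), rfl⟩
  have hcoeff : coeff l (raise K b q) = coeff μ q * (μ M * ((M : K) + 1)) := by
    conv_lhs => rw [q.as_sum, map_sum, coeff_sum]
    rw [Finset.sum_eq_single_of_mem μ hμ]
    · rw [raise_monomial, coeff_sum,
        Finset.sum_eq_single_of_mem M (Finsupp.mem_support_iff.2 hM), if_pos hbM, coeff_monomial,
        if_pos rfl]
      intro i hi hne
      split_ifs
      · rw [coeff_monomial, if_neg fun h => hne (key μ hμ i hi h).2]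
      · simp
    · intro ν hν hne
      rw [raise_monomial, coeff_sum]
      refine Finset.sum_eq_zero fun i hi => ?_
      split_ifs
      · rw [coeff_monomial, if_neg fun h => hne (key ν hν i hi h).1]
      · simp
  have hc : ((M : K) + 1) ≠ 0 := by exact_mod_cast Nat.succ_ne_zero M
  have hnl := hn l (by rw [hcoeff]; simp [hμq, hM, hc])
  obtain ⟨j, hj, hjl⟩ := hnl (M + 1) (by omega) (by
    have := DFunLike.congr_fun hlμ (M + 1)
    simpa [Finsupp.single_apply, hMax (M + 1) (by omega)] using this)
  have := DFunLike.congr_fun hlμ j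
  simp only [Finsupp.add_apply, Finsupp.single_apply, hMax j (by omega)] at this
  rw [if_neg (by omega), if_neg (by omega)] at this
  exact hjl this

/-- The family `w` represents a basis of the cokernel of the raising derivation. -/
def IsRaiseBasis (b m : ℕ) (n : ℤ) {ι : Type*} (w : ι → MvPolynomial ℕ K) : Prop :=
  (∀ i, w i ∈ polys K b m n) ∧
  (polys K b m n ≤ Submodule.span K (Set.range w) ⊔ raised K b m n) ∧
  ∀ c : ι →₀ K, Finsupp.linearCombination K w c ∈ raised K b m n → c = 0

/-- A combination of normal monomials that lies in the image of `raise` is the image of a constant,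
hence zero. -/
theorem isRaiseBasis_monomial [CharZero K] {b m : ℕ} {n : ℤ} {ι : Type*} {e : ι → ℕ →₀ ℕ}
    (hinj : Function.Injective e) (he : ∀ μ, (IsIndex b m n μ ∧ IsNormal b μ) ↔ ∃ i, e i = μ) :
    IsRaiseBasis b m n fun i => monomial (e i) (1 : K) := by
  classical
  refine ⟨fun i => monomial_mem_polys ((he _).2 ⟨i, rfl⟩).1 1, ?_, ?_⟩
  · refine polys_le fun μ hμ => ?_
    have hr : Set.range (fun i => monomial (e i) (1 : K)) =
        (fun l => monomial l (1 : K)) '' {l | IsIndex b m n l ∧ IsNormal b l} := by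
      ext p
      constructor
      · rintro ⟨i, rfl⟩
        exact ⟨e i, (he _).2 ⟨i, rfl⟩, rfl⟩
      · rintro ⟨μ, h, rfl⟩
        obtain ⟨i, rfl⟩ := (he μ).1 h
        exact ⟨i, rfl⟩
    rw [hr]
    exact monomial_mem_span_sup_raised μ hμ
  · rintro c ⟨q, hq, hqc⟩
    have hcoeff : ∀ i, coeff (e i) (Finsupp.linearCombination K (fun i => monomial (e i) (1 : K)) c)
        = c i := fun i => by
      rw [Finsupp.linearCombination_apply, Finsupp.sum, coeff_sum]
      simp only [coeff_smul, coeff_monomial, hinj.eq_iff, smul_eq_mul, mul_ite, mul_one, mul_zero]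
      simp [eq_comm]
    have h0 : raise K b q = 0 := by
      have hz := eq_zero_of_isNormal_raise (b := b) (q := q) (fun μ hμ => (hq μ hμ).1)
        (fun l hl => by
          change raise K b q = _ at hqc
          rw [hqc, Finsupp.linearCombination_apply, Finsupp.sum, coeff_sum] at hl
          obtain ⟨i, -, hi⟩ := Finset.exists_ne_zero_of_sum_ne_zero hl
          rw [coeff_smul, coeff_monomial] at hi
          split_ifs at hi with h
          · exact ((he l).2 ⟨i, h⟩).2
          · simp at hi)
      have : q = C (coeff 0 q) := by
        ext μ
        rw [coeff_C]
        split_ifs with h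
        · rw [h]
        · by_contra h'
          exact h (hz μ h').symm
      rw [this]
      exact derivation_C _ _
    ext i
    rw [← hcoeff i, ← hqc]
    change coeff (e i) (raise K b q) = 0
    rw [h0, coeff_zero]

/-- In a basis one member can be replaced by a vector that is not a combination of the others. -/
theorem IsRaiseBasis.replace {b m : ℕ} {n : ℤ} {ι : Type*} {w w' : ι → MvPolynomial ℕ K}
    (h : IsRaiseBasis b m n w) (i₀ : ι) (hw : ∀ i, i ≠ i₀ → w' i = w i)
    (hmem : w' i₀ ∈ polys K b m n) (ψ : MvPolynomial ℕ K →ₗ[K] K)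
    (hψ : ∀ p ∈ raised K b m n, ψ p = 0) (hψw : ∀ i, i ≠ i₀ → ψ (w i) = 0) (h₀ : ψ (w' i₀) ≠ 0) :
    IsRaiseBasis b m n w' := by
  classical
  obtain ⟨h1, h2, h3⟩ := h
  have hlin : ∀ c : ι →₀ K, Finsupp.linearCombination K w' c =
      c i₀ • w' i₀ + Finsupp.linearCombination K w (c.erase i₀) := fun c => by
    conv_lhs => rw [← Finsupp.single_add_erase i₀ c]
    rw [map_add, Finsupp.linearCombination_single]
    congr 1
    rw [Finsupp.linearCombination_apply, Finsupp.linearCombination_apply]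
    refine Finsupp.sum_congr fun i hi => ?_
    rw [hw i (by rintro rfl; simp at hi)]
  have hψe : ∀ c : ι →₀ K, ψ (Finsupp.linearCombination K w c) = c i₀ * ψ (w i₀) := fun c => by
    rw [Finsupp.linearCombination_apply, Finsupp.sum, map_sum]
    by_cases hc : i₀ ∈ c.support
    · rw [Finset.sum_eq_single_of_mem i₀ hc fun i _ hi => by rw [map_smul, hψw i hi, smul_zero],
        map_smul, smul_eq_mul]
    · rw [Finsupp.notMem_support_iff.1 hc, zero_mul]
      refine Finset.sum_eq_zero fun i hi => ?_
      rw [map_smul, hψw i (by rintro rfl; exact hc hi), smul_zero]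
  refine ⟨fun i => ?_, ?_, fun c hc => ?_⟩
  · by_cases hi : i = i₀
    · rwa [hi]
    · rw [hw i hi]; exact h1 i
  · refine h2.trans (sup_le (Submodule.span_le.2 ?_) le_sup_right)
    rintro _ ⟨i, rfl⟩
    by_cases hi : i = i₀
    · subst hi
      obtain ⟨u, hu, v, hv, huv⟩ := Submodule.mem_sup.1 (h2 hmem)
      obtain ⟨c, rfl⟩ := (Finsupp.mem_span_range_iff_exists_finsupp).1 hu
      have hψu : ψ (w' i) = c i * ψ (w i) := by
        rw [← huv, map_add, hψ v hv, add_zero]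
        exact hψe c
      -- The form `ψ` shows that the new vector involves the old one, which can therefore be solved
      -- for.
      have hci : c i ≠ 0 := fun h => h₀ (by rw [hψu, h, zero_mul])
      have hsum : c.sum (fun i a => a • w i) =
          c i • w i + Finsupp.linearCombination K w (c.erase i) := by
        rw [← Finsupp.linearCombination_apply]
        conv_lhs => rw [← Finsupp.single_add_erase i c]
        rw [map_add, Finsupp.linearCombination_single]
      have hwi : w i = (c i)⁻¹ • (w' i - Finsupp.linearCombination K w (c.erase i) - v) := by
        rw [← huv, hsum, eq_inv_smul_iff₀ hci]
        abel
      rw [hwi]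
      refine Submodule.smul_mem _ _ (Submodule.sub_mem _ (Submodule.sub_mem _ ?_ ?_) ?_)
      · exact Submodule.mem_sup_left (Submodule.subset_span ⟨i, rfl⟩)
      · rw [Finsupp.linearCombination_apply]
        refine Submodule.sum_mem _ fun j hj => Submodule.smul_mem _ _ (Submodule.mem_sup_left
          (Submodule.subset_span ⟨j, ?_⟩))
        exact hw j (by rintro rfl; simp at hj)
      · exact Submodule.mem_sup_right hv
    · exact Submodule.mem_sup_left (Submodule.subset_span ⟨i, hw i hi⟩)
  · have hc0 : c i₀ = 0 := by
      have := hψ _ hc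
      rw [hlin, map_add, hψe, map_smul, Finsupp.erase_same, zero_mul, add_zero, smul_eq_mul] at this
      exact (mul_eq_zero.1 this).resolve_right h₀
    have hce : c.erase i₀ = c := Finsupp.erase_of_notMem_support (by simpa using hc0)
    rw [hlin, hc0, zero_smul, zero_add, hce] at hc
    exact h3 c hc

end MvPolynomial

/-! ### Weights and coefficients seen by polarizations -/

namespace MvPolynomial

variable {K : Type*} [Field K]

/-- By `hv` the vector is supported at most at the index `d`, so the derivative is a multiple of a
single partial derivative and lowers the weight by `d`. -/
theorem coeff_vecDeriv_ne_zero {v : ℕ → K} {d n : ℤ} (hv : ∀ l : ℕ, v l ≠ 0 → d = l)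
    {q : MvPolynomial ℕ K} (hq : ∀ μ, coeff μ q ≠ 0 → (wt μ : ℤ) = n) (ν : ℕ →₀ ℕ)
    (h : coeff ν (vecDeriv v q) ≠ 0) : (wt ν : ℤ) = n - d := by
  have hv0 : v ≠ 0 := by
    rintro rfl
    simp [vecDeriv_zero] at h
  obtain ⟨l, hl⟩ := Function.ne_iff.1 hv0
  have hvl : v = v l • Pi.single l (1 : K) := by
    funext i
    by_cases hi : i = l
    · subst hi; simp
    · have : v i = 0 := by
        by_contra h'
        have := (hv i h').symm.trans (hv l hl)
        exact hi (by exact_mod_cast this)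
      simp [this, hi]
  rw [hvl, vecDeriv_smul, vecDeriv_single, Derivation.smul_apply, coeff_smul, coeff_pderiv] at h
  have := hq (ν + Finsupp.single l 1) fun h' => h (by simp [h'])
  rw [map_add, wt_single] at this
  have := hv l hl
  push_cast at *
  omega

theorem sum_eq_of_polar_ne_zero {ι : Type*} [DecidableEq ι] {v : ι → ℕ → K} {d : ι → ℤ} {n : ℤ}
    {s : Finset ι} (hv : ∀ i, ∀ l : ℕ, v i l ≠ 0 → d i = l) {p : MvPolynomial ℕ K}
    (hp : ∀ μ, coeff μ p ≠ 0 → (wt μ : ℤ) = n) (h : polar s v p ≠ 0) : ∑ i ∈ s, d i = n := by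
  have key : ∀ ν, coeff ν (multiDeriv s v p) ≠ 0 → (wt ν : ℤ) = n - ∑ i ∈ s, d i := by
    clear h
    induction s using Finset.induction_on with
    | empty => simpa [multiDeriv_empty] using hp
    | insert i s hi ih =>
      intro ν hν
      rw [multiDeriv_insert hi] at hν
      rw [coeff_vecDeriv_ne_zero (hv i) ih ν hν, Finset.sum_insert hi]
      ring
  have := key 0 h
  rw [map_zero] at this
  push_cast at this
  omega

/-- Iterated partial derivatives at `0` extract one coefficient, up to a product of factorials. -/
theorem exists_polar_single_eq [CharZero K] {ι : Type*} [DecidableEq ι] (s : Finset ι) (h : ι → ℕ) :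
    ∃ c : K, c ≠ 0 ∧ ∀ p, polar s (fun i => Pi.single (h i) (1 : K)) p =
      c * coeff (∑ i ∈ s, Finsupp.single (h i) 1) p := by
  have key : ∀ ν : ℕ →₀ ℕ, ∃ c : K, c ≠ 0 ∧
      ∀ p, coeff ν (multiDeriv s (fun i => Pi.single (h i) (1 : K)) p) =
        c * coeff (ν + ∑ i ∈ s, Finsupp.single (h i) 1) p := by
    induction s using Finset.induction_on with
    | empty => exact fun ν => ⟨1, one_ne_zero, fun p => by simp [multiDeriv_empty]⟩
    | insert i s hi ih =>
      intro ν
      obtain ⟨c, hc, hcp⟩ := ih (ν + Finsupp.single (h i) 1)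
      refine ⟨c * (ν (h i) + 1), mul_ne_zero hc (Nat.cast_add_one_ne_zero _), fun p => ?_⟩
      rw [multiDeriv_insert hi, vecDeriv_single, coeff_pderiv, hcp, Finset.sum_insert hi, add_assoc]
      ring
  obtain ⟨c, hc, hcp⟩ := key 0
  exact ⟨c, hc, fun p => by rw [polar_apply, hcp, zero_add]⟩

end MvPolynomial

/-! ### Cochains given by polynomials -/

namespace GradedLieSuperalgebra

open MvPolynomial (vecDeriv multiDeriv polar raise shiftVec polys)

variable {K A : Type*} [Field K] [AddCommGroup A] [Module K A]

/-- Coordinates on a graded Lie superalgebra with the (topological) basis `X`, `x^i` (`b ≤ i`),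
where `X` is even of grade `-1`, `x^i` is odd of grade `i`, and the only nonzero brackets are
`[x^i, X] = -[X, x^i] = i x^{i-1}` for `b < i`. -/
structure Coordinates (L : GradedLieSuperalgebra K A) (b : ℕ) where
  xi : A →ₗ[K] K
  y : ℕ → A →ₗ[K] K
  eX : A
  ex : ℕ → A
  y_of_lt : ∀ i < b, y i = 0
  xi_par_zero : ∀ a, xi (L.par 0 a) = xi a
  xi_par_one : ∀ a, xi (L.par 1 a) = 0
  y_par_zero : ∀ i a, y i (L.par 0 a) = 0
  y_par_one : ∀ i a, y i (L.par 1 a) = y i a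
  xi_comp : ∀ n a, xi (L.comp n a) = if n = -1 then xi a else 0
  y_comp : ∀ (n : ℤ) (i : ℕ) a, y i (L.comp n a) = if n = i then y i a else 0
  xi_bracket : ∀ a c, xi (L.bracket a c) = 0
  y_bracket : ∀ i a c, y i (L.bracket a c) =
    if b ≤ i then ((i : K) + 1) * (y (i + 1) a * xi c - xi a * y (i + 1) c) else 0
  ext : ∀ a, xi a = 0 → (∀ i, y i a = 0) → a = 0
  xi_eX : xi eX = 1
  y_eX : ∀ i, y i eX = 0
  xi_ex : ∀ i, xi (ex i) = 0
  y_ex : ∀ i j, y j (ex i) = if i = j ∧ b ≤ i then 1 else 0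

namespace Coordinates

variable {L : GradedLieSuperalgebra K A} {b : ℕ} (c : L.Coordinates b)

/-- The vector of the coordinates with respect to the odd basis elements. -/
def vec : A →ₗ[K] ℕ → K := LinearMap.pi c.y

theorem vec_apply (a : A) (i : ℕ) : c.vec a i = c.y i a := rfl

theorem vec_par_zero (a : A) : c.vec (L.par 0 a) = 0 := funext fun i => c.y_par_zero i a

theorem vec_par_one (a : A) : c.vec (L.par 1 a) = c.vec a := funext fun i => c.y_par_one i a

theorem vec_bracket (a a' : A) : c.vec (L.bracket a a') =
    c.xi a' • shiftVec b (c.vec a) - c.xi a • shiftVec b (c.vec a') := by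
  funext i
  simp only [vec_apply, c.y_bracket, shiftVec, Pi.sub_apply, Pi.smul_apply, smul_eq_mul]
  split_ifs
  · ring
  · ring

theorem xi_twist (ε : ZMod 2) (a : A) : c.xi (L.twist ε a) = c.xi a := by
  simp [twist, c.xi_par_zero, c.xi_par_one]

theorem vec_twist (ε : ZMod 2) (a : A) : c.vec (L.twist ε a) = (-1 : K) ^ ε.val • c.vec a := by
  simp [twist, c.vec_par_zero, c.vec_par_one]

theorem vec_ex {i : ℕ} (hi : b ≤ i) : c.vec (c.ex i) = Pi.single i 1 := by
  funext j
  rw [c.vec_apply, c.y_ex]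
  by_cases h : i = j
  · subst h; simp [hi]
  · simp [h, Ne.symm h]

theorem vec_eX : c.vec c.eX = 0 := funext c.y_eX

/-- The `m`-cochain that corresponds to a polynomial `p` in the `y_i = C(x^i)`. -/
def oddForm (m : ℕ) : MvPolynomial ℕ K →ₗ[K] ((Fin m → A) → K) :=
  LinearMap.pi fun a => polar Finset.univ (c.vec ∘ a)

/-- The `(m + 1)`-cochain `C(X) ∧ p`, for a polynomial `p` in the `y_i = C(x^i)`. -/
def xiForm (m : ℕ) : MvPolynomial ℕ K →ₗ[K] ((Fin (m + 1) → A) → K) :=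
  LinearMap.pi fun a => ∑ r : Fin (m + 1),
    ((-1) ^ (r : ℕ) * c.xi (a r)) • polar (Finset.univ.erase r) (c.vec ∘ a)

theorem oddForm_apply (m : ℕ) (p : MvPolynomial ℕ K) (a : Fin m → A) :
    c.oddForm m p a = polar Finset.univ (c.vec ∘ a) p := rfl

theorem xiForm_apply (m : ℕ) (p : MvPolynomial ℕ K) (a : Fin (m + 1) → A) :
    c.xiForm m p a = ∑ r : Fin (m + 1),
      (-1) ^ (r : ℕ) * c.xi (a r) * polar (Finset.univ.erase r) (c.vec ∘ a) p := by
  simp [xiForm]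

theorem vec_comp_update {ι : Type*} [DecidableEq ι] (a : ι → A) (i : ι) (x : A) :
    c.vec ∘ Function.update a i x = Function.update (c.vec ∘ a) i (c.vec x) :=
  Function.comp_update _ _ _ _

theorem polar_update_add {ι : Type*} [DecidableEq ι] {s : Finset ι} {i : ι} (hi : i ∈ s)
    (a : ι → A) (x x' : A) (p : MvPolynomial ℕ K) :
    polar s (c.vec ∘ Function.update a i (x + x')) p =
      polar s (c.vec ∘ Function.update a i x) p + polar s (c.vec ∘ Function.update a i x') p := by
  simp only [vec_comp_update, MvPolynomial.polar_update_of_mem hi, map_add,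
    MvPolynomial.vecDeriv_add, Derivation.add_apply, MvPolynomial.coeff_add]

theorem polar_update_smul {ι : Type*} [DecidableEq ι] {s : Finset ι} {i : ι} (hi : i ∈ s)
    (a : ι → A) (r : K) (x : A) (p : MvPolynomial ℕ K) :
    polar s (c.vec ∘ Function.update a i (r • x)) p =
      r * polar s (c.vec ∘ Function.update a i x) p := by
  simp only [vec_comp_update, MvPolynomial.polar_update_of_mem hi, map_smul,
    MvPolynomial.vecDeriv_smul, Derivation.smul_apply, MvPolynomial.coeff_smul, smul_eq_mul]

theorem polar_update_of_notMem {ι : Type*} [DecidableEq ι] {s : Finset ι} {i : ι} (hi : i ∉ s)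
    (a : ι → A) (x : A) (p : MvPolynomial ℕ K) :
    polar s (c.vec ∘ Function.update a i x) p = polar s (c.vec ∘ a) p := by
  rw [vec_comp_update, MvPolynomial.polar_update_of_notMem hi]

theorem vec_eq_zero_of_par {a : A} (h : L.par 0 a = a) : c.vec a = 0 := by
  rw [← h, c.vec_par_zero]

theorem xi_eq_zero_of_par {a : A} (h : L.par 1 a = a) : c.xi a = 0 := by
  rw [← h, c.xi_par_one]

theorem eq_of_y_ne_zero {a : A} {n : ℤ} (h : L.comp n a = a) {l : ℕ} (hl : c.vec a l ≠ 0) :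
    n = l := by
  rw [c.vec_apply, ← h, c.y_comp] at hl
  by_contra h'
  exact hl (if_neg h')

theorem eq_of_xi_ne_zero {a : A} {n : ℤ} (h : L.comp n a = a) (hl : c.xi a ≠ 0) : n = -1 := by
  rw [← h, c.xi_comp] at hl
  by_contra h'
  exact hl (if_neg h')

theorem eq_zero_of_comp_eq_zero {a : A} {N : ℤ} (hN : -1 ≤ N) (h : ∀ n ≤ N, L.comp n a = 0) :
    c.xi a = 0 ∧ ∀ l : ℕ, (l : ℤ) ≤ N → c.vec a l = 0 := by
  constructor
  · have := c.xi_comp (-1) a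
    rw [h _ hN, map_zero, if_pos rfl] at this
    exact this.symm
  · intro l hl
    have := c.y_comp l l a
    rw [h _ hl, map_zero, if_pos rfl] at this
    exact this.symm

theorem vecDeriv_eq_zero {p : MvPolynomial ℕ K} {a : A}
    (h : ∀ n ≤ ((p.vars.sup id : ℕ) : ℤ), L.comp n a = 0) : vecDeriv (c.vec a) p = 0 := by
  refine MvPolynomial.derivation_eq_zero_of_forall_mem_vars fun i hi => ?_
  rw [MvPolynomial.vecDeriv_X, (c.eq_zero_of_comp_eq_zero (by omega) h).2 i, MvPolynomial.C_0]
  exact_mod_cast Finset.le_sup (f := id) hi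

theorem polar_comp_swap {k : ℕ} (i j : Fin k) (a : Fin k → A) (s : Finset (Fin k))
    (p : MvPolynomial ℕ K) :
    polar s (c.vec ∘ a ∘ Equiv.swap i j) p =
      polar (s.map (Equiv.swap i j).toEmbedding) (c.vec ∘ a) p := by
  rw [polar, polar, MvPolynomial.multiDeriv_map]
  rfl

/-- Super skew-symmetry only distinguishes whether both exchanged arguments are odd. -/
theorem zmod_two_cases (p q : ZMod 2) : (p = 1 ∧ q = 1) ∨ ((p * q).val = 0 ∧ (p = 0 ∨ q = 0)) := by
  revert p q; decide

/-- The polarization is symmetric, as required for odd arguments, and vanishes as soon as one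
argument is even. Continuity holds because `p` involves finitely many variables; the largest index
of one serves as bound. -/
theorem oddForm_mem {m : ℕ} {n : ℤ} {b' : ℕ} {p : MvPolynomial ℕ K} (hp : p ∈ polys K b' m n) :
    c.oddForm m p ∈ L.cochains m n := by
  refine ⟨⟨MultilinearMap.mk' (c.oddForm m p) (fun a i x y => ?_) (fun a i r x => ?_), rfl⟩, ?_, ?_,
    ⟨(p.vars.sup id : ℕ), ?_⟩⟩
  · exact c.polar_update_add (Finset.mem_univ i) a x y p
  · exact c.polar_update_smul (Finset.mem_univ i) a r x p
  · intro i j hij q q' a hi hj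
    rw [oddForm_apply, oddForm_apply, polar_comp_swap]
    have : Finset.univ.map (Equiv.swap i j).toEmbedding = Finset.univ := by simp
    rw [this]
    rcases zmod_two_cases q q' with ⟨rfl, rfl⟩ | ⟨h, h'⟩
    · have : ((1 : ZMod 2) * 1).val = 1 := rfl
      rw [this]; ring
    · have : polar Finset.univ (c.vec ∘ a) p = 0 := by
        rcases h' with rfl | rfl
        · exact MvPolynomial.polar_eq_zero' (Finset.mem_univ i) (c.vec_eq_zero_of_par hi)
        · exact MvPolynomial.polar_eq_zero' (Finset.mem_univ j) (c.vec_eq_zero_of_par hj)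
      rw [this]; ring
  · intro a d hd hs
    by_contra h
    exact hs (MvPolynomial.sum_eq_of_polar_ne_zero (fun i l => c.eq_of_y_ne_zero (hd i))
      (fun μ hμ => (hp μ hμ).2.2) h)
  · intro a i hi
    exact MvPolynomial.polar_eq_zero (Finset.mem_univ i) (c.vecDeriv_eq_zero hi)

/-- The weight of `p` exceeds the grade by one because `X` has grade `-1`. A transposition of `i`
and `j` permutes the summands: if `r` is one of the two, the sign `(-1)^r` changes, and the summand
is zero when both arguments are odd; otherwise the polarization is unchanged, and it is zero when
one of them is even. -/
theorem xiForm_mem {m : ℕ} {n : ℤ} {b' : ℕ} {p : MvPolynomial ℕ K} (hp : p ∈ polys K b' m (n + 1)) :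
    c.xiForm m p ∈ L.cochains (m + 1) n := by
  refine ⟨⟨MultilinearMap.mk' (c.xiForm m p) (fun a i x y => ?_) (fun a i r x => ?_), rfl⟩, ?_, ?_,
    ⟨(p.vars.sup id : ℕ), ?_⟩⟩
  · rw [xiForm_apply, xiForm_apply, xiForm_apply, ← Finset.sum_add_distrib]
    refine Finset.sum_congr rfl fun r _ => ?_
    by_cases h : i = r
    · subst h
      simp only [c.polar_update_of_notMem (Finset.notMem_erase i _), Function.update_self, map_add]
      ring
    · simp only [c.polar_update_add (Finset.mem_erase.2 ⟨h, Finset.mem_univ i⟩),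
        Function.update_of_ne (Ne.symm h)]
      ring
  · rw [xiForm_apply, xiForm_apply, smul_eq_mul, Finset.mul_sum]
    refine Finset.sum_congr rfl fun r' _ => ?_
    by_cases h : i = r'
    · subst h
      simp only [c.polar_update_of_notMem (Finset.notMem_erase i _), Function.update_self, map_smul,
        smul_eq_mul]
      ring
    · simp only [c.polar_update_smul (Finset.mem_erase.2 ⟨h, Finset.mem_univ i⟩),
        Function.update_of_ne (Ne.symm h)]
      ring
  · intro i j hij q q' a hi hj
    have hij' : i ≠ j := fun h => by rw [h] at hij; omega
    rw [xiForm_apply, xiForm_apply, ← Equiv.sum_comp (Equiv.swap i j), Finset.mul_sum,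
      ← Finset.sum_neg_distrib]
    refine Finset.sum_congr rfl fun r _ => ?_
    have : (Finset.univ.erase (Equiv.swap i j r)).map (Equiv.swap i j).toEmbedding =
        Finset.univ.erase r := by
      rw [Finset.map_erase]; simp
    rw [polar_comp_swap, this, Function.comp_apply, Equiv.swap_apply_self]
    by_cases h : r = i ∨ r = j
    · have hs : (-1 : K) ^ ((Equiv.swap i j r : Fin (m + 1)) : ℕ) = -(-1) ^ (r : ℕ) := by
        rcases h with rfl | rfl
        · rw [Equiv.swap_apply_left, ← hij, pow_succ]; ring
        · rw [Equiv.swap_apply_right, ← hij, pow_succ]; ring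
      rw [hs]
      rcases zmod_two_cases q q' with ⟨rfl, rfl⟩ | ⟨h', -⟩
      · have : c.xi (a r) = 0 := by
          rcases h with rfl | rfl
          · exact c.xi_eq_zero_of_par hi
          · exact c.xi_eq_zero_of_par hj
        rw [this]; ring
      · rw [h']; ring
    · rw [not_or] at h
      rw [Equiv.swap_apply_of_ne_of_ne h.1 h.2]
      rcases zmod_two_cases q q' with ⟨rfl, rfl⟩ | ⟨-, h'⟩
      · have : ((1 : ZMod 2) * 1).val = 1 := rfl
        rw [this]; ring
      · have : polar (Finset.univ.erase r) (c.vec ∘ a) p = 0 := by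
          rcases h' with rfl | rfl
          · exact MvPolynomial.polar_eq_zero' (Finset.mem_erase.2 ⟨Ne.symm h.1, Finset.mem_univ i⟩)
              (c.vec_eq_zero_of_par hi)
          · exact MvPolynomial.polar_eq_zero' (Finset.mem_erase.2 ⟨Ne.symm h.2, Finset.mem_univ j⟩)
              (c.vec_eq_zero_of_par hj)
        rw [this]; ring
  · intro a d hd hs
    rw [xiForm_apply]
    refine Finset.sum_eq_zero fun r _ => ?_
    by_contra h
    have h1 := c.eq_of_xi_ne_zero (hd r) fun h' => h (by rw [h']; ring)
    have h2 := MvPolynomial.sum_eq_of_polar_ne_zero (s := Finset.univ.erase r) (v := c.vec ∘ a)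
      (fun i l => c.eq_of_y_ne_zero (hd i))
      (fun μ hμ => (hp μ hμ).2.2) fun h' => h (by rw [h']; ring)
    apply hs
    rw [← Finset.add_sum_erase _ _ (Finset.mem_univ r), h1, h2]
    ring
  · intro a i hi
    rw [xiForm_apply]
    refine Finset.sum_eq_zero fun r _ => ?_
    by_cases h : i = r
    · subst h
      rw [(c.eq_zero_of_comp_eq_zero (by omega) hi).1]; ring
    · have : polar (Finset.univ.erase r) (c.vec ∘ a) p = 0 := MvPolynomial.polar_eq_zero
        (Finset.mem_erase.2 ⟨h, Finset.mem_univ i⟩) (c.vecDeriv_eq_zero hi)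
      rw [this, mul_zero]

end Coordinates
end GradedLieSuperalgebra

/-! ### Exterior product and differential in terms of polynomials -/

theorem Fin.univ_map_succAboveEmb {n : ℕ} (j : Fin (n + 1)) :
    Finset.univ.map j.succAboveEmb = Finset.univ.erase j := by
  ext r
  simp [Fin.exists_succAbove_eq_iff]

theorem Fin.sum_succAbove_eq {M : Type*} [AddCommMonoid M] {n : ℕ} (j : Fin (n + 1))
    (f : Fin (n + 1) → M) : ∑ l, f (j.succAbove l) = ∑ r ∈ Finset.univ.erase j, f r := by
  rw [← Fin.univ_map_succAboveEmb, Finset.sum_map]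
  rfl

/-- Deleting the place `j` shifts the places behind it by one, which changes their sign. -/
theorem Fin.neg_one_pow_eq_succAbove {R : Type*} [Ring R] {n : ℕ} (j : Fin (n + 1)) (l : Fin n) :
    (-1 : R) ^ (l : ℕ) = (-1) ^ (j.succAbove l : ℕ) * if j < j.succAbove l then -1 else 1 := by
  rcases lt_or_ge l.castSucc j with h | h
  · rw [Fin.succAbove_of_castSucc_lt _ _ h, if_neg (by simpa using h.le)]
    simp
  · rw [Fin.succAbove_of_le_castSucc _ _ h, if_pos (by simpa [Fin.lt_def, Fin.le_def, Nat.lt_succ_iff] using h)]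
    simp [pow_succ]

/-- In the differential a pair `i < j` contributes twice, since either argument may supply `X`;
together this is a sum over all ordered pairs of distinct places. -/
theorem Finset.sum_ite_lt_add_eq {M : Type*} [AddCommMonoid M] {n : ℕ} (H : Fin n → Fin n → M) :
    ∑ i, ∑ j, (if i < j then H i j + H j i else 0) = ∑ j, ∑ i ∈ Finset.univ.erase j, H i j := by
  have h1 : ∀ i j, (if i < j then H i j + H j i else 0) =
      (if i < j then H i j else 0) + if i < j then H j i else 0 := fun i j => by
    split_ifs <;> simp
  simp only [h1, Finset.sum_add_distrib]
  rw [Finset.sum_comm, ← Finset.sum_add_distrib]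
  refine Finset.sum_congr rfl fun j _ => ?_
  rw [← Finset.sum_add_distrib, ← Finset.add_sum_erase _ _ (Finset.mem_univ j)]
  simp only [lt_self_iff_false, if_false, zero_add]
  refine Finset.sum_congr rfl fun i hi => ?_
  rcases lt_or_gt_of_ne (Finset.ne_of_mem_erase hi) with h | h
  · rw [if_pos h, if_neg h.not_gt, add_zero]
  · rw [if_neg h.not_gt, if_pos h, zero_add]

theorem Fin.prod_ite_lt {R : Type*} [CommRing R] {n : ℕ} (j : Fin n) :
    ∏ s, (if j < s then (-1 : R) else 1) = (-1) ^ (n - 1 - (j : ℕ)) := by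
  rw [Finset.prod_ite, Finset.prod_const_one, mul_one, Finset.prod_const]
  congr 1
  rw [← Fin.card_Ioi]
  congr 1
  ext; simp

theorem Fin.prod_ite_lt_lt {R : Type*} [CommRing R] {n : ℕ} (i j : Fin n) :
    ∏ s, (if i < s ∧ s < j then (-1 : R) else 1) = (-1) ^ ((j : ℕ) - i - 1) := by
  rw [Finset.prod_ite, Finset.prod_const_one, mul_one, Finset.prod_const]
  congr 1
  rw [← Fin.card_Ioo]
  congr 1
  ext; simp

namespace GradedLieSuperalgebra

open MvPolynomial (vecDeriv multiDeriv polar raise shiftVec polys)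

variable {K A : Type*} [Field K] [AddCommGroup A] [Module K A]

namespace Coordinates

variable {L : GradedLieSuperalgebra K A} {b : ℕ} (c : L.Coordinates b)

theorem oddForm_comp_succAbove {m : ℕ} (j : Fin (m + 1)) (a : Fin (m + 1) → A)
    (p : MvPolynomial ℕ K) :
    c.oddForm m p (a ∘ j.succAbove) = polar (Finset.univ.erase j) (c.vec ∘ a) p := by
  rw [oddForm_apply, ← Fin.univ_map_succAboveEmb, polar, polar, MvPolynomial.multiDeriv_map]
  rfl

theorem xiForm_comp_succAbove {m : ℕ} (j : Fin (m + 2)) (a : Fin (m + 2) → A)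
    (p : MvPolynomial ℕ K) :
    c.xiForm m p (a ∘ j.succAbove) = ∑ r ∈ Finset.univ.erase j,
      (-1) ^ (r : ℕ) * (if j < r then -1 else 1) * c.xi (a r) *
        polar ((Finset.univ.erase j).erase r) (c.vec ∘ a) p := by
  rw [xiForm_apply, ← Fin.sum_succAbove_eq]
  refine Finset.sum_congr rfl fun l _ => ?_
  have : (Finset.univ.erase j).erase (j.succAbove l) =
      (Finset.univ.erase l).map j.succAboveEmb := by
    rw [Finset.map_erase, Fin.univ_map_succAboveEmb]; rfl
  rw [this, Fin.neg_one_pow_eq_succAbove j l, polar, polar, MvPolynomial.multiDeriv_map]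
  rfl

/-- Only the odd part of `a j` is seen by `C(x^i)`. The twists of the arguments behind it then
produce the same sign as the prefactor, and the two cancel. -/
theorem wedge_xiForm (m i : ℕ) (p : MvPolynomial ℕ K) :
    L.wedge (c.xiForm m p) (c.y i) = c.xiForm (m + 1) (MvPolynomial.X i * p) := by
  funext a
  have hj : ∀ j : Fin (m + 2), ((-1) ^ (m + 1 - (j : ℕ)) * ∑ ε : ZMod 2,
      c.xiForm m p (fun s => if j < j.succAbove s then L.twist ε (a (j.succAbove s))
        else a (j.succAbove s)) * c.y i (L.par ε (a j))) =
      ∑ r ∈ Finset.univ.erase j, (-1) ^ (r : ℕ) * c.xi (a r) *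
        (c.y i (a j) * polar ((Finset.univ.erase j).erase r) (c.vec ∘ a) p) := fun j => by
    have hs : ∀ f : ZMod 2 → K, ∑ ε, f ε = f 0 + f 1 := fun f => Fin.sum_univ_two f
    rw [hs, c.y_par_zero, mul_zero, zero_add, c.y_par_one]
    set a' : Fin (m + 2) → A := fun s => if j < s then L.twist 1 (a s) else a s with ha'
    have h1 : (fun s => if j < j.succAbove s then L.twist 1 (a (j.succAbove s))
        else a (j.succAbove s)) = a' ∘ j.succAbove := rfl
    have hxi : ∀ r, c.xi (a' r) = c.xi (a r) := fun r => by
      rw [ha']; dsimp only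
      split_ifs
      · exact c.xi_twist _ _
      · rfl
    have hvec : c.vec ∘ a' = fun s => (if j < s then (-1 : K) else 1) • (c.vec ∘ a) s := by
      funext s
      simp only [ha', Function.comp_apply]
      split_ifs
      · rw [c.vec_twist]; congr 1; exact pow_one _
      · rw [one_smul]
    rw [h1, c.xiForm_comp_succAbove, hvec, Finset.sum_mul, Finset.mul_sum]
    refine Finset.sum_congr rfl fun r hr => ?_
    rw [MvPolynomial.polar_smul, hxi]
    -- The argument `a r`, entering through `C(X)`, is not twisted; the shift of `r` caused by
    -- deleting `j` supplies the missing factor.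
    have hprod : (if j < r then (-1 : K) else 1) *
        ∏ s ∈ (Finset.univ.erase j).erase r, (if j < s then (-1 : K) else 1) =
          (-1) ^ (m + 1 - (j : ℕ)) := by
      have h2 := Finset.mul_prod_erase _ (fun s => if j < s then (-1 : K) else 1) hr
      rw [Finset.prod_erase (a := j) _ (by simp), Fin.prod_ite_lt] at h2
      exact h2
    have hsq : (-1 : K) ^ (m + 1 - (j : ℕ)) * (-1) ^ (m + 1 - (j : ℕ)) = 1 := by
      rw [← mul_pow]; simp
    linear_combination ((-1) ^ (m + 1 - (j : ℕ)) * (-1) ^ (r : ℕ) * c.xi (a r) * c.y i (a j) *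
      polar ((Finset.univ.erase j).erase r) (c.vec ∘ a) p) * hprod +
      ((-1) ^ (r : ℕ) * c.xi (a r) * c.y i (a j) *
      polar ((Finset.univ.erase j).erase r) (c.vec ∘ a) p) * hsq
  rw [wedge, Finset.sum_congr rfl fun j _ => hj j, xiForm_apply]
  rw [Finset.sum_comm' (t' := Finset.univ) (s' := fun r => Finset.univ.erase r)
    (by intro x y; simp [eq_comm])]
  refine Finset.sum_congr rfl fun r _ => ?_
  rw [MvPolynomial.polar_X_mul, Finset.mul_sum]
  refine Finset.sum_congr rfl fun j _ => ?_
  rw [Finset.erase_right_comm]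
  rfl

/-- The arguments in the terms of the differential, before deleting the `j`-th one. -/
def dArg {k : ℕ} (L : GradedLieSuperalgebra K A) (a : Fin k → A) (i j : Fin k) (ε : ZMod 2) :
    Fin k → A := fun s =>
  if s = i then L.bracket (a i) (L.par ε (a j))
  else if i < s ∧ s < j then L.twist ε (a s) else a s

theorem d_apply {k : ℕ} (C : (Fin k → A) → K) (a : Fin (k + 1) → A) :
    L.d k C a = ∑ i : Fin (k + 1), ∑ j : Fin (k + 1), if i < j then
      (-1) ^ (j : ℕ) * (C (dArg L a i j 0 ∘ j.succAbove) + C (dArg L a i j 1 ∘ j.succAbove))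
      else 0 := by
  change (∑ i : Fin (k + 1), ∑ j : Fin (k + 1), if i < j then _ else (0 : K)) = _
  refine Finset.sum_congr rfl fun i _ => Finset.sum_congr rfl fun j _ => ?_
  split_ifs
  · congr 1
    exact Fin.sum_univ_two (M := K) _
  · rfl

theorem xi_dArg {k : ℕ} (a : Fin k → A) {i s : Fin k} (j : Fin k) (ε : ZMod 2) (h : s ≠ i) :
    c.xi (dArg L a i j ε s) = c.xi (a s) := by
  rw [dArg, if_neg h]
  split_ifs
  · exact c.xi_twist _ _
  · rfl

theorem xi_dArg_self {k : ℕ} (a : Fin k → A) (i j : Fin k) (ε : ZMod 2) :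
    c.xi (dArg L a i j ε i) = 0 := by
  rw [dArg, if_pos rfl, c.xi_bracket]

/-- The even part of `a j` is a multiple of `X`, so the bracket shifts the vector of `a i`; the
twists are trivial. -/
theorem polar_dArg_zero {k : ℕ} (a : Fin k → A) {i : Fin k} (j : Fin k) {S : Finset (Fin k)}
    (hi : i ∈ S) (p : MvPolynomial ℕ K) :
    polar S (c.vec ∘ dArg L a i j 0) p = c.xi (a j) * MvPolynomial.coeff 0
      (vecDeriv (shiftVec b (c.vec (a i))) (multiDeriv (S.erase i) (c.vec ∘ a) p)) := by
  rw [MvPolynomial.polar_erase hi]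
  have h1 : (c.vec ∘ dArg L a i j 0) i = c.xi (a j) • shiftVec b (c.vec (a i)) := by
    have h0 : shiftVec b (0 : ℕ → K) = 0 := by funext l; simp [shiftVec]
    rw [Function.comp_apply, dArg, if_pos rfl, c.vec_bracket, c.xi_par_zero, c.vec_par_zero, h0,
      smul_zero, sub_zero]
  have h2 : multiDeriv (S.erase i) (c.vec ∘ dArg L a i j 0) =
      multiDeriv (S.erase i) (c.vec ∘ a) := by
    refine MvPolynomial.multiDeriv_congr fun s hs => ?_
    rw [Function.comp_apply, dArg, if_neg (Finset.ne_of_mem_erase hs)]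
    split_ifs
    · rw [c.vec_twist, ZMod.val_zero, pow_zero, one_smul, Function.comp_apply]
    · rfl
  rw [h1, h2, MvPolynomial.vecDeriv_smul, Derivation.smul_apply, MvPolynomial.coeff_smul,
    smul_eq_mul]

/-- With the odd part of `a j` it is `a i` that supplies `X`: the bracket changes sign, and the
arguments strictly between `i` and `j` are twisted. -/
theorem polar_dArg_one {k : ℕ} (a : Fin k → A) {i : Fin k} (j : Fin k) {S : Finset (Fin k)}
    (hi : i ∈ S) (p : MvPolynomial ℕ K) :
    polar S (c.vec ∘ dArg L a i j 1) p =
      -(∏ s ∈ S, if i < s ∧ s < j then (-1 : K) else 1) * (c.xi (a i) * MvPolynomial.coeff 0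
      (vecDeriv (shiftVec b (c.vec (a j))) (multiDeriv (S.erase i) (c.vec ∘ a) p))) := by
  rw [MvPolynomial.polar_erase hi]
  have h1 : (c.vec ∘ dArg L a i j 1) i = (-c.xi (a i)) • shiftVec b (c.vec (a j)) := by
    rw [Function.comp_apply, dArg, if_pos rfl, c.vec_bracket, c.xi_par_one, c.vec_par_one,
      zero_smul, zero_sub, neg_smul]
  have h2 : multiDeriv (S.erase i) (c.vec ∘ dArg L a i j 1) =
      multiDeriv (S.erase i)
        (fun s => (if i < s ∧ s < j then (-1 : K) else 1) • (c.vec ∘ a) s) := by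
    refine MvPolynomial.multiDeriv_congr fun s hs => ?_
    rw [Function.comp_apply, dArg, if_neg (Finset.ne_of_mem_erase hs)]
    split_ifs
    · rw [c.vec_twist]; congr 1; exact pow_one _
    · exact (one_smul _ _).symm
  rw [h1, h2, MvPolynomial.vecDeriv_smul, Derivation.smul_apply, MvPolynomial.multiDeriv_smul,
    Derivation.map_smul, MvPolynomial.coeff_smul, MvPolynomial.coeff_smul, smul_eq_mul,
    smul_eq_mul, Finset.prod_erase _ (by simp)]
  ring

/-- The sign of the differential, the sign of the bracket and the `j - i - 1` twists combine to the
sign that moves `a i` to the front. -/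
theorem neg_one_pow_mul {i j : ℕ} (h : i < j) :
    (-1 : K) ^ j * -(-1) ^ (j - i - 1) = (-1) ^ i := by
  obtain ⟨l, rfl⟩ := Nat.exists_eq_add_of_lt h
  have : i + l + 1 - i - 1 = l := by omega
  rw [this, pow_succ, pow_add]
  have : (-1 : K) ^ l * (-1) ^ l = 1 := by rw [← mul_pow]; simp
  linear_combination (-1) ^ i * this

/-- For `i < j` the two parities of `a j` give `H i j`, with `X` taken from `a j`, and `H j i`, with
`X` taken from `a i`. For a fixed supplier of `X`, the sum over the shifted argument is the
polarization of `raise K b p` by `polar_raise`. -/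
theorem d_oddForm (m : ℕ) (p : MvPolynomial ℕ K) :
    L.d m (c.oddForm m p) = c.xiForm m (raise K b p) := by
  funext a
  set H : Fin (m + 1) → Fin (m + 1) → K := fun i j => (-1) ^ (j : ℕ) * c.xi (a j) *
    MvPolynomial.coeff 0 (vecDeriv (shiftVec b (c.vec (a i)))
      (multiDeriv ((Finset.univ.erase j).erase i) (c.vec ∘ a) p)) with hH
  have hij : ∀ i j : Fin (m + 1), (if i < j then (-1 : K) ^ (j : ℕ) *
      (c.oddForm m p (dArg L a i j 0 ∘ j.succAbove) + c.oddForm m p (dArg L a i j 1 ∘ j.succAbove))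
      else 0) = if i < j then H i j + H j i else 0 := fun i j => by
    split_ifs with h
    · have hi : i ∈ Finset.univ.erase j := Finset.mem_erase.2 ⟨h.ne, Finset.mem_univ i⟩
      rw [c.oddForm_comp_succAbove, c.oddForm_comp_succAbove, c.polar_dArg_zero a j hi,
        c.polar_dArg_one a j hi, Finset.prod_erase _ (by simp), Fin.prod_ite_lt_lt, hH]
      dsimp only
      rw [Finset.erase_right_comm (a := i)]
      linear_combination (c.xi (a i) * MvPolynomial.coeff 0 (vecDeriv (shiftVec b (c.vec (a j)))
        (multiDeriv ((Finset.univ.erase j).erase i) (c.vec ∘ a) p))) *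
          neg_one_pow_mul (K := K) (Fin.lt_def.1 h)
    · rfl
  rw [d_apply]
  simp only [hij]
  rw [Finset.sum_ite_lt_add_eq, xiForm_apply]
  refine Finset.sum_congr rfl fun j _ => ?_
  rw [MvPolynomial.polar_raise, Finset.mul_sum]
  rfl

theorem sum_eq_zero_of_antisymm [CharZero K] {ι : Type*} [Fintype ι] (f : ι → ι → K)
    (h : ∀ i j, f i j = -f j i) : ∑ i, ∑ j, f i j = 0 := by
  have : ∑ i, ∑ j, f i j = -∑ i, ∑ j, f i j := by
    conv_lhs => rw [Finset.sum_comm]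
    simp only [← Finset.sum_neg_distrib]
    exact Finset.sum_congr rfl fun i _ => Finset.sum_congr rfl fun j _ => h j i
  exact self_eq_neg.1 this

/-- Each term contains `C(X)` twice: once from the bracket, once from the form. With the shifted
argument `i` fixed, the terms are antisymmetric in the two places `j`, `r` that supply `X`. -/
theorem d_xiForm [CharZero K] (m : ℕ) (p : MvPolynomial ℕ K) :
    L.d (m + 1) (c.xiForm m p) = 0 := by
  funext a
  set G : Fin (m + 2) → Fin (m + 2) → Fin (m + 2) → K := fun i j r =>
    MvPolynomial.coeff 0 (vecDeriv (shiftVec b (c.vec (a i)))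
      (multiDeriv (((Finset.univ.erase j).erase r).erase i) (c.vec ∘ a) p)) with hG
  set T : Fin (m + 2) → Fin (m + 2) → Fin (m + 2) → K := fun i j r =>
    (-1) ^ (j : ℕ) * (-1) ^ (r : ℕ) * (if j < r then -1 else 1) * c.xi (a j) * c.xi (a r) *
      G i j r with hT
  set H : Fin (m + 2) → Fin (m + 2) → K := fun i j =>
    ∑ r ∈ (Finset.univ.erase j).erase i, T i j r with hH
  have hij : ∀ i j : Fin (m + 2), (if i < j then (-1 : K) ^ (j : ℕ) *
      (c.xiForm m p (dArg L a i j 0 ∘ j.succAbove) + c.xiForm m p (dArg L a i j 1 ∘ j.succAbove))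
      else 0) = if i < j then H i j + H j i else 0 := fun i j => by
    split_ifs with h
    · have hi : i ∈ Finset.univ.erase j := Finset.mem_erase.2 ⟨h.ne, Finset.mem_univ i⟩
      rw [c.xiForm_comp_succAbove, c.xiForm_comp_succAbove, ← Finset.add_sum_erase _ _ hi,
        ← Finset.add_sum_erase _ _ hi, c.xi_dArg_self, c.xi_dArg_self, hH]
      dsimp only
      rw [Finset.erase_right_comm (a := i) (b := j), mul_zero, zero_mul, zero_mul, zero_add,
        zero_add,
        ← Finset.sum_add_distrib, ← Finset.sum_add_distrib, Finset.mul_sum]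
      refine Finset.sum_congr rfl fun r hr => ?_
      obtain ⟨hri, hr⟩ := Finset.mem_erase.1 hr
      have hrj := Finset.ne_of_mem_erase hr
      have hi' : i ∈ (Finset.univ.erase j).erase r := Finset.mem_erase.2 ⟨Ne.symm hri, hi⟩
      rw [c.polar_dArg_zero a j hi', c.polar_dArg_one a j hi', c.xi_dArg a j 0 hri,
        c.xi_dArg a j 1 hri]
      -- Exchanging the roles of `i` and `j` replaces the shift of `r` due to deleting `j` by the
      -- shift due to deleting `i`; the two differ exactly when `r` lies between them, where its
      -- twist is missing.
      have hprod : (∏ s ∈ (Finset.univ.erase j).erase r,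
          if i < s ∧ s < j then (-1 : K) else 1) * (if j < r then -1 else 1) =
          (-1) ^ ((j : ℕ) - i - 1) * (if i < r then -1 else 1) := by
        have h1 := Finset.mul_prod_erase (Finset.univ.erase j)
          (fun s => if i < s ∧ s < j then (-1 : K) else 1) hr
        rw [Finset.prod_erase (a := j) _ (by simp), Fin.prod_ite_lt_lt] at h1
        rw [← h1]
        rcases lt_trichotomy j r with h2 | h2 | h2
        · rw [if_pos h2, if_pos (h.trans h2), if_neg fun h' => absurd h'.2 h2.not_gt, one_mul]
        · exact absurd h2.symm hrj
        · rcases lt_or_gt_of_ne hri with h3 | h3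
          · rw [if_neg h2.not_gt, if_neg h3.not_gt, if_neg fun h' => absurd h'.1 h3.not_gt]; ring
          · rw [if_neg h2.not_gt, if_pos h3, if_pos ⟨h3, h2⟩]; ring
      have hGji : G j i r = MvPolynomial.coeff 0 (vecDeriv (shiftVec b (c.vec (a j)))
          (multiDeriv (((Finset.univ.erase j).erase r).erase i) (c.vec ∘ a) p)) := by
        have : ((Finset.univ.erase i).erase r).erase j =
            ((Finset.univ.erase j).erase r).erase i := by
          ext s; simp only [Finset.mem_erase]; tauto
        rw [hG]; dsimp only; rw [this]
      rw [← hGji, hT]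
      dsimp only
      have hs := neg_one_pow_mul (K := K) (Fin.lt_def.1 h)
      linear_combination (-(-1) ^ (j : ℕ) * (-1) ^ (r : ℕ) * c.xi (a r) * c.xi (a i) * G j i r) *
        hprod + ((-1) ^ (r : ℕ) * c.xi (a r) * c.xi (a i) * G j i r * (if i < r then -1 else 1)) * hs
    · rfl
  rw [d_apply]
  simp only [hij]
  rw [Finset.sum_ite_lt_add_eq, Finset.sum_comm' (t' := Finset.univ)
    (s' := fun i => Finset.univ.erase i) (by intro x y; simp [eq_comm])]
  refine Finset.sum_eq_zero fun i _ => ?_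
  -- Extension by zero to coinciding places gives an antisymmetric function on all pairs.
  have h0 := sum_eq_zero_of_antisymm (K := K) (ι := Fin (m + 2))
    (fun j r => if j = i ∨ r = i ∨ j = r then 0 else T i j r) fun j r => by
      by_cases h : j = i ∨ r = i ∨ j = r
      · rw [if_pos h, if_pos (by tauto), neg_zero]
      · rw [if_neg h, if_neg (by tauto), hT, hG]
        dsimp only
        rw [Finset.erase_right_comm (a := j) (b := r)]
        have : (if j < r then (-1 : K) else 1) = -(if r < j then (-1 : K) else 1) := by
          rcases lt_trichotomy j r with h2 | h2 | h2
          · rw [if_pos h2, if_neg h2.not_gt]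
          · exact absurd h2 (by tauto)
          · rw [if_pos h2, if_neg h2.not_gt, neg_neg]
        rw [this]
        ring
  rw [← h0, ← Finset.add_sum_erase _ _ (Finset.mem_univ i)]
  simp only [true_or, if_true, Finset.sum_const_zero, zero_add]
  refine Finset.sum_congr rfl fun j hj => ?_
  have hji := Finset.ne_of_mem_erase hj
  rw [hH]
  dsimp only
  rw [← Finset.add_sum_erase _ _ (Finset.mem_univ j), if_pos (by simp), zero_add,
    ← Finset.add_sum_erase _ _ (Finset.mem_erase.2 ⟨Ne.symm hji, Finset.mem_univ i⟩),
    if_pos (by simp), zero_add]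
  refine Finset.sum_congr rfl fun r hr => ?_
  obtain ⟨hri, hr⟩ := Finset.mem_erase.1 hr
  have hrj := Finset.ne_of_mem_erase hr
  rw [if_neg (by simp [hji, hri, Ne.symm hrj])]

end Coordinates
end GradedLieSuperalgebra

/-! ### All cochains come from polynomials; the cohomology is a cokernel -/

theorem exists_perm_of_sum_single_eq {ι : Type*} [Fintype ι] {h h' : ι → ℕ}
    (e : ∑ i, Finsupp.single (h i) 1 = ∑ i, Finsupp.single (h' i) 1) :
    ∃ σ : Equiv.Perm ι, h' ∘ σ = h := by
  classical
  have hcard : ∀ (f : ι → ℕ) (x : ℕ), Fintype.card {i // f i = x} =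
      (∑ i, Finsupp.single (f i) 1) x := fun f x => by
    rw [Fintype.card_subtype, Finset.card_filter, Finsupp.finsetSum_apply]
    simp [Finsupp.single_apply]
  -- Corresponding fibres of `h` and `h'` have equal cardinality; bijections between them glue to
  -- the permutation.
  have he : ∀ x, Nonempty ({i // h i = x} ≃ {i // h' i = x}) := fun x => by
    rw [← Fintype.card_eq, hcard, hcard, e]
  have E := fun x => Classical.choice (he x)
  refine ⟨(Equiv.sigmaFiberEquiv h).symm.trans
    ((Equiv.sigmaCongrRight E).trans (Equiv.sigmaFiberEquiv h')), funext fun i => ?_⟩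
  exact (E (h i) ⟨i, rfl⟩).2

/-- A property of permutations of `Fin k` that is stable under composition with transpositions of
adjacent elements holds for all permutations. -/
theorem Equiv.Perm.adjacent_induction {k : ℕ} {P : Equiv.Perm (Fin k) → Prop} (h1 : P 1)
    (hmul : ∀ σ τ, P σ → P τ → P (σ * τ))
    (hs : ∀ i j : Fin k, (i : ℕ) + 1 = j → P (Equiv.swap i j)) (σ : Equiv.Perm (Fin k)) : P σ := by
  cases k with
  | zero => rwa [Subsingleton.elim σ 1]
  | succ n =>
    have hσ : σ ∈ Submonoid.closure
        (Set.range fun i : Fin n => Equiv.swap i.castSucc i.succ) := by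
      rw [Equiv.Perm.mclosure_swap_castSucc_succ]; trivial
    induction hσ using Submonoid.closure_induction with
    | mem x hx =>
      obtain ⟨i, rfl⟩ := hx
      exact hs _ _ (by simp)
    | one => exact h1
    | mul x y _ _ hx hy => exact hmul x y hx hy

namespace MvPolynomial

variable {K : Type*} [Field K]

theorem finite_setOf_isIndex (b m : ℕ) (n : ℤ) : {μ | IsIndex b m n μ}.Finite := by
  refine (Set.finite_Iic (∑ i ∈ Finset.range (n.toNat + 1), Finsupp.single i m)).subset ?_
  rintro μ ⟨-, h2, h3⟩ i
  by_cases hi : μ i = 0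
  · rw [hi]; exact Nat.zero_le _
  have h4 : i ≤ n.toNat := by
    have : i ≤ wt μ := Finsupp.le_weight_of_ne_zero' (fun i : ℕ => i) hi
    omega
  have h5 : μ i ≤ m := h2 ▸ Finsupp.le_degree i μ
  rw [Finsupp.finsetSum_apply]
  have := Finset.single_le_sum (f := fun j => Finsupp.single j m i) (fun j _ => Nat.zero_le _)
    (Finset.mem_range.2 (Nat.lt_succ_of_le h4))
  refine le_trans ?_ this
  simpa using h5

theorem isIndex_sum_single {b k : ℕ} {g : ℤ} {h : Fin k → ℕ} (hb : ∀ i, b ≤ h i)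
    (hg : ∑ i, (h i : ℤ) = g) : IsIndex b k g (∑ i, Finsupp.single (h i) 1) := by
  refine ⟨fun j hj => ?_, ?_, ?_⟩
  · rw [Finsupp.finsetSum_apply]
    refine Finset.sum_eq_zero fun i _ => Finsupp.single_eq_of_ne ?_
    have := hb i
    omega
  · simp
  · simp only [map_sum, wt_single, one_mul]
    push_cast
    exact hg

theorem exists_sum_single_eq {b : ℕ} {k : ℕ} {g : ℤ} {μ : ℕ →₀ ℕ} (hμ : IsIndex b k g μ) :
    ∃ h : Fin k → ℕ, (∀ i, b ≤ h i) ∧ ∑ i, Finsupp.single (h i) 1 = μ := by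
  obtain ⟨h1, h2, -⟩ := hμ
  induction k generalizing μ with
  | zero =>
    refine ⟨Fin.elim0, fun i => i.elim0, ?_⟩
    rw [(Finsupp.degree_eq_zero_iff μ).1 h2]
    rfl
  | succ k ih =>
    have h0 : μ ≠ 0 := by rintro rfl; simp at h2
    obtain ⟨j, hj⟩ := Finsupp.ne_iff.1 h0
    have e := Finsupp.sub_add_single_one_cancel (i := j) (u := μ) hj
    obtain ⟨h, hb, hh⟩ := ih (μ := μ - Finsupp.single j 1)
      (fun i hi => by simp [h1 i hi]) (by
        have := congrArg Finsupp.degree e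
        rw [map_add, Finsupp.degree_single, h2] at this
        omega)
    refine ⟨Fin.cons j h, fun i => ?_, ?_⟩
    · refine Fin.cases ?_ (fun i => ?_) i
      · exact not_lt.1 fun h => hj (h1 j h)
      · exact hb i
    · rw [Fin.sum_univ_succ]
      simp only [Fin.cons_zero, Fin.cons_succ, hh]
      rw [add_comm, e]

/-- A symmetric function of indices is given by the values of the polarization of a polynomial. -/
theorem exists_polar_eq [CharZero K] {b k : ℕ} {g : ℤ} (D : (Fin k → ℕ) → K)
    (hD : ∀ h (σ : Equiv.Perm (Fin k)), D (h ∘ σ) = D h)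
    (hg : ∀ h, ∑ i, (h i : ℤ) ≠ g → D h = 0) :
    ∃ p ∈ polys K b k g, ∀ h : Fin k → ℕ, (∀ i, b ≤ h i) →
      polar Finset.univ (fun i => Pi.single (h i) (1 : K)) p = D h := by
  classical
  choose c hc hcp using fun h : Fin k → ℕ => exists_polar_single_eq (K := K) Finset.univ h
  choose! H hHb hH using fun μ (hμ : IsIndex b k g μ) => exists_sum_single_eq hμ
  set F := (finite_setOf_isIndex b k g).toFinset with hF
  -- The tuple `H μ` is one chosen enumeration of the indices in `μ`, and the division compensates
  -- the factorials from polarizing.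
  set p : MvPolynomial ℕ K := ∑ μ ∈ F, monomial μ (D (H μ) / c (H μ)) with hp
  have hpc : ∀ μ, coeff μ p = if IsIndex b k g μ then D (H μ) / c (H μ) else 0 := fun μ => by
    rw [hp, coeff_sum]
    simp only [coeff_monomial, Finset.sum_ite_eq']
    simp [hF]
  refine ⟨p, fun μ hμ => ?_, fun h hb => ?_⟩
  · by_contra h
    exact hμ (by rw [hpc, if_neg h])
  · by_cases hs : ∑ i, (h i : ℤ) = g
    · have hI := isIndex_sum_single hb hs
      set μ := ∑ i, Finsupp.single (h i) 1
      obtain ⟨σ, hσ⟩ := exists_perm_of_sum_single_eq (h := h) (h' := H μ) (hH μ hI).symm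
      have : polar Finset.univ (fun i => Pi.single (h i) (1 : K)) p =
          polar Finset.univ (fun i => Pi.single (H μ i) (1 : K)) p := by
        rw [← hσ]
        conv_rhs => rw [← Finset.map_univ_equiv σ, polar, multiDeriv_map]
        rfl
      rw [this, hcp, hH μ hI, hpc, if_pos hI, mul_div_cancel₀ _ (hc _), ← hD (H μ) σ, hσ]
    · rw [hcp, hg h hs]
      have : coeff (∑ i, Finsupp.single (h i) 1) p = 0 := by
        rw [hpc, if_neg]
        rintro ⟨-, -, h3⟩
        apply hs
        simp only [map_sum, wt_single, one_mul] at h3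
        exact_mod_cast h3
      rw [this, mul_zero]

theorem eq_zero_of_polar_eq_zero [CharZero K] {b k : ℕ} {g : ℤ} {p : MvPolynomial ℕ K}
    (hp : p ∈ polys K b k g) (h0 : ∀ h : Fin k → ℕ, (∀ i, b ≤ h i) →
      polar Finset.univ (fun i => Pi.single (h i) (1 : K)) p = 0) : p = 0 := by
  ext μ
  by_contra hμ
  obtain ⟨h, hb, rfl⟩ := exists_sum_single_eq (hp μ hμ)
  obtain ⟨c, hc, hcp⟩ := exists_polar_single_eq (K := K) Finset.univ h
  have := h0 h hb
  rw [hcp] at this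
  exact hμ ((mul_eq_zero.1 this).resolve_left hc)

end MvPolynomial

namespace GradedLieSuperalgebra

open MvPolynomial (vecDeriv multiDeriv polar raise shiftVec polys)

variable {K A : Type*} [Field K] [AddCommGroup A] [Module K A]

namespace Coordinates

variable {L : GradedLieSuperalgebra K A} {b : ℕ} (c : L.Coordinates b)

theorem eq_of_coords {a a' : A} (h : c.xi a = c.xi a') (h' : ∀ i, c.y i a = c.y i a') : a = a' :=
  sub_eq_zero.1 (c.ext _ (by rw [map_sub, h, sub_self]) fun i => by rw [map_sub, h' i, sub_self])

theorem par_eX : L.par 0 c.eX = c.eX :=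
  c.eq_of_coords (c.xi_par_zero _) fun i => by rw [c.y_par_zero, c.y_eX]

theorem par_ex (i : ℕ) : L.par 1 (c.ex i) = c.ex i :=
  c.eq_of_coords (by rw [c.xi_par_one, c.xi_ex]) fun j => c.y_par_one _ _

theorem ex_of_lt {i : ℕ} (hi : i < b) : c.ex i = 0 :=
  c.ext _ (c.xi_ex i) fun j => by rw [c.y_ex, if_neg fun h => absurd h.2 (not_le.2 hi)]

theorem comp_eX : L.comp (-1) c.eX = c.eX :=
  c.eq_of_coords (by rw [c.xi_comp, if_pos rfl]) fun i => by rw [c.y_comp, c.y_eX, ite_self]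

theorem comp_ex (i : ℕ) : L.comp i (c.ex i) = c.ex i :=
  c.eq_of_coords (by rw [c.xi_comp, c.xi_ex, ite_self]) fun j => by
    rw [c.y_comp, c.y_ex]
    by_cases h : i = j
    · subst h; simp
    · simp [h]

/-- The basis elements `X` and `x^i`. -/
def basisElem : Option ℕ → A := fun t => t.elim c.eX c.ex

/-- The coordinate forms `C(X)` and `C(x^i)`. -/
def coord : Option ℕ → A →ₗ[K] K := fun t => t.elim c.xi c.y

theorem exists_par_basisElem (t : Option ℕ) : ∃ p, L.par p (c.basisElem t) = c.basisElem t := by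
  cases t with
  | none => exact ⟨0, c.par_eX⟩
  | some i => exact ⟨1, c.par_ex i⟩

/-- The truncation of an element to the basis elements of grade at most `M`. -/
def trunc (M : ℕ) (a : A) : A :=
  ∑ t ∈ Finset.insertNone (Finset.range (M + 1)), c.coord t a • c.basisElem t

theorem comp_sub_trunc {M : ℕ} (a : A) {n : ℤ} (hn : n ≤ M) : L.comp n (a - c.trunc M a) = 0 := by
  have ht : c.trunc M a = c.xi a • c.eX + ∑ i ∈ Finset.range (M + 1), c.y i a • c.ex i :=
    Finset.sum_insertNone _ _
  refine c.ext _ ?_ fun i => ?_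
  · rw [c.xi_comp, map_sub, ht, map_add, map_sum]
    simp [c.xi_eX, c.xi_ex]
  · rw [c.y_comp, map_sub, ht, map_add, map_sum]
    split_ifs with h
    · simp only [map_smul, c.y_eX, c.y_ex, smul_eq_mul, mul_zero, zero_add]
      rw [Finset.sum_eq_single_of_mem i (Finset.mem_range.2 (by omega)) fun j _ hj => by
        rw [if_neg fun h => hj h.1, mul_zero]]
      by_cases hi : b ≤ i
      · simp [hi]
      · rw [c.y_of_lt i (not_le.1 hi)]; simp
    · rfl

/-- By continuity each argument may be truncated, one after the other, to a finite combination of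
basis elements; multilinearity does the rest. -/
theorem eq_zero_of_basisElem {k : ℕ} {g : ℤ} {C : (Fin k → A) → K} (hC : C ∈ L.cochains k g)
    (h : ∀ t : Fin k → Option ℕ, C (c.basisElem ∘ t) = 0) : C = 0 := by
  classical
  obtain ⟨⟨f, rfl⟩, -, -, N, hN⟩ := hC
  funext a
  have htr : ∀ s : Finset (Fin k), f (s.piecewise (c.trunc N.toNat ∘ a) a) = f a := fun s => by
    induction s using Finset.induction_on with
    | empty => rw [Finset.piecewise_empty]
    | insert i s hi ih =>
      rw [Finset.piecewise_insert, ← ih]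
      set u := s.piecewise (c.trunc N.toNat ∘ a) a
      have h1 : u i = a i := Finset.piecewise_eq_of_notMem _ _ _ hi
      have h2 : f (Function.update u i (a i - c.trunc N.toNat (a i))) = 0 :=
        hN _ i fun n hn => by
          rw [Function.update_self]
          exact c.comp_sub_trunc _ (by omega)
      rw [f.map_update_sub, ← h1, Function.update_eq_self, sub_eq_zero] at h2
      rw [h2, h1]
      rfl
  rw [← htr Finset.univ, Finset.piecewise_univ]
  have : (c.trunc N.toNat ∘ a) = fun i =>
      ∑ t ∈ Finset.insertNone (Finset.range (N.toNat + 1)), c.coord t (a i) • c.basisElem t := rfl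
  rw [this, f.map_sum_finset]
  refine Finset.sum_eq_zero fun t _ => ?_
  rw [f.map_smul_univ]
  exact smul_eq_zero_of_right _ (h t)

/-- Only vanishing is transported, so no signs of permutations need to be tracked. -/
theorem cochain_comp_perm_eq_zero {k : ℕ} {g : ℤ} {C : (Fin k → A) → K} (hC : C ∈ L.cochains k g)
    (σ : Equiv.Perm (Fin k)) : ∀ t : Fin k → Option ℕ, C (c.basisElem ∘ t) = 0 →
      C (c.basisElem ∘ t ∘ σ) = 0 := by
  induction σ using Equiv.Perm.adjacent_induction with
  | h1 => exact fun t h => h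
  | hmul σ τ hσ hτ => exact fun t h => hτ (t ∘ σ) (hσ t h)
  | hs i j hij =>
    intro t h
    obtain ⟨p, hp⟩ := c.exists_par_basisElem (t i)
    obtain ⟨q, hq⟩ := c.exists_par_basisElem (t j)
    have := hC.2.1 i j hij p q (c.basisElem ∘ t) hp hq
    rw [h, mul_zero, neg_zero] at this
    exact this

/-- Once the second `X` is moved next to the first, exchanging them changes the sign of the value,
as `X` is even, but not the arguments. -/
theorem cochain_eq_zero_of_two [CharZero K] {k : ℕ} {g : ℤ} {C : (Fin (k + 1) → A) → K}
    (hC : C ∈ L.cochains (k + 1) g) {t : Fin (k + 1) → Option ℕ} (h0 : t 0 = none) {i : Fin (k + 1)}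
    (hi : i ≠ 0) (h : t i = none) : C (c.basisElem ∘ t) = 0 := by
  obtain ⟨n, rfl⟩ : ∃ n, k = n + 1 := by
    cases k with
    | zero => exact absurd (Fin.ext (by omega)) hi
    | succ n => exact ⟨n, rfl⟩
  set σ := Equiv.swap (1 : Fin (n + 2)) i
  have e : t = (t ∘ σ) ∘ σ := by
    funext s
    simp [σ]
  rw [e]
  refine c.cochain_comp_perm_eq_zero hC σ (t ∘ σ) ?_
  have h0' : (t ∘ σ) 0 = none := by
    rw [Function.comp_apply, Equiv.swap_apply_of_ne_of_ne (by simp) hi.symm, h0]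
  have h1' : (t ∘ σ) 1 = none := by
    rw [Function.comp_apply, Equiv.swap_apply_left, h]
  have hpar : ∀ s, (t ∘ σ) s = none →
      L.par 0 ((c.basisElem ∘ t ∘ σ) s) = (c.basisElem ∘ t ∘ σ) s := fun s hs => by
    rw [Function.comp_apply, hs]; exact c.par_eX
  have hsw : (c.basisElem ∘ t ∘ σ) ∘ Equiv.swap 0 1 = c.basisElem ∘ t ∘ σ := by
    funext s
    rw [Function.comp_apply]
    by_cases hs0 : s = 0
    · subst hs0
      rw [Equiv.swap_apply_left]
      change c.basisElem ((t ∘ σ) 1) = c.basisElem ((t ∘ σ) 0)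
      rw [h0', h1']
    by_cases hs1 : s = 1
    · subst hs1
      rw [Equiv.swap_apply_right]
      change c.basisElem ((t ∘ σ) 0) = c.basisElem ((t ∘ σ) 1)
      rw [h0', h1']
    rw [Equiv.swap_apply_of_ne_of_ne hs0 hs1]
  have := hC.2.1 0 1 (by simp) 0 0 (c.basisElem ∘ t ∘ σ) (hpar 0 h0') (hpar 1 h1')
  rw [hsw] at this
  have hz : (-1 : K) ^ ((0 : ZMod 2) * 0).val = 1 := pow_zero _
  rw [hz, one_mul] at this
  exact self_eq_neg.1 this

/-- Tuples with two arguments `X` or with an `x^i = 0`, `i < b`, contribute nothing, and a single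
`X` can be moved to the front. -/
theorem cochain_ext [CharZero K] {k : ℕ} {g : ℤ} {C : (Fin k → A) → K} (hC : C ∈ L.cochains k g)
    (hx : ∀ h : Fin k → ℕ, (∀ i, b ≤ h i) → C (c.ex ∘ h) = 0)
    (hX : ∀ m (e : k = m + 1) (h : Fin m → ℕ), (∀ i, b ≤ h i) →
      C ((Fin.cons c.eX (c.ex ∘ h) : Fin (m + 1) → A) ∘ Fin.cast e) = 0) : C = 0 := by
  refine c.eq_zero_of_basisElem hC fun t => ?_
  have hzero : ∀ i l, t i = some l → l < b → C (c.basisElem ∘ t) = 0 := fun i l hi hl => by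
    obtain ⟨⟨f, rfl⟩, -⟩ := hC
    exact f.map_coord_zero i (by rw [Function.comp_apply, hi]; exact c.ex_of_lt hl)
  by_cases ht : ∃ j, t j = none
  · obtain ⟨j, hj⟩ := ht
    obtain ⟨m, rfl⟩ : ∃ m, k = m + 1 := by
      cases k with
      | zero => exact j.elim0
      | succ m => exact ⟨m, rfl⟩
    set σ := Equiv.swap 0 j
    have e : t = (t ∘ σ) ∘ σ := by funext s; simp [σ]
    rw [e]
    refine c.cochain_comp_perm_eq_zero hC σ (t ∘ σ) ?_
    have h0 : (t ∘ σ) 0 = none := by rw [Function.comp_apply, Equiv.swap_apply_left, hj]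
    by_cases h1 : ∃ i, i ≠ 0 ∧ (t ∘ σ) i = none
    · obtain ⟨i, hi, hi'⟩ := h1
      exact c.cochain_eq_zero_of_two hC h0 hi hi'
    · push Not at h1
      have h2 : ∀ i : Fin m, ∃ l, (t ∘ σ) i.succ = some l := fun i =>
        Option.ne_none_iff_exists'.1 (h1 _ (Fin.succ_ne_zero i))
      choose h hh using h2
      by_cases hb : ∀ i, b ≤ h i
      · have := hX m rfl h hb
        convert this using 2
        funext s
        refine Fin.cases ?_ (fun s => ?_) s
        · rw [Function.comp_apply, h0]; rfl
        · rw [Function.comp_apply, hh]; rfl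
      · push Not at hb
        obtain ⟨i, hi⟩ := hb
        obtain ⟨⟨f, rfl⟩, -⟩ := hC
        exact f.map_coord_zero i.succ (by rw [Function.comp_apply, hh]; exact c.ex_of_lt hi)
  · push Not at ht
    choose h hh using fun i => Option.ne_none_iff_exists'.1 (ht i)
    by_cases hb : ∀ i, b ≤ h i
    · convert hx h hb using 2
      funext s
      rw [Function.comp_apply, hh]; rfl
    · push Not at hb
      obtain ⟨i, hi⟩ := hb
      exact hzero i _ (hh i) hi

theorem oddForm_ex (m : ℕ) (p : MvPolynomial ℕ K) {h : Fin m → ℕ} (hb : ∀ i, b ≤ h i) :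
    c.oddForm m p (c.ex ∘ h) = polar Finset.univ (fun i => Pi.single (h i) (1 : K)) p := by
  rw [oddForm_apply]
  congr 2
  funext i
  exact c.vec_ex (hb i)

theorem oddForm_cons (m : ℕ) (p : MvPolynomial ℕ K) (a : Fin m → A) :
    c.oddForm (m + 1) p (Fin.cons c.eX a) = 0 :=
  MvPolynomial.polar_eq_zero' (Finset.mem_univ 0) c.vec_eX

theorem xiForm_ex (m : ℕ) (p : MvPolynomial ℕ K) (h : Fin (m + 1) → ℕ) :
    c.xiForm m p (c.ex ∘ h) = 0 := by
  rw [xiForm_apply]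
  exact Finset.sum_eq_zero fun r _ => by rw [Function.comp_apply, c.xi_ex]; ring

theorem xiForm_cons (m : ℕ) (p : MvPolynomial ℕ K) (a : Fin m → A)
    (ha : ∀ i, c.xi (a i) = 0) :
    c.xiForm m p (Fin.cons c.eX a) = c.oddForm m p a := by
  rw [xiForm_apply, Finset.sum_eq_single_of_mem 0 (Finset.mem_univ 0), ← c.oddForm_comp_succAbove]
  · simp only [Fin.val_zero, pow_zero, Fin.cons_zero, c.xi_eX, one_mul]
    rfl
  · intro r _ hr
    obtain ⟨i, rfl⟩ := Fin.exists_succ_eq.2 hr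
    rw [Fin.cons_succ, ha]; ring

theorem xiForm_injOn [CharZero K] {m : ℕ} {n : ℤ} {p : MvPolynomial ℕ K} (hp : p ∈ polys K b m n)
    (h : c.xiForm m p = 0) : p = 0 :=
  MvPolynomial.eq_zero_of_polar_eq_zero hp fun s hs => by
    rw [← c.oddForm_ex m p hs, ← c.xiForm_cons m p (c.ex ∘ s) fun i => c.xi_ex _, h]
    rfl

/-- On odd basis elements a cochain is a symmetric function of the indices, zero unless they add up
to the grade. -/
theorem exists_oddForm_eq [CharZero K] {k : ℕ} {g : ℤ} {C : (Fin k → A) → K}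
    (hC : C ∈ L.cochains k g) :
    ∃ p ∈ polys K b k g, ∀ h : Fin k → ℕ, (∀ i, b ≤ h i) →
      (C - c.oddForm k p) (c.ex ∘ h) = 0 := by
  have hperm : ∀ (σ : Equiv.Perm (Fin k)) (h : Fin k → ℕ),
      C (c.ex ∘ h ∘ σ) = C (c.ex ∘ h) := fun σ => by
    induction σ using Equiv.Perm.adjacent_induction with
    | h1 => exact fun h => rfl
    | hmul σ τ hσ hτ => exact fun h => (hτ (h ∘ σ)).trans (hσ h)
    | hs i j hij =>
      intro h
      have := hC.2.1 i j hij 1 1 (c.ex ∘ h) (c.par_ex _) (c.par_ex _)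
      have hz : (-1 : K) ^ ((1 : ZMod 2) * 1).val = -1 := pow_one _
      rw [hz, neg_one_mul, neg_neg] at this
      exact this
  obtain ⟨p, hp, hpD⟩ := MvPolynomial.exists_polar_eq (b := b) (fun h => C (c.ex ∘ h))
    (fun h σ => hperm σ h) (g := g)
    (fun h hh => hC.2.2.1 _ (fun i => (h i : ℤ)) (fun i => c.comp_ex _) hh)
  refine ⟨p, hp, fun h hb => ?_⟩
  rw [Pi.sub_apply, c.oddForm_ex k p hb, hpD h hb, sub_self]

theorem exists_xiForm_eq [CharZero K] {m : ℕ} {g : ℤ} {C : (Fin (m + 1) → A) → K}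
    (hC : C ∈ L.cochains (m + 1) g) :
    ∃ p ∈ polys K b m (g + 1), ∀ h : Fin m → ℕ, (∀ i, b ≤ h i) →
      (C - c.xiForm m p) (Fin.cons c.eX (c.ex ∘ h)) = 0 := by
  have hperm : ∀ (σ : Equiv.Perm (Fin m)) (h : Fin m → ℕ),
      C (Fin.cons c.eX (c.ex ∘ h ∘ σ)) = C (Fin.cons c.eX (c.ex ∘ h)) := fun σ => by
    induction σ using Equiv.Perm.adjacent_induction with
    | h1 => exact fun h => rfl
    | hmul σ τ hσ hτ => exact fun h => (hτ (h ∘ σ)).trans (hσ h)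
    | hs i j hij =>
      intro h
      have := hC.2.1 i.succ j.succ (by simp [← hij]) 1 1 (Fin.cons c.eX (c.ex ∘ h))
        (c.par_ex _) (c.par_ex _)
      have hz : (-1 : K) ^ ((1 : ZMod 2) * 1).val = -1 := pow_one _
      rw [hz, neg_one_mul, neg_neg] at this
      rw [← this]
      congr 1
      funext s
      refine Fin.cases ?_ (fun s => ?_) s
      · rw [Function.comp_apply, Equiv.swap_apply_of_ne_of_ne (Fin.succ_ne_zero i).symm
          (Fin.succ_ne_zero j).symm]
        rfl
      · rw [Function.comp_apply, Fin.cons_succ, (Fin.succ_injective m).swap_apply, Fin.cons_succ]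
        rfl
  obtain ⟨p, hp, hpD⟩ := MvPolynomial.exists_polar_eq (b := b)
    (fun h => C (Fin.cons c.eX (c.ex ∘ h))) (fun h σ => hperm σ h) (g := g + 1)
    (fun h hh => hC.2.2.1 _ (Fin.cons (-1) fun i => (h i : ℤ)) (fun i => by
      refine Fin.cases ?_ (fun i => ?_) i
      · exact c.comp_eX
      · exact c.comp_ex _) (by
      rw [Fin.sum_univ_succ]
      simp only [Fin.cons_zero, Fin.cons_succ]
      omega))
  refine ⟨p, hp, fun h hb => ?_⟩
  rw [Pi.sub_apply, c.xiForm_cons m p (c.ex ∘ h) fun i => c.xi_ex _, c.oddForm_ex m p hb, hpD h hb, sub_self]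

/-- The values on odd arguments determine `p`, those with `X` in front determine `q`. The two do not
interfere: each kind of form vanishes on the arguments that determine the other. -/
theorem exists_forms [CharZero K] {m : ℕ} {g : ℤ} {C : (Fin (m + 1) → A) → K}
    (hC : C ∈ L.cochains (m + 1) g) :
    ∃ p ∈ polys K b (m + 1) g, ∃ q ∈ polys K b m (g + 1),
      C = c.oddForm (m + 1) p + c.xiForm m q := by
  obtain ⟨p, hp, hp'⟩ := c.exists_oddForm_eq hC
  obtain ⟨q, hq, hq'⟩ := c.exists_xiForm_eq hC
  refine ⟨p, hp, q, hq, ?_⟩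
  rw [← sub_eq_zero]
  refine c.cochain_ext (Submodule.sub_mem _ hC
    (Submodule.add_mem _ (c.oddForm_mem hp) (c.xiForm_mem hq))) (fun h hb => ?_) ?_
  · have := hp' h hb
    rw [← sub_sub, Pi.sub_apply, this, c.xiForm_ex, sub_self]
  · intro m' e h hb
    obtain rfl : m = m' := by omega
    have := hq' h hb
    change (C - (c.oddForm (m + 1) p + c.xiForm m q)) (Fin.cons c.eX (c.ex ∘ h)) = 0
    rw [add_comm (c.oddForm (m + 1) p), ← sub_sub, Pi.sub_apply, this, c.oddForm_cons, sub_self]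

theorem exists_oddForm_zero [CharZero K] {g : ℤ} {C : (Fin 0 → A) → K} (hC : C ∈ L.cochains 0 g) :
    ∃ p ∈ polys K b 0 g, C = c.oddForm 0 p := by
  obtain ⟨p, hp, hp'⟩ := c.exists_oddForm_eq hC
  refine ⟨p, hp, ?_⟩
  rw [← sub_eq_zero]
  exact c.cochain_ext (Submodule.sub_mem _ hC (c.oddForm_mem hp)) hp' fun m e => by omega

/-- The differential of `p + ξ q` is `ξ D p`, and `D` is injective because `p` has positive degree
`m + 1`. -/
theorem cocycles_eq [CharZero K] (m : ℕ) (g : ℤ) :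
    L.cocycles (m + 1) g = (polys K b m (g + 1)).map (c.xiForm m) := by
  ext C
  constructor
  · rintro ⟨hC, hd⟩
    obtain ⟨p, hp, q, hq, rfl⟩ := c.exists_forms hC
    have hd' : L.d (m + 1) (c.oddForm (m + 1) p + c.xiForm m q) = 0 := hd
    rw [map_add, c.d_xiForm, add_zero, c.d_oddForm] at hd'
    have hr := c.xiForm_injOn (MvPolynomial.raise_mem_polys hp) hd'
    have hp0 : p = 0 := by
      ext μ
      by_contra hμ
      have := MvPolynomial.eq_zero_of_isNormal_raise (b := b) (fun μ hμ => (hp μ hμ).1)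
        (fun l hl => by simp [hr] at hl) μ hμ
      have h2 := (hp μ hμ).2.1
      rw [this, map_zero] at h2
      exact absurd h2 (Nat.succ_ne_zero m).symm
    refine ⟨q, hq, ?_⟩
    rw [hp0, map_zero, zero_add]
  · rintro ⟨q, hq, rfl⟩
    exact ⟨c.xiForm_mem hq, c.d_xiForm m q⟩

theorem coboundaries_eq [CharZero K] (m : ℕ) (g : ℤ) :
    L.coboundaries (m + 1) g = (MvPolynomial.raised K b m (g + 1)).map (c.xiForm m) := by
  have h1 : g + 1 - 1 = g := by ring
  ext C
  constructor
  · rintro ⟨C, hC, rfl⟩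
    -- Cochains of degree `0` are treated separately because they have no part with `C(X)`.
    cases m with
    | zero =>
      obtain ⟨p, hp, rfl⟩ := c.exists_oddForm_zero hC
      exact ⟨raise K b p, ⟨p, h1.symm ▸ hp, rfl⟩, (c.d_oddForm 0 p).symm⟩
    | succ m =>
      obtain ⟨p, hp, q, hq, rfl⟩ := c.exists_forms hC
      refine ⟨raise K b p, ⟨p, h1.symm ▸ hp, rfl⟩, ?_⟩
      rw [map_add, c.d_xiForm, add_zero, c.d_oddForm]
  · rintro ⟨_, ⟨p, hp, rfl⟩, rfl⟩
    rw [h1] at hp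
    exact ⟨c.oddForm m p, c.oddForm_mem hp, c.d_oddForm m p⟩

theorem xiForm_mem_coboundaries_iff [CharZero K] {m : ℕ} {g : ℤ} {q : MvPolynomial ℕ K}
    (hq : q ∈ polys K b m (g + 1)) :
    c.xiForm m q ∈ L.coboundaries (m + 1) g ↔ q ∈ MvPolynomial.raised K b m (g + 1) := by
  rw [c.coboundaries_eq]
  refine ⟨?_, fun h => ⟨q, h, rfl⟩⟩
  rintro ⟨q', hq', h⟩
  have : q' - q = 0 := c.xiForm_injOn
    (Submodule.sub_mem _ (MvPolynomial.raised_le b m _ hq') hq) (by rw [map_sub, h, sub_self])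
  rwa [← sub_eq_zero.1 this]

/-- Multiplication by `C(X)` identifies the cokernel of `raise` with the cohomology. -/
theorem isCohomologyBasis [CharZero K] {m : ℕ} {g : ℤ} {ι : Type*} {w : ι → MvPolynomial ℕ K}
    (hw : MvPolynomial.IsRaiseBasis b m (g + 1) w) :
    L.IsCohomologyBasis (m + 1) g fun i => c.xiForm m (w i) := by
  obtain ⟨h1, h2, h3⟩ := hw
  have hZ : ∀ i, c.xiForm m (w i) ∈ L.cocycles (m + 1) g := fun i => by
    rw [c.cocycles_eq]; exact ⟨w i, h1 i, rfl⟩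
  set Q := ((L.coboundaries (m + 1) g).submoduleOf (L.cocycles (m + 1) g)).mkQ
  have hli : LinearIndependent K fun i => Q ⟨c.xiForm m (w i), hZ i⟩ := by
    rw [linearIndependent_iff]
    intro l hl
    apply h3
    have hmem : Finsupp.linearCombination K w l ∈ polys K b m (g + 1) := by
      rw [Finsupp.linearCombination_apply]
      exact Submodule.sum_mem _ fun i _ => Submodule.smul_mem _ _ (h1 i)
    rw [← c.xiForm_mem_coboundaries_iff hmem]
    have hs : Finsupp.linearCombination K (fun i => Q ⟨c.xiForm m (w i), hZ i⟩) l =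
        Q (Finsupp.linearCombination K
          (fun i => (⟨c.xiForm m (w i), hZ i⟩ : L.cocycles (m + 1) g)) l) := by
      simp only [Finsupp.linearCombination_apply, Finsupp.sum, map_sum, map_smul]
    rw [hs, Submodule.mkQ_apply, Submodule.Quotient.mk_eq_zero, Submodule.submoduleOf,
      Submodule.mem_comap] at hl
    convert hl using 1
    simp only [Finsupp.linearCombination_apply, Finsupp.sum, map_sum, map_smul]
    rfl
  have hsp : ⊤ ≤ Submodule.span K (Set.range fun i => Q ⟨c.xiForm m (w i), hZ i⟩) := by
    rintro x -
    obtain ⟨⟨C, hC⟩, rfl⟩ := Submodule.mkQ_surjective _ x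
    have hC' := hC
    rw [c.cocycles_eq] at hC'
    obtain ⟨q, hq, rfl⟩ := hC'
    obtain ⟨u, hu, v, hv, rfl⟩ := Submodule.mem_sup.1 (h2 hq)
    obtain ⟨l, rfl⟩ := (Finsupp.mem_span_range_iff_exists_finsupp).1 hu
    have : Q ⟨_, hC⟩ = Q (l.sum fun i r =>
        r • (⟨c.xiForm m (w i), hZ i⟩ : L.cocycles (m + 1) g)) := by
      rw [← sub_eq_zero, ← map_sub, Submodule.mkQ_apply, Submodule.Quotient.mk_eq_zero,
        Submodule.submoduleOf,
      Submodule.mem_comap]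
      have hv' := (c.xiForm_mem_coboundaries_iff (MvPolynomial.raised_le b m _ hv)).2 hv
      convert hv' using 1
      simp only [Finsupp.sum, map_sum, map_add, map_sub, map_smul, Submodule.subtype_apply]
      abel
    change Q ⟨_, hC⟩ ∈ _
    rw [this, Finsupp.sum, map_sum]
    refine Submodule.sum_mem _ fun i _ => ?_
    rw [map_smul]
    exact Submodule.smul_mem _ _ (Submodule.subset_span ⟨i, rfl⟩)
  exact ⟨hZ, Module.Basis.mk hli hsp, fun i => Module.Basis.mk_apply hli hsp i⟩

end Coordinates
end GradedLieSuperalgebra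

/-! ### Coordinates on SB(1) and SLe(1) -/

namespace Buttin

variable (K : Type*) [Field K]

/-- In characteristic zero a power series with vanishing derivative is constant. -/
theorem snd_eq_C [CharZero K] (a : SBSpace K) : a.1.2 = PowerSeries.C (dualX K a) := by
  ext i
  have h := a.2
  rw [mem_SBSpace] at h
  cases i with
  | zero => rw [coeff_zero_C]; rfl
  | succ i =>
    have := congrArg (coeff i) h
    rw [coeff_derivative, map_zero] at this
    rw [coeff_C, if_neg (Nat.succ_ne_zero i)]
    exact (mul_eq_zero.1 this).resolve_right (Nat.cast_add_one_ne_zero i)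

theorem dualx_elx (i j : ℕ) : dualx K j (elx K i) = if i = j then 1 else 0 := by
  change coeff j ((X : K⟦X⟧) ^ i) = _
  rw [coeff_X_pow]
  simp [eq_comm]

theorem dualX_elx (i : ℕ) : dualX K (elx K i) = 0 := by
  change coeff 0 (0 : K⟦X⟧) = 0
  simp

theorem dualx_bracket [CharZero K] (i : ℕ) (a c : SBSpace K) : dualx K i ((SB K).bracket a c) =
    ((i : K) + 1) * (dualx K (i + 1) a * dualX K c - dualX K a * dualx K (i + 1) c) := by
  change coeff i (derivative K a.1.1 * c.1.2 - a.1.2 * derivative K c.1.1) = _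
  rw [snd_eq_C, snd_eq_C, map_sub, coeff_mul_C, coeff_C_mul, coeff_derivative, coeff_derivative]
  change dualx K (i + 1) a * _ * _ - _ * (dualx K (i + 1) c * _) = _
  ring

theorem dualX_bracket [CharZero K] (a c : SBSpace K) : dualX K ((SB K).bracket a c) = 0 := by
  change coeff 0 (derivative K a.1.2 * c.1.2 - a.1.2 * derivative K c.1.2) = _
  have ha := (mem_SBSpace K).1 a.2
  have hc := (mem_SBSpace K).1 c.2
  rw [ha, hc]
  simp

/-- The standard coordinates on `SB(1)`. -/
def coordsSB [CharZero K] : (SB K).Coordinates 0 where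
  xi := dualX K
  y := dualx K
  eX := elX K
  ex := elx K
  y_of_lt i hi := absurd hi (Nat.not_lt_zero i)
  xi_par_zero a := by
    change coeff 0 (par 0 a.1).2 = _
    rw [par_zero_apply]; rfl
  xi_par_one a := by
    change coeff 0 (par 1 a.1).2 = _
    rw [par_one_apply, map_zero]
  y_par_zero i a := by
    change coeff i (par 0 a.1).1 = _
    rw [par_zero_apply, map_zero]
  y_par_one i a := by
    change coeff i (par 1 a.1).1 = _
    rw [par_one_apply]; rfl
  xi_comp n a := by
    change coeff 0 (term (n + 1) a.1.2) = if n = -1 then coeff 0 a.1.2 else 0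
    rw [coeff_term]
    exact if_congr (by push_cast; omega) rfl rfl
  y_comp n i a := by
    change coeff i (term n a.1.1) = if n = i then coeff i a.1.1 else 0
    rw [coeff_term]
    exact if_congr eq_comm rfl rfl
  xi_bracket := dualX_bracket K
  y_bracket i a c := by rw [dualx_bracket, if_pos (Nat.zero_le i)]
  ext a h h' := by
    refine Subtype.ext (Prod.ext ?_ ?_)
    · ext i
      exact h' i
    · rw [snd_eq_C, h, map_zero]; rfl
  xi_eX := by
    change coeff 0 (1 : K⟦X⟧) = 1
    simp
  y_eX i := by
    change coeff i (0 : K⟦X⟧) = 0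
    simp
  xi_ex := dualX_elx K
  y_ex i j := by rw [dualx_elx]; simp

theorem lift_mk (a : SBSpace K) : lift K ((center K).mkQ a) = a - dualx K 0 a • elx K 0 := rfl

theorem dualX_lift_mk (a : SBSpace K) : dualX K (lift K ((center K).mkQ a)) = dualX K a := by
  rw [lift_mk, map_sub, map_smul, dualX_elx, smul_zero, sub_zero]

theorem dualx_lift_mk (i : ℕ) (a : SBSpace K) :
    dualx K i (lift K ((center K).mkQ a)) = if 1 ≤ i then dualx K i a else 0 := by
  rw [lift_mk, map_sub, map_smul, dualx_elx]
  rcases Nat.eq_zero_or_pos i with rfl | h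
  · simp
  · rw [if_neg (by omega), if_pos (by omega), smul_zero, sub_zero]

/-- The standard coordinates on `SLe(1)`. -/
def coordsSLe [CharZero K] : (SLe K).Coordinates 1 where
  xi := dualX K ∘ₗ lift K
  y i := dualx K i ∘ₗ lift K
  eX := (center K).mkQ (elX K)
  ex i := (center K).mkQ (elx K i)
  y_of_lt i hi := LinearMap.ext fun a => by
    obtain ⟨a, rfl⟩ := (center K).mkQ_surjective a
    rw [LinearMap.comp_apply, dualx_lift_mk, if_neg (by omega)]; rfl
  xi_par_zero a := by
    obtain ⟨a, rfl⟩ := (center K).mkQ_surjective a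
    exact (dualX_lift_mk K _).trans (((coordsSB K).xi_par_zero a).trans (dualX_lift_mk K _).symm)
  xi_par_one a := by
    obtain ⟨a, rfl⟩ := (center K).mkQ_surjective a
    exact (dualX_lift_mk K _).trans ((coordsSB K).xi_par_one a)
  y_par_zero i a := by
    obtain ⟨a, rfl⟩ := (center K).mkQ_surjective a
    refine (dualx_lift_mk K i _).trans ?_
    split_ifs
    · exact (coordsSB K).y_par_zero i a
    · rfl
  y_par_one i a := by
    obtain ⟨a, rfl⟩ := (center K).mkQ_surjective a
    refine (dualx_lift_mk K i _).trans (Eq.trans ?_ (dualx_lift_mk K i _).symm)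
    split_ifs
    · exact (coordsSB K).y_par_one i a
    · rfl
  xi_comp n a := by
    obtain ⟨a, rfl⟩ := (center K).mkQ_surjective a
    refine (dualX_lift_mk K _).trans (((coordsSB K).xi_comp n a).trans ?_)
    rw [LinearMap.comp_apply, dualX_lift_mk]; rfl
  y_comp n i a := by
    obtain ⟨a, rfl⟩ := (center K).mkQ_surjective a
    refine (dualx_lift_mk K i _).trans ?_
    rw [LinearMap.comp_apply, dualx_lift_mk]
    split_ifs with h h'
    · exact ((coordsSB K).y_comp n i a).trans (if_pos h')
    · exact ((coordsSB K).y_comp n i a).trans (if_neg ‹_›)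
    all_goals rfl
  xi_bracket a c := by
    obtain ⟨a, rfl⟩ := (center K).mkQ_surjective a
    obtain ⟨c, rfl⟩ := (center K).mkQ_surjective c
    exact (dualX_lift_mk K _).trans (dualX_bracket K a c)
  y_bracket i a c := by
    obtain ⟨a, rfl⟩ := (center K).mkQ_surjective a
    obtain ⟨c, rfl⟩ := (center K).mkQ_surjective c
    refine (dualx_lift_mk K i _).trans ?_
    simp only [LinearMap.comp_apply, dualx_lift_mk, dualX_lift_mk]
    split_ifs
    · exact dualx_bracket K i a c
    · omega
    · rfl
  ext a h h' := by
    obtain ⟨a, rfl⟩ := (center K).mkQ_surjective a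
    refine (Submodule.Quotient.mk_eq_zero _).2 (mem_center.2 ⟨fun i hi => ?_, ?_⟩)
    · have := h' i
      rw [LinearMap.comp_apply, dualx_lift_mk, if_pos (by omega)] at this
      exact this
    · rw [LinearMap.comp_apply, dualX_lift_mk] at h
      rw [snd_eq_C, h, map_zero]
  xi_eX := by
    rw [LinearMap.comp_apply, dualX_lift_mk]
    exact (coordsSB K).xi_eX
  y_eX i := by
    rw [LinearMap.comp_apply, dualx_lift_mk]
    split_ifs
    · exact (coordsSB K).y_eX i
    · rfl
  xi_ex i := by
    rw [LinearMap.comp_apply, dualX_lift_mk]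
    exact dualX_elx K i
  y_ex i j := by
    rw [LinearMap.comp_apply, dualx_lift_mk, dualx_elx]
    by_cases h : i = j
    · subst h; simp
    · simp [h]

variable {K}

/-- The coordinates on SLe(1) are those of the lift to SB(1), so deletion keeps the polynomial while
`y_0` becomes the zero form. -/
theorem deleteOne_xiForm [CharZero K] (m : ℕ) (p : MvPolynomial ℕ K) :
    deleteOne ((coordsSB K).xiForm m p) = (coordsSLe K).xiForm m p := rfl

end Buttin

/-! ### Enumeration of the normal monomials -/

namespace NormalLists

/-- The nonincreasing lists of length `m` with sum `n` and entries between `b` and `M`. -/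
def descLists (b : ℕ) : ℕ → ℕ → ℕ → List (List ℕ)
  | 0, _, n => if n = 0 then [[]] else []
  | m + 1, M, n => (List.range (M + 1)).flatMap fun i =>
      if b ≤ i ∧ i ≤ n then (descLists b m i (n - i)).map (i :: ·) else []

/-- The nonincreasing lists of length `m` with sum `n` and entries at least `b`, which are empty or
have two equal first entries. -/
def genLists (b : ℕ) : ℕ → ℕ → List (List ℕ)
  | 0, n => if n = 0 then [[]] else []
  | 1, _ => []
  | m + 2, n => (List.range (n + 1)).flatMap fun p =>
      if b ≤ p ∧ 2 * p ≤ n then (descLists b m p (n - 2 * p)).map (fun l => p :: p :: l) else []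

/-- The property that characterizes the members of `genLists b m n`. -/
def IsGen (b m n : ℕ) (l : List ℕ) : Prop :=
  l.length = m ∧ l.sum = n ∧ (∀ i ∈ l, b ≤ i) ∧ l.Pairwise (· ≥ ·) ∧
    (l = [] ∨ ∃ p l', l = p :: p :: l')

theorem mem_descLists (b m M n : ℕ) (l : List ℕ) : l ∈ descLists b m M n ↔
    l.length = m ∧ l.sum = n ∧ (∀ i ∈ l, b ≤ i) ∧ (M :: l).Pairwise (· ≥ ·) := by
  induction m generalizing M n l with
  | zero =>
    rw [descLists]
    constructor
    · intro h
      split_ifs at h with hn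
      · rw [List.mem_singleton] at h
        subst h; subst hn
        simp
      · simp at h
    · rintro ⟨h1, h2, -⟩
      rw [List.length_eq_zero_iff] at h1
      subst h1
      simp only [List.sum_nil] at h2
      simp [← h2]
  | succ m ih =>
    rw [descLists, List.mem_flatMap]
    constructor
    · rintro ⟨i, hi, h⟩
      rw [List.mem_range] at hi
      split_ifs at h with hb
      · obtain ⟨l', hl', rfl⟩ := List.mem_map.1 h
        obtain ⟨h1, h2, h3, h4⟩ := (ih _ _ _).1 hl'
        refine ⟨by simp [h1], by simp [h2]; omega, ?_, ?_⟩
        · rintro j (_ | ⟨_, hj⟩)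
          · exact hb.1
          · exact h3 j hj
        · refine List.pairwise_cons.2 ⟨?_, h4⟩
          rintro j (_ | ⟨_, hj⟩)
          · omega
          · have := (List.pairwise_cons.1 h4).1 j hj
            omega
      · simp at h
    · rintro ⟨h1, h2, h3, h4⟩
      cases l with
      | nil => simp at h1
      | cons i l =>
        have hi := (List.pairwise_cons.1 h4).1 i (by simp)
        refine ⟨i, List.mem_range.2 (by omega), ?_⟩
        rw [List.sum_cons] at h2
        rw [if_pos ⟨h3 i (by simp), by omega⟩]
        refine List.mem_map.2 ⟨l, (ih _ _ _).2 ⟨by simpa using h1, by omega,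
          fun j hj => h3 j (by simp [hj]), (List.pairwise_cons.1 h4).2⟩, rfl⟩

theorem mem_genLists (b m n : ℕ) (l : List ℕ) : l ∈ genLists b m n ↔ IsGen b m n l := by
  match m with
  | 0 =>
    rw [genLists]
    constructor
    · intro h
      split_ifs at h with hn
      · rw [List.mem_singleton] at h
        subst h; subst hn
        simp [IsGen]
      · simp at h
    · rintro ⟨h1, h2, -⟩
      rw [List.length_eq_zero_iff] at h1
      subst h1
      simp only [List.sum_nil] at h2
      simp [← h2]
  | 1 =>
    rw [genLists]
    constructor
    · intro h; simp at h
    · rintro ⟨h1, -, -, -, rfl | ⟨p, l', rfl⟩⟩ <;> simp at h1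
  | m + 2 =>
    rw [genLists, List.mem_flatMap]
    constructor
    · rintro ⟨p, hp, h⟩
      split_ifs at h with hb
      · obtain ⟨l', hl', rfl⟩ := List.mem_map.1 h
        obtain ⟨h1, h2, h3, h4⟩ := (mem_descLists _ _ _ _ _).1 hl'
        refine ⟨by simp [h1], by simp [h2]; omega, ?_, ?_, Or.inr ⟨p, l', rfl⟩⟩
        · rintro j (_ | ⟨_, _ | ⟨_, hj⟩⟩)
          · exact hb.1
          · exact hb.1
          · exact h3 j hj
        · refine List.pairwise_cons.2 ⟨?_, h4⟩
          rintro j (_ | ⟨_, hj⟩)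
          · exact le_refl p
          · exact (List.pairwise_cons.1 h4).1 j hj
      · simp at h
    · rintro ⟨h1, h2, h3, h4, rfl | ⟨p, l', rfl⟩⟩
      · simp at h1
      · simp only [List.sum_cons] at h2
        refine ⟨p, List.mem_range.2 (by omega), ?_⟩
        rw [if_pos ⟨h3 p (by simp), by omega⟩]
        exact List.mem_map.2 ⟨l', (mem_descLists _ _ _ _ _).2 ⟨by simpa using h1, by omega,
          fun j hj => h3 j (by simp [hj]), (List.pairwise_cons.1 h4).2⟩, rfl⟩

theorem nodup_descLists (b m M n : ℕ) : (descLists b m M n).Nodup := by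
  induction m generalizing M n with
  | zero => rw [descLists]; split_ifs <;> simp
  | succ m ih =>
    rw [descLists, List.nodup_flatMap]
    constructor
    · intro i _
      split_ifs
      · exact (ih _ _).map fun l l' h => (List.cons.inj h).2
      · exact List.nodup_nil
    · refine List.nodup_range.imp fun {i j} hij => ?_
      intro l hl hl'
      dsimp only at hl hl'
      split_ifs at hl hl'
      · obtain ⟨_, _, rfl⟩ := List.mem_map.1 hl
        obtain ⟨_, _, h⟩ := List.mem_map.1 hl'
        exact hij (List.cons.inj h).1.symm
      all_goals simp_all

theorem nodup_genLists (b m n : ℕ) : (genLists b m n).Nodup := by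
  match m with
  | 0 => rw [genLists]; split_ifs <;> simp
  | 1 => rw [genLists]; exact List.nodup_nil
  | m + 2 =>
    rw [genLists, List.nodup_flatMap]
    constructor
    · intro i _
      split_ifs
      · exact (nodup_descLists _ _ _ _).map fun l l' h => (List.cons.inj (List.cons.inj h).2).2
      · exact List.nodup_nil
    · refine List.nodup_range.imp fun {i j} hij => ?_
      intro l hl hl'
      dsimp only at hl hl'
      split_ifs at hl hl'
      · obtain ⟨_, _, rfl⟩ := List.mem_map.1 hl
        obtain ⟨_, _, h⟩ := List.mem_map.1 hl'
        exact hij (List.cons.inj h).1.symm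
      all_goals simp_all

/-- For `b = 1` the members of `genLists 2 m n`; for `b = 0` these are followed by the members of
`genLists 1 m n` with an entry `1`. -/
def table (b m n : ℕ) : List (List ℕ) :=
  genLists 2 m n ++ if b = 0 then (genLists 1 m n).filter (1 ∈ ·) else []

theorem mem_table {b : ℕ} (hb : b ≤ 1) (m n : ℕ) (l : List ℕ) :
    l ∈ table b m n ↔ IsGen (b + 1) m n l := by
  rw [table, List.mem_append, mem_genLists]
  rcases Nat.le_one_iff_eq_zero_or_eq_one.1 hb with rfl | rfl
  · rw [if_pos rfl, List.mem_filter, mem_genLists, decide_eq_true_iff]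
    constructor
    · rintro (⟨h1, h2, h3, h4⟩ | ⟨h, -⟩)
      · exact ⟨h1, h2, fun i hi => le_trans (by norm_num) (h3 i hi), h4⟩
      · exact h
    · rintro ⟨h1, h2, h3, h4⟩
      by_cases h : 1 ∈ l
      · exact Or.inr ⟨⟨h1, h2, h3, h4⟩, h⟩
      · refine Or.inl ⟨h1, h2, fun i hi => ?_, h4⟩
        have := h3 i hi
        have : i ≠ 1 := fun h' => h (h' ▸ hi)
        omega
  · simp

theorem nodup_table (b m n : ℕ) : (table b m n).Nodup := by
  refine List.Nodup.append (nodup_genLists _ _ _) ?_ fun l hl hl' => ?_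
  · split_ifs
    · exact (nodup_genLists _ _ _).filter _
    · exact List.nodup_nil
  · split_ifs at hl'
    · rw [List.mem_filter, decide_eq_true_iff] at hl'
      have := ((mem_genLists _ _ _ _).1 hl).2.2.1 1 hl'.2
      omega
    · simp at hl'

/-- The starred entries come first in the table for SB(1), so an index of a generator of SLe(1)
denotes the cocycle it arises from. -/
theorem getD_table_one {m n j : ℕ} (hj : j < (table 1 m n).length) :
    (table 0 m n).getD j [] = (table 1 m n).getD j [] := by
  have h : table 1 m n = genLists 2 m n := by simp [table]
  rw [h] at hj ⊢
  rw [table, List.getD_append _ _ _ _ hj]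

open MvPolynomial (wt IsIndex IsNormal)

/-- The exponent of the monomial `∏ y_i`, for `i` in the list `l`. -/
def expo (l : List ℕ) : ℕ →₀ ℕ := Multiset.toFinsupp (l : Multiset ℕ)

theorem expo_apply (l : List ℕ) (i : ℕ) : expo l i = l.count i := by
  rw [expo, Multiset.toFinsupp_apply, Multiset.coe_count]

theorem expo_nil : expo [] = 0 := Multiset.toFinsupp_zero

theorem expo_cons (i : ℕ) (l : List ℕ) : expo (i :: l) = Finsupp.single i 1 + expo l := by
  rw [expo, ← Multiset.cons_coe, ← Multiset.singleton_add, map_add, Multiset.toFinsupp_singleton]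
  rfl

theorem degree_expo (l : List ℕ) : (expo l).degree = l.length := by
  induction l with
  | nil => rw [expo_nil, map_zero]; rfl
  | cons i l ih => rw [expo_cons, map_add, ih, Finsupp.degree_single, List.length_cons, add_comm]

theorem wt_expo (l : List ℕ) : wt (expo l) = l.sum := by
  induction l with
  | nil => rw [expo_nil, map_zero]; rfl
  | cons i l ih => rw [expo_cons, map_add, ih, MvPolynomial.wt_single, List.sum_cons, one_mul]

theorem prod_map_X {K : Type*} [Field K] (l : List ℕ) :
    (l.map (MvPolynomial.X (R := K))).prod = MvPolynomial.monomial (expo l) 1 := by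
  induction l with
  | nil => rw [expo_nil]; rfl
  | cons i l ih =>
    rw [List.map_cons, List.prod_cons, ih, expo_cons, MvPolynomial.X, MvPolynomial.monomial_mul,
      one_mul]

/-- Split off the power of `y_b` and sort the remaining indices downwards; normality makes the first
two of them equal. -/
theorem exists_expo {b m : ℕ} {n : ℤ} {μ : ℕ →₀ ℕ} (h : IsIndex b m n μ) (hn : IsNormal b μ) :
    ∃ r m' n' l, r + m' = m ∧ ((n' + b * r : ℕ) : ℤ) = n ∧ IsGen (b + 1) m' n' l ∧
      Finsupp.single b r + expo l = μ := by
  obtain ⟨h1, h2, h3⟩ := h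
  set l := (Finsupp.toMultiset (Finsupp.erase b μ)).sort (· ≥ ·) with hl
  have hle : expo l = Finsupp.erase b μ := by
    rw [expo, hl, Multiset.sort_eq, Finsupp.toMultiset_toFinsupp]
  have hμ : Finsupp.single b (μ b) + expo l = μ := by rw [hle, Finsupp.single_add_erase]
  have hmem : ∀ i, i ∈ l ↔ i ≠ b ∧ μ i ≠ 0 := fun i => by
    rw [← List.count_pos_iff, ← expo_apply, hle, Finsupp.erase_apply]
    split_ifs with hi
    · simp [hi]
    · simp [hi, Nat.pos_iff_ne_zero]
  have hcount : ∀ i, i ≠ b → μ i = l.count i := fun i hi => by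
    rw [← expo_apply, hle, Finsupp.erase_ne hi]
  have hb : ∀ i ∈ l, b + 1 ≤ i := fun i hi => by
    obtain ⟨h4, h5⟩ := (hmem i).1 hi
    have : ¬ i < b := fun h => h5 (h1 i h)
    omega
  have hpw : l.Pairwise (· ≥ ·) := Multiset.pairwise_sort _ _
  refine ⟨μ b, l.length, l.sum, l, ?_, ?_, ⟨rfl, rfl, hb, hpw, ?_⟩, hμ⟩
  · rw [← h2, ← degree_expo]
    conv_rhs => rw [← hμ]
    rw [map_add, Finsupp.degree_single]
  · rw [← h3, ← wt_expo]
    conv_rhs => rw [← hμ]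
    rw [map_add, MvPolynomial.wt_single, mul_comm, add_comm]
  · clear_value l
    cases l with
    | nil => exact Or.inl rfl
    | cons p l =>
      right
      have hp : b + 1 ≤ p := hb p (by simp)
      have hple := (List.pairwise_cons.1 hpw).1
      -- If the largest entry `p` occurred only once, normality would provide a still larger one.
      have hpl : p ∈ l := by
        by_contra hpl
        obtain ⟨j, hj, hj'⟩ := hn p (by omega) (by
          rw [hcount p (by omega), List.count_cons_self, List.count_eq_zero_of_not_mem hpl])
        rcases List.mem_cons.1 ((hmem j).2 ⟨by omega, hj'⟩) with h | h
        · omega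
        · have := hple j h
          omega
      cases l with
      | nil => simp at hpl
      | cons q l =>
        have hq := hple q (by simp)
        have : p ≤ q := by
          rcases List.mem_cons.1 hpl with h | h
          · exact h.le
          · exact (List.pairwise_cons.1 (List.pairwise_cons.1 hpw).2).1 p h
        obtain rfl : p = q := le_antisymm this hq
        exact ⟨p, l, rfl⟩

theorem isIndex_expo {b r m n : ℕ} {l : List ℕ} (h : IsGen (b + 1) m n l) :
    IsIndex b (r + m) ((n + b * r : ℕ) : ℤ) (Finsupp.single b r + expo l) ∧
      IsNormal b (Finsupp.single b r + expo l) := by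
  obtain ⟨h1, h2, h3, h4, h5⟩ := h
  refine ⟨⟨fun i hi => ?_, ?_, ?_⟩, fun M hM hM1 => ?_⟩
  · rw [Finsupp.add_apply, Finsupp.single_eq_of_ne (by omega), zero_add, expo_apply]
    refine List.count_eq_zero_of_not_mem fun h => ?_
    have := h3 i h
    omega
  · rw [map_add, Finsupp.degree_single, degree_expo, h1]
  · rw [map_add, MvPolynomial.wt_single, wt_expo, h2, mul_comm, add_comm]
  · rw [Finsupp.add_apply, Finsupp.single_eq_of_ne (by omega), zero_add, expo_apply] at hM1
    have hMl : M ∈ l := List.count_pos_iff.1 (by omega)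
    rcases h5 with rfl | ⟨p, l', rfl⟩
    · simp at hMl
    · have hne : p ≠ M := by
        rintro rfl
        simp at hM1
      have : M ≤ p := by
        rcases List.mem_cons.1 hMl with h | h
        · exact h.le
        · exact (List.pairwise_cons.1 h4).1 M h
      refine ⟨p, by omega, ?_⟩
      rw [Finsupp.add_apply, expo_apply]
      simp

/-- All entries exceed `b`, so the exponent of `y_b` recovers `r`; a nonincreasing list is
determined by its multiset. -/
theorem expo_injective {b r r' m m' n n' : ℕ} {l l' : List ℕ} (h : IsGen (b + 1) m n l)
    (h' : IsGen (b + 1) m' n' l')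
    (e : Finsupp.single b r + expo l = Finsupp.single b r' + expo l') : r = r' ∧ l = l' := by
  have hb : ∀ {m n : ℕ} {l : List ℕ}, IsGen (b + 1) m n l → expo l b = 0 := fun h => by
    rw [expo_apply]
    refine List.count_eq_zero_of_not_mem fun hb => ?_
    have := h.2.2.1 b hb
    omega
  have hr : r = r' := by
    have := DFunLike.congr_fun e b
    simpa [hb h, hb h'] using this
  refine ⟨hr, ?_⟩
  rw [hr] at e
  have e' : (l : Multiset ℕ) = l' := Multiset.toFinsupp.injective (add_left_cancel e)
  exact (Multiset.coe_eq_coe.1 e').eq_of_pairwise' h.2.2.2.1 h'.2.2.2.1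

/-- The weight `n` is the grade plus one; grades from `-1` to `10` are checked by evaluating the
enumeration. -/
theorem numSB_eq : ∀ m < 10, ∀ n : ℕ, n < 12 →
    Buttin.numSB (m + 1) ((n : ℤ) - 1) = (table 0 m n).length := by
  decide

theorem numSLe_eq : ∀ m < 10, ∀ n : ℕ, n < 12 →
    Buttin.numSLe (m + 1) ((n : ℤ) - 1) = (table 1 m n).length := by
  decide

end NormalLists

/-! ### The prescribed quadratic polynomials and the linear forms dual to them -/

namespace Buttin

theorem map_aThree {K M M' : Type*} [Field K] [AddCommGroup M] [Module K M] [AddCommGroup M']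
    [Module K M'] (f : M →ₗ[K] M') (m : ℕ) (c : ℕ → ℕ → M) :
    f (aThree K m c) = aThree K m fun i j => f (c i j) := by
  simp [aThree]

theorem aThree_congr {K M : Type*} [Field K] [AddCommGroup M] [Module K M] {m : ℕ}
    {c c' : ℕ → ℕ → M} (h : ∀ i ≤ m + 1, c i (2 * m + 2 - i) = c' i (2 * m + 2 - i)) :
    aThree K m c = aThree K m c' := by
  rw [aThree, aThree, Finset.sum_congr rfl fun i hi => by
    rw [h i (by have := Finset.mem_range.1 hi; omega)]]
  have := h (m + 1) le_rfl
  rw [show 2 * m + 2 - (m + 1) = m + 1 by omega] at this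
  rw [this]

end Buttin

namespace MvPolynomial

open Buttin (aThree)

variable {K : Type*} [Field K]

/-- The quadratic polynomial `∑ ± binom(2q+2, i) y_i y_{2q+2-i}` in the variables `y_i`, `b ≤ i`. -/
def pairPoly (K : Type*) [Field K] (b q : ℕ) : MvPolynomial ℕ K :=
  aThree K q fun i j => if b ≤ i then X i * X j else 0

/-- The linear form `∑ ± binom(2q+2, i) ∂_i ∂_{2q+2-i}` on quadratic polynomials. -/
def pairForm (K : Type*) [Field K] (q : ℕ) : MvPolynomial ℕ K →ₗ[K] K :=
  aThree K q fun i j => lcoeff K 0 ∘ₗ (pderiv i).toLinearMap ∘ₗ (pderiv j).toLinearMap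

theorem pairForm_apply (q : ℕ) (p : MvPolynomial ℕ K) :
    pairForm K q p = aThree K q fun i j => coeff 0 (pderiv i (pderiv j p)) := by
  simp only [pairForm, aThree, LinearMap.add_apply, LinearMap.sum_apply, LinearMap.smul_apply]
  rfl

/-- The form `pairForm` applied to the `r`-th derivative by `y_b`. -/
def pairFormDeriv (K : Type*) [Field K] (b r q : ℕ) : MvPolynomial ℕ K →ₗ[K] K :=
  pairForm K q ∘ₗ (pderiv b).toLinearMap ^ r

/-- Only the positivity of the integer factor matters: it later excludes cancellation. -/
theorem exists_coeff_pderiv_pow (b r : ℕ) (ν : ℕ →₀ ℕ) : ∃ N : ℕ, 0 < N ∧ ∀ p : MvPolynomial ℕ K,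
    coeff ν (((pderiv b).toLinearMap ^ r) p) = N * coeff (ν + Finsupp.single b r) p := by
  induction r generalizing ν with
  | zero => exact ⟨1, one_pos, fun p => by simp⟩
  | succ r ih =>
    obtain ⟨N, hN, h⟩ := ih (ν + Finsupp.single b 1)
    refine ⟨N * (ν b + 1), Nat.mul_pos hN (Nat.succ_pos _), fun p => ?_⟩
    rw [pow_succ', Module.End.mul_apply]
    change coeff ν (pderiv b _) = _
    rw [coeff_pderiv, h, add_assoc, ← Finsupp.single_add, add_comm 1 r]
    push_cast
    ring

theorem exists_coeff_pderiv_pderiv (i j b r : ℕ) : ∃ N : ℕ, 0 < N ∧ ∀ p : MvPolynomial ℕ K,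
    coeff 0 (pderiv i (pderiv j (((pderiv b).toLinearMap ^ r) p))) =
      N * coeff (Finsupp.single i 1 + Finsupp.single j 1 + Finsupp.single b r) p := by
  obtain ⟨N, hN, h⟩ := exists_coeff_pderiv_pow (K := K) b r
    (Finsupp.single i 1 + Finsupp.single j 1)
  refine ⟨N * (Finsupp.single i 1 j + 1), Nat.mul_pos hN (Nat.succ_pos _), fun p => ?_⟩
  rw [coeff_pderiv, coeff_pderiv, zero_add, h]
  simp only [Finsupp.coe_zero, Pi.zero_apply]
  push_cast
  ring

/-- The form `pairFormDeriv` as a combination of coefficients. -/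
theorem exists_pairFormDeriv_eq (b r q : ℕ) : ∃ N : ℕ → ℕ, (∀ i, 0 < N i) ∧
    ∀ p : MvPolynomial ℕ K, pairFormDeriv K b r q p =
      aThree K q fun i _ => N i *
        coeff (Finsupp.single i 1 + Finsupp.single (2 * q + 2 - i) 1 + Finsupp.single b r) p := by
  choose N hN h using fun i => exists_coeff_pderiv_pderiv (K := K) i (2 * q + 2 - i) b r
  refine ⟨N, hN, fun p => ?_⟩
  rw [pairFormDeriv, LinearMap.comp_apply, pairForm_apply]
  exact Buttin.aThree_congr fun i _ => h i p

/-- The form sees only the monomials `y_i y_{2q+2-i} y_b^r`, `i ≤ q + 1`. For `i ≤ q` the index `2q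
+ 2 - i` is the largest, exceeds `b` and occurs once, so the monomial is not normal. -/
theorem pairFormDeriv_monomial {b r q : ℕ} (hb : b ≤ q + 1) {μ : ℕ →₀ ℕ} (hμ : IsNormal b μ)
    (hne : μ ≠ Finsupp.single (q + 1) 1 + Finsupp.single (q + 1) 1 + Finsupp.single b r) :
    pairFormDeriv K b r q (monomial μ 1) = 0 := by
  classical
  obtain ⟨N, -, h⟩ := exists_pairFormDeriv_eq (K := K) b r q
  rw [h, show (0 : K) = aThree K q fun _ _ => (0 : K) by simp [aThree]]
  refine Buttin.aThree_congr fun i hi => ?_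
  rw [coeff_monomial, if_neg, mul_zero]
  rintro rfl
  rcases Nat.lt_or_ge i (q + 1) with hlt | hge
  · obtain ⟨j, hj, hj'⟩ := hμ (2 * q + 2 - i) (by omega) (by
      simp only [Finsupp.add_apply, Finsupp.single_apply]
      rw [if_neg (by omega), if_pos trivial, if_neg (by omega), zero_add, add_zero])
    apply hj'
    simp only [Finsupp.add_apply, Finsupp.single_apply]
    rw [if_neg (by omega), if_neg (by omega), if_neg (by omega), add_zero, add_zero]
  · obtain rfl : i = q + 1 := by omega
    apply hne
    rw [show 2 * q + 2 - (q + 1) = q + 1 by omega]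

theorem single_add_single_inj {q i a : ℕ} (hi : i ≤ q + 1) (ha : a ≤ q + 1)
    (h : Finsupp.single i 1 + Finsupp.single (2 * q + 2 - i) 1 =
      (Finsupp.single a 1 + Finsupp.single (2 * q + 2 - a) 1 : ℕ →₀ ℕ)) : i = a := by
  by_contra hne
  wlog hlt : i < a generalizing i a
  · exact this ha hi h.symm (Ne.symm hne) (by omega)
  have := DFunLike.congr_fun h i
  simp only [Finsupp.add_apply, Finsupp.single_apply] at this
  rw [if_pos trivial, if_neg (by omega), if_neg (by omega), if_neg (by omega)] at this
  omega

theorem X_mul_X_eq (i j : ℕ) : (X i * X j : MvPolynomial ℕ K) =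
    monomial (Finsupp.single i 1 + Finsupp.single j 1) 1 := by
  rw [X, X, monomial_mul, one_mul]

theorem coeff_pairPoly {b q a : ℕ} (ha : a ≤ q + 1) :
    coeff (Finsupp.single a 1 + Finsupp.single (2 * q + 2 - a) 1) (pairPoly K b q) =
      (-1) ^ a * ((if b ≤ a then (Nat.choose (2 * q + 2) a : K) else 0) *
        (if a ≤ q then 1 else 1 / 2)) := by
  classical
  have hc : ∀ i ≤ q + 1, coeff (Finsupp.single a 1 + Finsupp.single (2 * q + 2 - a) 1)
      (if b ≤ i then X i * X (2 * q + 2 - i) else 0 : MvPolynomial ℕ K) =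
        if i = a then (if b ≤ i then 1 else 0) else 0 := fun i hi => by
    by_cases hb : b ≤ i
    · rw [if_pos hb, X_mul_X_eq, coeff_monomial]
      by_cases hia : i = a
      · subst hia; simp [hb]
      · rw [if_neg fun h => hia (single_add_single_inj hi ha h), if_neg hia]
    · simp [hb]
  have hlc := Buttin.map_aThree
    (lcoeff K (Finsupp.single a 1 + Finsupp.single (2 * q + 2 - a) 1)) q
    (fun i j => (if b ≤ i then X i * X j else 0 : MvPolynomial ℕ K))
  change coeff _ (pairPoly K b q) = _ at hlc
  rw [hlc, Buttin.aThree_congr (c' := fun i _ => if i = a then (if b ≤ i then (1 : K) else 0) else 0)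
    fun i hi => hc i hi, aThree]
  by_cases haq : a ≤ q
  · rw [Finset.sum_eq_single_of_mem a (Finset.mem_range.2 (by omega)) fun i _ hi => by
      rw [if_neg hi, smul_zero]]
    rw [if_pos rfl, if_neg (by omega : ¬ q + 1 = a), if_pos haq, smul_zero, add_zero]
    split_ifs <;> simp
  · obtain rfl : a = q + 1 := by omega
    rw [Finset.sum_eq_zero fun i hi => by
      rw [if_neg (by have := Finset.mem_range.1 hi; omega), smul_zero], if_pos rfl, if_neg haq]
    split_ifs
    · simp only [smul_eq_mul]; ring
    · simp

/-- Polynomial and form carry the same signed binomial coefficients, so the signs cancel and the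
value is a sum of nonnegative rationals, the one for `i = q + 1` being positive. -/
theorem pairFormDeriv_pairPoly_ne_zero [CharZero K] {b q : ℕ} (r : ℕ) (hb : b ≤ q + 1) :
    pairFormDeriv K b r q (X b ^ r * pairPoly K b q) ≠ 0 := by
  obtain ⟨N, hN, h⟩ := exists_pairFormDeriv_eq (K := K) b r q
  have hsq : ∀ i : ℕ, (-1 : K) ^ i * (-1) ^ i = 1 := fun i => by rw [← mul_pow]; simp
  have hcoeff : ∀ i ≤ q + 1, (N i : K) * coeff (Finsupp.single i 1 +
      Finsupp.single (2 * q + 2 - i) 1 + Finsupp.single b r) (X b ^ r * pairPoly K b q) =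
      N i * ((-1) ^ i * ((if b ≤ i then (Nat.choose (2 * q + 2) i : K) else 0) *
        (if i ≤ q then 1 else 1 / 2))) := fun i hi => by
    rw [mul_comm (X b ^ r), X_pow_eq_monomial, coeff_mul_monomial, mul_one, coeff_pairPoly hi]
  set n := 2 * q + 2
  rw [h, Buttin.aThree_congr (c' := fun i _ => (N i : K) * ((-1) ^ i *
    ((if b ≤ i then (Nat.choose n i : K) else 0) * (if i ≤ q then 1 else 1 / 2))))
    fun i hi => hcoeff i hi, aThree]
  have h1 : ∑ i ∈ Finset.range (q + 1), ((-1 : K) ^ i * (Nat.choose n i : K)) • ((N i : K) *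
      ((-1) ^ i * ((if b ≤ i then (Nat.choose n i : K) else 0) * (if i ≤ q then 1 else 1 / 2)))) =
      ((∑ i ∈ Finset.range (q + 1), if b ≤ i then N i * Nat.choose n i ^ 2 else 0 : ℕ) : K) := by
    push_cast
    refine Finset.sum_congr rfl fun i hi => ?_
    rw [if_pos (by have := Finset.mem_range.1 hi; omega : i ≤ q), smul_eq_mul]
    split_ifs
    · linear_combination (N i * (Nat.choose n i : K) ^ 2) * hsq i
    · ring
  have h2 : ((-1 : K) ^ (q + 1) * ((Nat.choose n (q + 1) : K) / 2)) • ((N (q + 1) : K) *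
      ((-1) ^ (q + 1) * ((if b ≤ q + 1 then (Nat.choose n (q + 1) : K) else 0) *
        (if q + 1 ≤ q then 1 else 1 / 2)))) =
      ((N (q + 1) * Nat.choose n (q + 1) ^ 2 : ℕ) : K) / 4 := by
    rw [if_pos hb, if_neg (by omega), smul_eq_mul]
    push_cast
    linear_combination (N (q + 1) * (Nat.choose n (q + 1) : K) ^ 2 / 4) * hsq (q + 1)
  rw [h1, h2]
  intro h0
  -- The factor `4` clears the two halves in the middle term, one from the form and one from the
  -- polynomial.
  have h4 : ((4 * (∑ i ∈ Finset.range (q + 1), if b ≤ i then N i * Nat.choose n i ^ 2 else 0) +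
      N (q + 1) * Nat.choose n (q + 1) ^ 2 : ℕ) : K) = 0 := by
    push_cast at h0 ⊢
    linear_combination 4 * h0
  have h5 := Nat.cast_eq_zero.1 h4
  have h6 : 0 < N (q + 1) * Nat.choose n (q + 1) ^ 2 :=
    Nat.mul_pos (hN _) (pow_pos (Nat.choose_pos (by omega)) 2)
  omega

theorem X_pow_mul_pairPoly_mem {b q r : ℕ} (hb : b ≤ q + 1) :
    X b ^ r * pairPoly K b q ∈ polys K b (r + 2) ((2 * q + 2 + b * r : ℕ) : ℤ) := by
  have h : ∀ i ≤ q + 1, X b ^ r * (if b ≤ i then X i * X (2 * q + 2 - i) else 0) ∈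
      polys K b (r + 2) ((2 * q + 2 + b * r : ℕ) : ℤ) := fun i hi => by
    split_ifs with hbi
    · rw [X_mul_X_eq, X_pow_eq_monomial, monomial_mul, one_mul]
      refine monomial_mem_polys ⟨fun j hj => ?_, ?_, ?_⟩ 1
      · simp only [Finsupp.add_apply, Finsupp.single_apply]
        rw [if_neg (by omega), if_neg (by omega), if_neg (by omega), add_zero, add_zero]
      · simp
      · simp only [map_add, wt_single, mul_comm r b]
        omega
    · rw [mul_zero]; exact Submodule.zero_mem _
  rw [pairPoly, aThree, mul_add, Finset.mul_sum]
  refine Submodule.add_mem _ (Submodule.sum_mem _ fun i hi => ?_) ?_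
  · rw [mul_smul_comm]
    exact Submodule.smul_mem _ _ (h i (by have := Finset.mem_range.1 hi; omega))
  · rw [mul_smul_comm]
    have := h (q + 1) le_rfl
    rw [show 2 * q + 2 - (q + 1) = q + 1 by omega] at this
    exact Submodule.smul_mem _ _ this

/-- Reduces the vanishing of `pairForm` on images to the case `b = 0`. -/
theorem raise_eq_raise_zero {b : ℕ} {p : MvPolynomial ℕ K}
    (hp : ∀ μ, coeff μ p ≠ 0 → ∀ i < b, μ i = 0) : raise K b p = raise K 0 p := by
  rw [p.as_sum, map_sum, map_sum]
  refine Finset.sum_congr rfl fun μ hμ => ?_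
  rw [raise_monomial, raise_monomial]
  refine Finset.sum_congr rfl fun i hi => ?_
  rw [if_pos (Nat.zero_le i), if_pos]
  exact not_lt.1 fun h => Finsupp.mem_support_iff.1 hi (hp μ (mem_support_iff.1 hμ) i h)

/-- The variable `y_b` occurs in no image of a variable under `raise K b`, so the commutator
vanishes. -/
theorem pderiv_raise_self (b : ℕ) (p : MvPolynomial ℕ K) :
    pderiv b (raise K b p) = raise K b (pderiv b p) := by
  have h : shiftVec b (Pi.single b (1 : K)) = 0 := by
    funext l
    rw [shiftVec]
    split_ifs
    · rw [Pi.single_eq_of_ne (by omega), mul_zero]; rfl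
    · rfl
  rw [← vecDeriv_single, vecDeriv_raise, h, vecDeriv_zero, Derivation.zero_apply, add_zero]

theorem pderiv_raise_zero (i : ℕ) (p : MvPolynomial ℕ K) :
    pderiv i (raise K 0 p) = raise K 0 (pderiv i p) + (i : K) • pderiv (i - 1) p := by
  have h : shiftVec 0 (Pi.single i (1 : K)) = (i : K) • Pi.single (i - 1) (1 : K) := by
    funext l
    rw [shiftVec, if_pos (Nat.zero_le l), Pi.smul_apply, smul_eq_mul]
    by_cases hl : l + 1 = i
    · subst hl; simp
    · rw [Pi.single_eq_of_ne hl]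
      cases i with
      | zero => simp
      | succ i => rw [Pi.single_eq_of_ne (by omega)]; ring
  rw [← vecDeriv_single, vecDeriv_raise, h, vecDeriv_smul, Derivation.smul_apply, vecDeriv_single,
    vecDeriv_single]

/-- With `n = 2q + 2` the sum telescopes because `(n - i) binom(n, i) = (i + 1) binom(n, i + 1)`;
what remains in the middle cancels by the symmetry of second derivatives, with coefficient `(q + 1)
binom(n, q + 1) / 2`. The five cases are checked one by one. -/
theorem pairForm_raise_zero [CharZero K] {q : ℕ} (hq : q ≤ 4) (p : MvPolynomial ℕ K) :
    pairForm K q (raise K 0 p) = 0 := by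
  set c : ℕ → ℕ → K := fun i j => coeff 0 (pderiv i (pderiv j p)) with hc
  have hsymm : ∀ i j, c i j = c j i := fun i j => by
    simp only [hc, ← vecDeriv_single]
    rw [vecDeriv_comm]
  have h : ∀ i j, coeff 0 (pderiv i (pderiv j (raise K 0 p))) =
      i * c (i - 1) j + j * c i (j - 1) := fun i j => by
    rw [pderiv_raise_zero, map_add, pderiv_raise_zero, Derivation.map_smul, coeff_add, coeff_add,
      coeff_zero_raise, coeff_smul, coeff_smul]
    simp [hc]
  rw [pairForm_apply]
  simp only [h]
  clear_value c
  interval_cases q <;> simp [aThree, Finset.sum_range_succ, Nat.choose]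
  · linear_combination hsymm 0 1
  · linear_combination 6 * hsymm 2 1
  · linear_combination 30 * hsymm 2 3
  · linear_combination 140 * hsymm 4 3
  · linear_combination 630 * hsymm 4 5

theorem pairFormDeriv_raised [CharZero K] {b r q m : ℕ} {n : ℤ} (hq : q ≤ 4) {p : MvPolynomial ℕ K}
    (hp : p ∈ raised K b m n) : pairFormDeriv K b r q p = 0 := by
  obtain ⟨p, hp, rfl⟩ := hp
  have hb : ∀ μ, coeff μ (((pderiv b).toLinearMap ^ r) p) ≠ 0 → ∀ i < b, μ i = 0 := by
    intro μ hμ i hi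
    obtain ⟨N, -, h⟩ := exists_coeff_pderiv_pow (K := K) b r μ
    rw [h] at hμ
    have := (hp _ (right_ne_zero_of_mul hμ)).1 i hi
    rw [Finsupp.add_apply] at this
    omega
  have hcomm : ∀ p', ((pderiv b).toLinearMap ^ r) (raise K b p') =
      raise K b (((pderiv b).toLinearMap ^ r) p') := by
    clear hb
    induction r with
    | zero => exact fun p' => rfl
    | succ r ih =>
      intro p'
      rw [pow_succ', Module.End.mul_apply, ih, Module.End.mul_apply]
      exact pderiv_raise_self b _
  change pairForm K q (((pderiv b).toLinearMap ^ r) (raise K b p)) = 0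
  rw [hcomm, raise_eq_raise_zero hb, pairForm_raise_zero hq]

/-- The basis of monomials, with a quadratic polynomial `pairPoly` inserted. -/
theorem isRaiseBasis_pairPoly [CharZero K] {b r q m : ℕ} {n : ℤ} (hm : m = r + 2)
    (hn : n = (2 * q + 2 + b * r : ℕ)) (hb : b ≤ q + 1) (hq : q ≤ 4) {ι : Type*}
    {e : ι → ℕ →₀ ℕ} (hinj : Function.Injective e)
    (he : ∀ μ, (IsIndex b m n μ ∧ IsNormal b μ) ↔ ∃ i, e i = μ)
    {w : ι → MvPolynomial ℕ K} (i₀ : ι)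
    (h₀ : e i₀ = Finsupp.single (q + 1) 1 + Finsupp.single (q + 1) 1 + Finsupp.single b r)
    (hw₀ : w i₀ = X b ^ r * pairPoly K b q) (hw : ∀ i, i ≠ i₀ → w i = monomial (e i) 1) :
    IsRaiseBasis b m n w := by
  subst hm hn
  refine (isRaiseBasis_monomial (K := K) hinj he).replace i₀ hw
    (hw₀ ▸ X_pow_mul_pairPoly_mem hb) (pairFormDeriv K b r q) (fun p hp => pairFormDeriv_raised hq hp)
    (fun i hi => ?_) (hw₀ ▸ pairFormDeriv_pairPoly_ne_zero r hb)
  refine pairFormDeriv_monomial hb ((he _).2 ⟨i, rfl⟩).2 fun h => hi (hinj (h.trans h₀.symm))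

/-- The only normal monomial of degree `2` and weight `2q + 2` is `y_{q+1}²`. So the cokernel is
spanned by one class, on which `pairForm` does not vanish. -/
theorem mem_raised_iff [CharZero K] {b q : ℕ} (hb : b ≤ q + 1) (hq : q ≤ 4) {p : MvPolynomial ℕ K}
    (hp : p ∈ polys K b 2 ((2 * q + 2 : ℕ) : ℤ)) :
    p ∈ raised K b 2 ((2 * q + 2 : ℕ) : ℤ) ↔ pairForm K q p = 0 := by
  have h0 : ∀ p, pairFormDeriv K b 0 q p = pairForm K q p := fun p => rfl
  refine ⟨fun h => (h0 p) ▸ pairFormDeriv_raised hq h, fun h => ?_⟩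
  set μ₀ : ℕ →₀ ℕ := Finsupp.single (q + 1) 1 + Finsupp.single (q + 1) 1 with hμ₀
  have huniq : ∀ μ, IsIndex b 2 ((2 * q + 2 : ℕ) : ℤ) μ → IsNormal b μ → μ = μ₀ := by
    intro μ hI hN
    by_contra hne
    obtain ⟨s, -, rfl⟩ := exists_sum_single_eq hI
    obtain ⟨-, -, h3⟩ := hI
    rw [Fin.sum_univ_two] at hN hne h3
    simp only [map_add, wt_single, one_mul] at h3
    wlog hlt : s 0 ≤ s 1 generalizing s
    · refine this ![s 1, s 0] ?_ ?_ ?_ ?_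
      · simpa [add_comm] using hN
      · simpa [add_comm] using hne
      · simpa [add_comm] using h3
      · simpa using (not_le.1 hlt).le
    rcases hlt.eq_or_lt with h | h
    · apply hne
      have h1 : s 1 = q + 1 := by omega
      rw [h, h1]
    · obtain ⟨j, hj, hj'⟩ := hN (s 1) (by omega) (by
        simp only [Finsupp.add_apply, Finsupp.single_apply]
        rw [if_neg (by omega), if_pos trivial])
      apply hj'
      simp only [Finsupp.add_apply, Finsupp.single_apply]
      rw [if_neg (by omega), if_neg (by omega), add_zero]
  have hspan : polys K b 2 ((2 * q + 2 : ℕ) : ℤ) ≤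
      Submodule.span K {monomial μ₀ (1 : K)} ⊔ raised K b 2 ((2 * q + 2 : ℕ) : ℤ) := by
    refine polys_le fun μ hμ => ?_
    have hle : (fun l : ℕ →₀ ℕ => monomial l (1 : K)) ''
        {l | IsIndex b 2 ((2 * q + 2 : ℕ) : ℤ) l ∧ IsNormal b l} ⊆ {monomial μ₀ 1} := by
      rintro _ ⟨l, ⟨h1, h2⟩, rfl⟩
      rw [huniq l h1 h2]
      rfl
    have hsup := sup_le_sup (Submodule.span_mono (R := K) hle)
      (le_refl (raised K b 2 ((2 * q + 2 : ℕ) : ℤ)))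
    exact hsup (monomial_mem_span_sup_raised μ hμ)
  have key : ∀ p ∈ polys K b 2 ((2 * q + 2 : ℕ) : ℤ), ∃ s : K, ∃ v ∈ raised K b 2 ((2 * q + 2 : ℕ) : ℤ),
      p = s • monomial μ₀ (1 : K) + v ∧ pairForm K q p = s * pairForm K q (monomial μ₀ 1) := by
    intro p hp
    obtain ⟨u, hu, v, hv, rfl⟩ := Submodule.mem_sup.1 (hspan hp)
    obtain ⟨s, rfl⟩ := Submodule.mem_span_singleton.1 hu
    refine ⟨s, v, hv, rfl, ?_⟩
    rw [map_add, map_smul, ← h0 v, pairFormDeriv_raised hq hv, add_zero, smul_eq_mul]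
  -- The nonzero value at `pairPoly` is a multiple of the value at this monomial.
  have hne : pairForm K q (monomial μ₀ (1 : K)) ≠ 0 := fun hz => by
    have hm := X_pow_mul_pairPoly_mem (K := K) (r := 0) hb
    have hz' := pairFormDeriv_pairPoly_ne_zero (K := K) 0 hb
    rw [pow_zero, one_mul] at hm hz'
    obtain ⟨s, v, -, -, h2⟩ := key _ hm
    rw [hz, mul_zero] at h2
    exact hz' h2
  obtain ⟨s, v, hv, rfl, h2⟩ := key p hp
  rw [h2] at h
  rw [(mul_eq_zero.1 h).resolve_right hne, zero_smul, zero_add]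
  exact hv

end MvPolynomial

/-! ### From lists to generating cocycles; the coboundary criterion -/

namespace NormalLists

open MvPolynomial (pairPoly)

/-- The polynomial that represents the cocycle with the leading monomial `∏ y_i`, `i ∈ l`. -/
def polyOf {K : Type*} [Field K] (b : ℕ) : List ℕ → MvPolynomial ℕ K
  | [p, _] => pairPoly K b (p - 1)
  | l => (l.map MvPolynomial.X).prod

theorem polyOf_of_length_ne {K : Type*} [Field K] {b : ℕ} {l : List ℕ} (hl : l.length ≠ 2) :
    polyOf (K := K) b l = MvPolynomial.monomial (expo l) 1 := by
  rw [← prod_map_X]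
  match l with
  | [] => rfl
  | [_] => rfl
  | [_, _] => simp at hl
  | _ :: _ :: _ :: _ => rfl

theorem getD_mem {b m n j : ℕ} (hj : j < (table b m n).length) :
    (table b m n).getD j [] ∈ table b m n := by
  rw [List.getD_eq_getElem _ _ hj]
  exact List.getElem_mem hj

end NormalLists

namespace GradedLieSuperalgebra

open MvPolynomial (vecDeriv polar pderiv polys raised IsRaiseBasis IsIndex IsNormal pairPoly
  pairForm)
open NormalLists Buttin

variable {K A : Type*} [Field K] [AddCommGroup A] [Module K A]

namespace Coordinates

variable {L : GradedLieSuperalgebra K A} {b : ℕ} (c : L.Coordinates b)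

/-- Each exterior factor `C(x^b)` multiplies the polynomial by `y_b`. -/
theorem consequence_eq {a : (k : ℕ) → ℤ → ℕ → (Fin k → A) → K} {m m' : ℕ} (h : m' ≤ m) {g : ℤ}
    {j : ℕ} {p : MvPolynomial ℕ K} (ha : a (m' + 1) g j = c.xiForm m' p) :
    L.consequence (c.y b) a (m + 1) (m' + 1) g j =
      c.xiForm m (MvPolynomial.X b ^ (m - m') * p) := by
  induction m, h using Nat.le_induction with
  | base => rw [consequence, if_pos rfl, ha, Nat.sub_self, pow_zero, one_mul]
  | succ m h ih =>
    rw [consequence, if_neg (by omega), ih, wedge_xiForm, ← mul_assoc, ← pow_succ',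
      Nat.sub_add_comm h]

/-- The index set of the generators and their consequences corresponds bijectively to the normal
monomials of degree `k - 1` and weight `g + 1`. The polynomials are these monomials, except that at
most one is exchanged for a power of `y_b` times a `pairPoly`. -/
theorem generates [CharZero K] (hb : b ≤ 1) {num : ℕ → ℤ → ℕ} (hnum₀ : ∀ g, num 0 g = 0)
    (hnum : ∀ m < 10, ∀ g ≤ 10, num (m + 1) g =
      if 0 ≤ g + 1 then (table b m (g + 1).toNat).length else 0)
    {a : (k : ℕ) → ℤ → ℕ → (Fin k → A) → K}
    (ha : ∀ m g j, j < (table b m (g + 1).toNat).length →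
      a (m + 1) g j = c.xiForm m (polyOf b ((table b m (g + 1).toNat).getD j [])))
    {z : ℤ} (hz : z = b) {k : ℕ} {g : ℤ} (hk : 1 ≤ k) (hk' : k ≤ 10) (hg : g ≤ 10) :
    L.Generates (c.y b) z num a k g := by
  subst hz
  obtain ⟨m, rfl⟩ := Nat.exists_eq_add_of_le' hk
  unfold Generates
  set T := {t : ℕ × ℤ × ℕ // t.1 ≤ m + 1 ∧ t.2.1 + (b : ℤ) * (((m + 1 : ℕ) : ℤ) - t.1) = g ∧
    t.2.2 < num t.1 t.2.1} with hT
  -- A generator has list length `m'` and weight `n`, that is, degree `m' + 1` and grade `n - 1`;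
  -- `r` counts the factors `C(x^b)`, each of weight `b`.
  have hfacts : ∀ t : T, ∃ (m' r n j : ℕ), t.1 = (m' + 1, (n : ℤ) - 1, j) ∧ r + m' = m ∧
      ((n + b * r : ℕ) : ℤ) = g + 1 ∧ j < (table b m' n).length := by
    rintro ⟨⟨k', g', j⟩, h1, h2, h3⟩
    dsimp only at h1 h2 h3
    cases k' with
    | zero => simp [hnum₀] at h3
    | succ m' =>
      have hbr : (0 : ℤ) ≤ (b : ℤ) * (((m + 1 : ℕ) : ℤ) - (m' + 1 : ℕ)) :=
        mul_nonneg (by omega) (by omega)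
      rw [hnum m' (by omega) g' (by omega)] at h3
      split_ifs at h3 with hg'
      · refine ⟨m', m - m', (g' + 1).toNat, j, ?_, by omega, ?_, h3⟩
        · rw [Int.toNat_of_nonneg hg', add_sub_cancel_right]
        · push_cast [Nat.cast_sub (by omega : m' ≤ m)] at h2 ⊢
          rw [Int.toNat_of_nonneg hg']
          linear_combination h2
      · omega
  choose m' r n j ht hr hn hj using hfacts
  have hgen : ∀ t, IsGen (b + 1) (m' t) (n t) ((table b (m' t) (n t)).getD (j t) []) := fun t =>
    (mem_table hb _ _ _).1 (getD_mem (hj t))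
  set l : T → List ℕ := fun t => (table b (m' t) (n t)).getD (j t) []
  set e : T → ℕ →₀ ℕ := fun t => Finsupp.single b (r t) + expo (l t)
  set w : T → MvPolynomial ℕ K := fun t => MvPolynomial.X b ^ r t * polyOf b (l t)
  have hcons : (fun t : T => L.consequence (c.y b) a (m + 1) t.1.1 t.1.2.1 t.1.2.2) =
      fun t => c.xiForm m (w t) := by
    funext t
    have h1 : ((n t : ℤ) - 1 + 1).toNat = n t := by omega
    have h2 := ha (m' t) ((n t : ℤ) - 1) (j t) (by rw [h1]; exact hj t)
    rw [h1] at h2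
    have h3 := c.consequence_eq (by have := hr t; omega : m' t ≤ m) h2
    rw [show m - m' t = r t by have := hr t; omega] at h3
    rw [ht t]
    exact h3
  have hinj : Function.Injective e := by
    intro t t' h
    obtain ⟨h1, h2⟩ := expo_injective (hgen t) (hgen t') h
    have hm : m' t = m' t' := by have := hr t; have := hr t'; omega
    have hn' : n t = n t' := by
      have h3 := hn t
      rw [← hn t', h1] at h3
      have := Nat.cast_injective h3
      omega
    have hj' : j t = j t' := by
      have hjt := hj t
      have hjt' := hj t'
      rw [← hm, ← hn'] at hjt' h2
      rw [List.getD_eq_getElem _ _ hjt, List.getD_eq_getElem _ _ hjt'] at h2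
      exact (nodup_table _ _ _).getElem_inj_iff.1 h2
    exact Subtype.ext (by rw [ht t, ht t', hm, hn', hj'])
  have he : ∀ μ, (IsIndex b m (g + 1) μ ∧ IsNormal b μ) ↔ ∃ t, e t = μ := by
    intro μ
    constructor
    · rintro ⟨h1, h2⟩
      obtain ⟨r₁, m₁, n₁, l₁, h3, h4, h5, h6⟩ := exists_expo h1 h2
      obtain ⟨j₁, hj₁, hl₁⟩ := List.getElem_of_mem ((mem_table hb _ _ _).2 h5)
      have hbr := Nat.zero_le (b * r₁)
      have hnum₁ : num (m₁ + 1) ((n₁ : ℤ) - 1) = (table b m₁ n₁).length := by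
        rw [hnum m₁ (by omega) _ (by push_cast at h4 hbr; omega), if_pos (by omega),
          sub_add_cancel, Int.toNat_natCast]
      set t : T := ⟨(m₁ + 1, (n₁ : ℤ) - 1, j₁), by dsimp only; omega, by
        subst h3
        push_cast at h4 ⊢
        linear_combination h4, by rw [hnum₁]; exact hj₁⟩ with htdef
      have h7 := ht t
      simp only [htdef, Prod.mk.injEq] at h7
      rw [← htdef] at h7
      have hm' : m' t = m₁ := by omega
      have hn' : n t = n₁ := by omega
      have hr' : r t = r₁ := by have := hr t; omega
      refine ⟨t, ?_⟩
      change Finsupp.single b (r t) + expo ((table b (m' t) (n t)).getD (j t) []) = μ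
      rw [hm', hn', hr', ← h7.2.2, List.getD_eq_getElem _ _ hj₁, hl₁, h6]
    · rintro ⟨t, rfl⟩
      have := isIndex_expo (r := r t) (hgen t)
      rwa [hr t, hn t] at this
  have hw : ∀ t, (l t).length ≠ 2 → w t = MvPolynomial.monomial (e t) 1 := fun t hl => by
    change MvPolynomial.X b ^ r t * polyOf b (l t) = _
    rw [polyOf_of_length_ne hl, MvPolynomial.X_pow_eq_monomial, MvPolynomial.monomial_mul, one_mul]
  refine (congrArg (L.IsCohomologyBasis (m + 1) g) hcons).mpr (c.isCohomologyBasis ?_)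
  by_cases hex : ∃ t, (l t).length = 2
  · obtain ⟨t₀, ht₀⟩ := hex
    have hpair : ∀ t, (l t).length = 2 → ∃ q, l t = [q + 1, q + 1] ∧ b ≤ q + 1 ∧ m' t = 2 ∧
        n t = 2 * q + 2 := by
      intro t hl
      obtain ⟨h1, h2, h3, -, h5⟩ := hgen t
      change (l t).length = _ at h1
      change (l t).sum = _ at h2
      rcases h5 with h5 | ⟨p, l', h5⟩
      · change l t = _ at h5
        rw [h5] at hl
        simp at hl
      · change l t = _ at h5
        have hl' : l' = [] := by
          rw [h5] at hl
          simpa using hl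
        subst hl'
        have hp := h3 p (by change p ∈ l t; rw [h5]; simp)
        obtain ⟨q, rfl⟩ : ∃ q, p = q + 1 := ⟨p - 1, by omega⟩
        rw [h5] at h2
        simp only [List.sum_cons, List.sum_nil] at h2
        exact ⟨q, h5, by omega, by omega, by omega⟩
    obtain ⟨q, hl₀, hbq, hm₀, hn₀⟩ := hpair t₀ ht₀
    have hr₀ := hr t₀
    have hg₀ := hn t₀
    rw [hn₀] at hg₀
    have hbr := Nat.zero_le (b * r t₀)
    -- The bound `q ≤ 4` follows from `2q + 2 ≤ g + 1 ≤ 11`.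
    refine MvPolynomial.isRaiseBasis_pairPoly (by omega) hg₀.symm hbq (by omega) hinj he t₀ ?_ ?_
      fun t hne => hw t ?_
    · change Finsupp.single b (r t₀) + expo (l t₀) = _
      rw [hl₀, expo_cons, expo_cons, expo_nil, add_zero, add_comm]
    · change MvPolynomial.X b ^ r t₀ * polyOf b (l t₀) = _
      rw [hl₀]
      rfl
    -- The exception is unique: list length two fixes `r`, hence the weight `n` and with it `q`.
    · intro hlt
      obtain ⟨q', hl', -, hm', hn'⟩ := hpair t hlt
      apply hne
      apply hinj
      have hrr : r t = r t₀ := by have := hr t; omega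
      have hg' := hn t
      rw [hrr, ← hg₀] at hg'
      have := Nat.cast_injective hg'
      have hqq : q' = q := by omega
      change Finsupp.single b (r t) + expo (l t) = Finsupp.single b (r t₀) + expo (l t₀)
      rw [hrr, hl', hl₀, hqq]
  · rw [show w = fun t => MvPolynomial.monomial (e t) 1 from
      funext fun t => hw t fun h => hex ⟨t, h⟩]
    exact MvPolynomial.isRaiseBasis_monomial hinj he

/-- For `i < b` both sides vanish: `x^i` is zero and `p` does not involve `y_i`. -/
theorem vecDeriv_vec_ex {m : ℕ} {n : ℤ} {p : MvPolynomial ℕ K} (hp : p ∈ polys K b m n) (i : ℕ) :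
    vecDeriv (c.vec (c.ex i)) p = pderiv i p := by
  rcases Nat.lt_or_ge i b with hi | hi
  · rw [c.ex_of_lt hi, map_zero, MvPolynomial.vecDeriv_zero, Derivation.zero_apply]
    ext μ
    rw [MvPolynomial.coeff_pderiv, MvPolynomial.coeff_zero]
    by_contra h
    have := (hp _ (left_ne_zero_of_mul (Ne.symm h))).1 i hi
    simp at this
  · rw [c.vec_ex hi, MvPolynomial.vecDeriv_single]

theorem xiForm_two_apply {n : ℤ} {p : MvPolynomial ℕ K} (hp : p ∈ polys K b 2 n) (i j : ℕ) :
    c.xiForm 2 p ![c.eX, c.ex i, c.ex j] = MvPolynomial.coeff 0 (pderiv i (pderiv j p)) := by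
  refine (c.xiForm_cons 2 p ![c.ex i, c.ex j] fun s => ?_).trans ?_
  · fin_cases s
    · exact c.xi_ex i
    · exact c.xi_ex j
  · rw [oddForm_apply, MvPolynomial.polar_apply,
      show (Finset.univ : Finset (Fin 2)) = insert 0 (insert 1 ∅) by decide,
      MvPolynomial.multiDeriv_insert (by decide), MvPolynomial.multiDeriv_insert (by decide),
      MvPolynomial.multiDeriv_empty]
    change MvPolynomial.coeff 0 (vecDeriv (c.vec (c.ex i)) (vecDeriv (c.vec (c.ex j)) p)) = _
    rw [MvPolynomial.vecDeriv_comm, c.vecDeriv_vec_ex hp, ← MvPolynomial.vecDeriv_single,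
      MvPolynomial.vecDeriv_comm, c.vecDeriv_vec_ex hp, MvPolynomial.vecDeriv_single,
      ← MvPolynomial.vecDeriv_single, ← MvPolynomial.vecDeriv_single, MvPolynomial.vecDeriv_comm]

/-- The values of `C(X) ∧ p` at `X, x^i, x^j` are the second derivatives of `p`, so the expression
in question is `pairForm`. -/
theorem mem_coboundaries_iff [CharZero K] {q : ℕ} (hb : b ≤ q + 1) (hq : q ≤ 4)
    {C : (Fin 3 → A) → K} (hC : C ∈ L.cocycles 3 (2 * q + 1)) :
    C ∈ L.coboundaries 3 (2 * q + 1) ↔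
      aThree K q (fun i j => C ![c.eX, c.ex i, c.ex j]) = 0 := by
  rw [c.cocycles_eq] at hC
  obtain ⟨p, hp, rfl⟩ := hC
  rw [c.xiForm_mem_coboundaries_iff hp]
  have hn : (2 * q + 1 + 1 : ℤ) = ((2 * q + 2 : ℕ) : ℤ) := by push_cast; ring
  rw [hn] at hp ⊢
  rw [MvPolynomial.mem_raised_iff hb hq hp, MvPolynomial.pairForm_apply]
  simp only [c.xiForm_two_apply hp]

end Coordinates

end GradedLieSuperalgebra

/-! ### The generating cocycles of SB(1) and their images in SLe(1) -/

namespace Buttin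

open MvPolynomial (pairPoly)
open NormalLists

variable (K : Type*) [Field K]

theorem numSB_eq_ite : ∀ m < 10, ∀ g ≤ (10 : ℤ), numSB (m + 1) g =
    if 0 ≤ g + 1 then (table 0 m (g + 1).toNat).length else 0 := by
  intro m hm g hg
  split_ifs with h
  · rw [← numSB_eq m hm (g + 1).toNat (by omega), Int.toNat_of_nonneg h, add_sub_cancel_right]
  · interval_cases m <;> simp only [numSB] <;> split_ifs <;> omega

theorem numSLe_eq_ite : ∀ m < 10, ∀ g ≤ (10 : ℤ), numSLe (m + 1) g =
    if 0 ≤ g + 1 then (table 1 m (g + 1).toNat).length else 0 := by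
  intro m hm g hg
  split_ifs with h
  · rw [← numSLe_eq m hm (g + 1).toNat (by omega), Int.toNat_of_nonneg h, add_sub_cancel_right]
  · interval_cases m <;> simp only [numSLe] <;> split_ifs <;> omega

theorem pairPoly_one_zero [CharZero K] :
    pairPoly K 1 0 = -(MvPolynomial.X 1 * (MvPolynomial.X 1 * 1)) := by
  simp [pairPoly, aThree]

theorem pairPoly_one_zero_mem : pairPoly K 1 0 ∈ MvPolynomial.polys K 1 2 ((2 * 0 + 2 : ℕ) : ℤ) := by
  simpa using MvPolynomial.X_pow_mul_pairPoly_mem (K := K) (r := 0) (le_refl 1)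

variable [CharZero K]

/-- The generating cocycles. -/
def genCocycle : (k : ℕ) → ℤ → ℕ → (Fin k → SBSpace K) → K
  | 0, _, _ => 0
  | m + 1, g, j => (coordsSB K).xiForm m (polyOf 0 ((table 0 m (g + 1).toNat).getD j []))

theorem xiForm_zero_one : (coordsSB K).xiForm 0 1 = ofLin (dualX K) := by
  funext a
  rw [GradedLieSuperalgebra.Coordinates.xiForm_apply, Fin.sum_univ_one,
    show (Finset.univ : Finset (Fin 1)).erase 0 = ∅ by decide, MvPolynomial.polar_apply,
    MvPolynomial.multiDeriv_empty, MvPolynomial.coeff_zero_one, mul_one]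
  rw [Fin.val_zero, pow_zero, one_mul]
  rfl

theorem cXxx_eq (i j : ℕ) :
    cXxx K i j = (coordsSB K).xiForm 2 (MvPolynomial.X j * (MvPolynomial.X i * 1)) := by
  rw [cXxx, ← xiForm_zero_one]
  exact (congrArg (fun C => (SB K).wedge C (dualx K j)) ((coordsSB K).wedge_xiForm 0 i 1)).trans
    ((coordsSB K).wedge_xiForm 1 j _)

theorem genCocycle_one : genCocycle K 1 (-1) 0 = ofLin (dualX K) := by
  rw [← xiForm_zero_one]
  rfl

theorem genCocycle_three_eq_pairPoly {m : ℕ} (hm : m ≤ 4) :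
    genCocycle K 3 (2 * m + 1) 0 = (coordsSB K).xiForm 2 (pairPoly K 0 m) := by
  -- The two entries are equal and add up to the weight `2m + 2`, so this is the only list.
  have h : (table 0 2 (2 * (m : ℤ) + 1 + 1).toNat).getD 0 [] = [m + 1, m + 1] := by
    rw [show (2 * (m : ℤ) + 1 + 1).toNat = 2 * m + 2 by omega]
    interval_cases m <;> decide
  rw [genCocycle, h]
  rfl

theorem genCocycle_three {m : ℕ} (hm : m ≤ 4) :
    genCocycle K 3 (2 * m + 1) 0 = aThree K m (cXxx K) := by
  rw [genCocycle_three_eq_pairPoly K hm, pairPoly, map_aThree]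
  refine aThree_congr fun i _ => ?_
  rw [if_pos (Nat.zero_le i), cXxx_eq, mul_one, mul_comm]

theorem xiForm_X_zero_mul (m : ℕ) (p : MvPolynomial ℕ K) :
    (coordsSLe K).xiForm (m + 1) (MvPolynomial.X 0 * p) = 0 := by
  rw [← (coordsSLe K).wedge_xiForm, (coordsSLe K).y_of_lt 0 one_pos]
  funext a
  simp [GradedLieSuperalgebra.wedge]

/-- The polynomials differ only in the term `y_0 y_{2q+2}`, and `y_0` is zero on SLe(1). -/
theorem xiForm_pairPoly_zero (q : ℕ) :
    (coordsSLe K).xiForm 2 (pairPoly K 0 q) = (coordsSLe K).xiForm 2 (pairPoly K 1 q) := by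
  rw [pairPoly, pairPoly, map_aThree, map_aThree]
  refine aThree_congr fun i _ => ?_
  rw [if_pos (Nat.zero_le i)]
  cases i with
  | zero => rw [if_neg (by omega), map_zero, xiForm_X_zero_mul]
  | succ i => rw [if_pos (by omega)]

/-- The list is the same for both algebras; its polynomial depends on `b` only for length two, where
the difference is invisible on SLe(1). -/
theorem deleteOne_genCocycle {m : ℕ} {g : ℤ} {j : ℕ} (hj : j < (table 1 m (g + 1).toNat).length) :
    deleteOne (genCocycle K (m + 1) g j) =
      (coordsSLe K).xiForm m (polyOf 1 ((table 1 m (g + 1).toNat).getD j [])) := by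
  rw [genCocycle, deleteOne_xiForm, getD_table_one hj]
  have hlen := ((mem_table le_rfl _ _ _).1 (getD_mem hj)).1
  by_cases h : m = 2
  · subst h
    obtain ⟨p, p', h⟩ := List.length_eq_two.1 hlen
    rw [h]
    exact xiForm_pairPoly_zero K (p - 1)
  · rw [polyOf_of_length_ne (by omega), polyOf_of_length_ne (by omega)]

theorem deleteOne_genCocycle_three_one :
    deleteOne (genCocycle K 3 1 0) = (coordsSLe K).xiForm 2 (pairPoly K 1 0) := by
  have h := genCocycle_three_eq_pairPoly K (Nat.zero_le 4)
  simp only [Nat.cast_zero, mul_zero, zero_add] at h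
  rw [h, deleteOne_xiForm, xiForm_pairPoly_zero]

theorem deleteOne_genCocycle_three_one_eq : deleteOne (genCocycle K 3 1 0) =
    -(SLe K).wedge ((SLe K).wedge (deleteOne (genCocycle K 1 (-1) 0)) (dualx K 1 ∘ₗ lift K))
      (dualx K 1 ∘ₗ lift K) := by
  rw [deleteOne_genCocycle_three_one, pairPoly_one_zero, map_neg, genCocycle_one,
    ← xiForm_zero_one, deleteOne_xiForm]
  exact congrArg Neg.neg (((congrArg (fun C => (SLe K).wedge C (dualx K 1 ∘ₗ lift K))
    ((coordsSLe K).wedge_xiForm 0 1 1)).trans ((coordsSLe K).wedge_xiForm 1 1 _)).symm)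

theorem deleteOne_genCocycle_three_one_mem :
    deleteOne (genCocycle K 3 1 0) ∈ (SLe K).cocycles 3 1 := by
  rw [deleteOne_genCocycle_three_one, (coordsSLe K).cocycles_eq]
  exact ⟨_, pairPoly_one_zero_mem K, rfl⟩

/-- The form `pairForm` with `q = 0` vanishes on coboundaries but not on the polynomial `-y_1²`. -/
theorem deleteOne_genCocycle_three_one_notMem :
    deleteOne (genCocycle K 3 1 0) ∉ (SLe K).coboundaries 3 1 := by
  rw [deleteOne_genCocycle_three_one,
    (coordsSLe K).xiForm_mem_coboundaries_iff (pairPoly_one_zero_mem K)]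
  intro h
  have h' := (MvPolynomial.mem_raised_iff (le_refl 1) (Nat.zero_le 4)
    (pairPoly_one_zero_mem K)).1 h
  have hne := MvPolynomial.pairFormDeriv_pairPoly_ne_zero (K := K) 0 (le_refl (0 + 1))
  rw [pow_zero, one_mul] at hne
  exact hne h'

end Buttin

end

theorem mainTheorem4 (K : Type*) [Field K] [CharZero K] :
    ∃ a : (k : ℕ) → ℤ → ℕ → (Fin k → Buttin.SBSpace K) → K,
      -- the explicit cocycles
      a 1 (-1) 0 = Buttin.ofLin (Buttin.dualX K) ∧
      (∀ m : ℕ, m ≤ 4 → a 3 (2 * m + 1) 0 = Buttin.aThree K m (Buttin.cXxx K)) ∧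
      -- the table for `SB(1)`
      (∀ (k : ℕ) (g : ℤ), 1 ≤ k → k ≤ 10 → g ≤ 10 →
        (SB K).Generates (Buttin.dualx K 0) 0 Buttin.numSB a k g) ∧
      -- the table for `SLe(1)`
      (∀ (k : ℕ) (g : ℤ), 1 ≤ k → k ≤ 10 → g ≤ 10 →
        (SLe K).Generates (Buttin.dualx K 1 ∘ₗ Buttin.lift K) 1 Buttin.numSLe
          (fun k g j => Buttin.deleteOne (a k g j)) k g) ∧
      -- the remaining mark of the table: `a^3_1` gives the nontrivial cocycle `-C(X, x, x)` of
      -- `SLe(1)`, which is a consequence of `C(X)`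
      (Buttin.deleteOne (a 3 1 0) =
          -(SLe K).wedge ((SLe K).wedge (Buttin.deleteOne (a 1 (-1) 0))
            (Buttin.dualx K 1 ∘ₗ Buttin.lift K)) (Buttin.dualx K 1 ∘ₗ Buttin.lift K) ∧
        Buttin.deleteOne (a 3 1 0) ∈ (SLe K).cocycles 3 1 ∧
        Buttin.deleteOne (a 3 1 0) ∉ (SLe K).coboundaries 3 1) ∧
      -- the expressions `a^3_{2m+1}` as linear forms in the values of a cocycle
      (∀ m : ℕ, m ≤ 4 → ∀ C ∈ (SB K).cocycles 3 (2 * m + 1),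
        (C ∈ (SB K).coboundaries 3 (2 * m + 1) ↔
          Buttin.aThree K m (fun i j => C ![Buttin.elX K, Buttin.elx K i, Buttin.elx K j]) = 0)) ∧
      (∀ m : ℕ, m ≤ 4 → ∀ C ∈ (SLe K).cocycles 3 (2 * m + 1),
        (C ∈ (SLe K).coboundaries 3 (2 * m + 1) ↔
          Buttin.aThree K m (fun i j => C ![(Buttin.center K).mkQ (Buttin.elX K),
            (Buttin.center K).mkQ (Buttin.elx K i), (Buttin.center K).mkQ (Buttin.elx K j)]) = 0)) := by
  refine ⟨Buttin.genCocycle K, Buttin.genCocycle_one K, fun m hm => Buttin.genCocycle_three K hm,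
    fun k g hk hk' hg => ?_, fun k g hk hk' hg => ?_,
    ⟨Buttin.deleteOne_genCocycle_three_one_eq K, Buttin.deleteOne_genCocycle_three_one_mem K,
      Buttin.deleteOne_genCocycle_three_one_notMem K⟩,
    fun m hm C hC => (Buttin.coordsSB K).mem_coboundaries_iff (Nat.zero_le _) hm hC,
    fun m hm C hC => (Buttin.coordsSLe K).mem_coboundaries_iff (Nat.le_add_left 1 m) hm hC⟩
  · exact (Buttin.coordsSB K).generates (Nat.zero_le 1) (fun _ => rfl) Buttin.numSB_eq_ite
      (fun _ _ _ _ => rfl) rfl hk hk' hg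
  · exact (Buttin.coordsSLe K).generates le_rfl (fun _ => rfl) Buttin.numSLe_eq_ite
      (fun _ _ _ hj => Buttin.deleteOne_genCocycle K hj) rfl hk hk' hg
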